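/- Let $(\Omega,\mathcal F,\mathbb P)$ be a probability space, $X:\Omega\to\mathbb R^d$ and $Y:\Omega\to\mathbb R^p$ random variables, $f:\mathbb R^p\to\mathbb R$ measurable with $\mathbb E[f(Y)^2]<\infty$, and $u:\mathbb R^d\to\mathbb R^q$ measurable. For $\theta\in\mathbb R^q$ put $v^\infty(\theta)=\mathbb E\big[(\theta\cdot u(X)-\mathbb E[f(Y)|X])^2\big]$. Let $H=2\,\mathbb E[u(X)u(X)^T]$ and assume that - $H$ is positive definite, and set $\theta^\star=2H^{-1}\mathbb E[f(Y)u(X)]$; - for some $\eta>0$, $\mathbb E[|u(X)|^{4+\eta}]<\infty$ and $\mathbb E[|f(Y)u(X)|^{2+\eta}]<\infty$; - $\epsilon>0$ is such that $H-2\epsilon I_q$ is positive definite. Let $(X_i)_{i\ge1}$ and $(Y_i^{(k)})_{i,k\ge 1}$ be a nested sample: the sequences $(X_i,(Y_i^{(k)})_{k\ge1})$ are independent over $i$, $X_i$ has the law of $X$, and given $X_i=x$ the $Y_i^{(k)}$, $k\ge1$, are i.i.d. with law $\mathcal L(Y|X=x)$. For a symmetric matrix $S$, let $S\vee(\epsilon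 I_q)$ be the matrix with the same eigenvectors in which each eigenvalue $\lambda$ is replaced by $\max(\lambda,\epsilon)$, and for $N,K\ge1$ let $$\theta^{K,\epsilon}_N=2\Big(\Big(\tfrac2N\sum_{i=1}^N u(X_i)u(X_i)^T\Big)\vee(\epsilon I_q)\Big)^{-1}\Big(\tfrac1N\sum_{i=1}^N\Big(\tfrac1K\sum_{k=1}^K f(Y_i^{(k)})\Big)u(X_i)\Big).$$ Let $\Gamma^K=A+B/K$ with $A=\mathbb E[(\theta^\star\cdot u(X)-\mathbb E[f(Y)|X])^2u(X)u(X)^T]$ and $B=\mathbb E[(f(Y)-\mathbb E[f(Y)|X])^2u(X)u(X)^T]$. Then for every fixed $K\ge1$, as $N\to\infty$: 1. $\theta^{K,\epsilon}_N\to\theta^\star$ almost surely; 2. $\sqrt N(\theta^{K,\epsilon}_N-\theta^\star)$ converges in law to $\mathcal N(0,4H^{-1}\Gamma^KH^{-1})$; 3. the sequence $N\big(v^\infty(\theta^{K,\epsilon}_N)-v^\infty(\theta^\star)\big)$, $N\ge1$, is uniformly integrable; 4. $v^\infty(\theta^{K,\epsilon}_N)$ is integrable for every $N$ and $$\mathbb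 E[v^\infty(\theta^{K,\epsilon}_N)]=v^\infty(\theta^\star)+\frac{2\operatorname{tr}(\Gamma^KH^{-1})}{N}+o(1/N).$$ Moreover, suppose $A\neq0$ and let $\kappa>0$ (the cost of one draw from $\mathcal L(Y|X)$, one draw of $X$ costing $1$). For $x\ge 0$ let $\nu(x)$ be the least integer $n\ge1$ with $x\le n(n+1)$ (so for $x>0$ it is the unique $n\ge1$ with $(n-1)n<x\le n(n+1)$, and $\nu(0)=1$). Then $$K^\star=\nu\Big(\frac{\operatorname{tr}(BH^{-1})}{\kappa\operatorname{tr}(AH^{-1})}\Big),\qquad N^\star=N^\star(c)=\Big\lfloor\frac{c}{1+K^\star\kappa}\Big\rfloor$$ is an asymptotically optimal allocation of the budget $c$ as $c\to\infty$: for all large $c$ one has $N^\star,K^\star\ge1$ and $N^\star+N^\star K^\star\kappa\le c$, and $$\mathbb E[v^\infty(\theta^{K^\star,\epsilon}_{N^\star})]-v^\infty(\theta^\star)\ \underset{c\to\infty}{\sim}\ \inf_{N,K\ge1,\;N+NK\kappa\le c}\Big(\mathbb E[v^\infty(\theta^{K,\epsilon}_N)]-v^\infty(\theta^\star)\Big).$$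 -/

import Mathlib

open MeasureTheory ProbabilityTheory Filter Topology
open scoped Matrix

namespace NestedRegression

noncomputable section

/-! ### Floor of a symmetric matrix and the integer `ν(x)` -/

/-- `S ∨ (ε I)`: for symmetric `S`, the matrix with the same eigenvectors as `S` in which every
eigenvalue `l` is replaced by `max l ε` (see `eigenFloor_mulVec`). -/
def eigenFloor {q : ℕ} (S : Matrix (Fin q) (Fin q) ℝ) (ε : ℝ) : Matrix (Fin q) (Fin q) ℝ :=
  cfc (fun l : ℝ => max l ε) S

/-- The defining property of `S ∨ (ε I)`. -/
theorem eigenFloor_mulVec {q : ℕ} {S : Matrix (Fin q) (Fin q) ℝ} (hS : S.IsHermitian) (ε : ℝ)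
    {l : ℝ} {v : Fin q → ℝ} (hv : S *ᵥ v = l • v) :
    eigenFloor S ε *ᵥ v = max l ε • v := by
  set U : Matrix (Fin q) (Fin q) ℝ := (hS.eigenvectorUnitary : Matrix (Fin q) (Fin q) ℝ) with hU
  have hUU : star U * U = 1 := Unitary.coe_star_mul_self hS.eigenvectorUnitary
  have hUU' : U * star U = 1 := Unitary.coe_mul_star_self hS.eigenvectorUnitary
  have hspec : S = U * Matrix.diagonal hS.eigenvalues * star U := by
    have h := hS.spectral_theorem
    rw [Unitary.conjStarAlgAut_apply] at h
    exact h
  have hfl : eigenFloor S ε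
      = U * Matrix.diagonal (fun i => max (hS.eigenvalues i) ε) * star U := by
    rw [eigenFloor, hS.cfc_eq, Matrix.IsHermitian.cfc, Unitary.conjStarAlgAut_apply]
    rfl
  set w := star U *ᵥ v with hw
  have h1 : Matrix.diagonal hS.eigenvalues *ᵥ w = l • w := by
    have h2 : star U *ᵥ (S *ᵥ v) = l • w := by rw [hv, Matrix.mulVec_smul]
    have h3 : star U * S = Matrix.diagonal hS.eigenvalues * star U := by
      conv_lhs => rw [hspec]
      rw [← mul_assoc, ← mul_assoc, hUU, one_mul]
    rw [Matrix.mulVec_mulVec, h3, ← Matrix.mulVec_mulVec] at h2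
    exact h2
  have h4 : Matrix.diagonal (fun i => max (hS.eigenvalues i) ε) *ᵥ w = max l ε • w := by
    ext i
    have h5 := congrFun h1 i
    simp only [Matrix.mulVec_diagonal, Pi.smul_apply, smul_eq_mul] at h5 ⊢
    rcases mul_eq_mul_right_iff.mp h5 with h | h
    · rw [h]
    · simp [h]
  rw [hfl, ← Matrix.mulVec_mulVec, ← Matrix.mulVec_mulVec, ← hw, h4, Matrix.mulVec_smul, hw,
    Matrix.mulVec_mulVec, hUU', Matrix.one_mulVec]

/-- `ν(x)`: the least integer `n ≥ 1` such that `x ≤ n (n + 1)`. For `x > 0` this is the unique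
integer `n ≥ 1` with `(n - 1) n < x ≤ n (n + 1)` (see `nu_eq_iff`), and `ν(0) = 1`. -/
def nu (x : ℝ) : ℕ := sInf {n : ℕ | 1 ≤ n ∧ x ≤ (n : ℝ) * (n + 1)}

theorem nu_spec (x : ℝ) : 1 ≤ nu x ∧ x ≤ (nu x : ℝ) * (nu x + 1) := by
  refine Nat.sInf_mem (s := {n : ℕ | 1 ≤ n ∧ x ≤ (n : ℝ) * (n + 1)}) ?_
  obtain ⟨n, hn⟩ := exists_nat_ge x
  refine ⟨n + 1, by omega, ?_⟩
  push_cast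
  nlinarith [(Nat.cast_nonneg n : (0 : ℝ) ≤ n)]

theorem nu_eq_iff {x : ℝ} (hx : 0 < x) (n : ℕ) :
    nu x = n ↔ 1 ≤ n ∧ ((n : ℝ) - 1) * n < x ∧ x ≤ (n : ℝ) * (n + 1) := by
  constructor
  · rintro rfl
    obtain ⟨h1, h2⟩ := nu_spec x
    refine ⟨h1, ?_, h2⟩
    by_contra! h
    obtain ⟨m, hm⟩ : ∃ m, nu x = m + 1 := ⟨nu x - 1, by omega⟩
    rw [hm] at h
    push_cast at h
    have hm0 : 1 ≤ m := by
      rcases Nat.eq_zero_or_pos m with h0 | h0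
      · subst h0; norm_num at h; linarith
      · exact h0
    have : nu x ≤ m := Nat.sInf_le ⟨hm0, by linarith⟩
    omega
  · rintro ⟨h1, h2, h3⟩
    apply le_antisymm
    · exact Nat.sInf_le ⟨h1, h3⟩
    · by_contra! h
      obtain ⟨-, h5⟩ := nu_spec x
      have h6 : (nu x : ℝ) + 1 ≤ n := by exact_mod_cast h
      nlinarith [(Nat.cast_nonneg (nu x) : (0 : ℝ) ≤ (nu x : ℝ))]

theorem nu_zero : nu 0 = 1 := by
  apply le_antisymm
  · exact Nat.sInf_le ⟨le_rfl, by norm_num⟩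
  · exact (nu_spec 0).1

/-! ### The regression problem -/

section Population

variable {d p q : ℕ} {Ω : Type*} [MeasurableSpace Ω]

/-- `E[f(Y) | X]`. -/
def condMean (P : Measure Ω) (X : Ω → EuclideanSpace ℝ (Fin d))
    (Y : Ω → EuclideanSpace ℝ (Fin p)) (f : EuclideanSpace ℝ (Fin p) → ℝ) : Ω → ℝ :=
  P[fun ω => f (Y ω) | MeasurableSpace.comap X inferInstance]

/-- `v^∞(θ) = E[(θ · u(X) - E[f(Y) | X])²]`. -/
def vInf (P : Measure Ω) (X : Ω → EuclideanSpace ℝ (Fin d))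
    (Y : Ω → EuclideanSpace ℝ (Fin p)) (f : EuclideanSpace ℝ (Fin p) → ℝ)
    (u : EuclideanSpace ℝ (Fin d) → EuclideanSpace ℝ (Fin q))
    (θ : EuclideanSpace ℝ (Fin q)) : ℝ :=
  ∫ ω, (inner ℝ θ (u (X ω)) - condMean P X Y f ω) ^ 2 ∂P

/-- `H = 2 E[u(X) u(X)ᵀ]`. -/
def matH (P : Measure Ω) (X : Ω → EuclideanSpace ℝ (Fin d))
    (u : EuclideanSpace ℝ (Fin d) → EuclideanSpace ℝ (Fin q)) : Matrix (Fin q) (Fin q) ℝ :=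
  Matrix.of fun i j => 2 * ∫ ω, u (X ω) i * u (X ω) j ∂P

/-- `θ⋆ = 2 H⁻¹ E[f(Y) u(X)]`. -/
def thetaStar (P : Measure Ω) (X : Ω → EuclideanSpace ℝ (Fin d))
    (Y : Ω → EuclideanSpace ℝ (Fin p)) (f : EuclideanSpace ℝ (Fin p) → ℝ)
    (u : EuclideanSpace ℝ (Fin d) → EuclideanSpace ℝ (Fin q)) : EuclideanSpace ℝ (Fin q) :=
  (2 : ℝ) • Matrix.toEuclideanLin (matH P X u)⁻¹ (∫ ω, f (Y ω) • u (X ω) ∂P)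

/-- `A = E[(θ⋆ · u(X) - E[f(Y) | X])² u(X) u(X)ᵀ]`. -/
def matA (P : Measure Ω) (X : Ω → EuclideanSpace ℝ (Fin d))
    (Y : Ω → EuclideanSpace ℝ (Fin p)) (f : EuclideanSpace ℝ (Fin p) → ℝ)
    (u : EuclideanSpace ℝ (Fin d) → EuclideanSpace ℝ (Fin q)) : Matrix (Fin q) (Fin q) ℝ :=
  Matrix.of fun i j =>
    ∫ ω, (inner ℝ (thetaStar P X Y f u) (u (X ω)) - condMean P X Y f ω) ^ 2
      * (u (X ω) i * u (X ω) j) ∂P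

/-- `B = E[(f(Y) - E[f(Y) | X])² u(X) u(X)ᵀ]`. -/
def matB (P : Measure Ω) (X : Ω → EuclideanSpace ℝ (Fin d))
    (Y : Ω → EuclideanSpace ℝ (Fin p)) (f : EuclideanSpace ℝ (Fin p) → ℝ)
    (u : EuclideanSpace ℝ (Fin d) → EuclideanSpace ℝ (Fin q)) : Matrix (Fin q) (Fin q) ℝ :=
  Matrix.of fun i j =>
    ∫ ω, (f (Y ω) - condMean P X Y f ω) ^ 2 * (u (X ω) i * u (X ω) j) ∂P

/-- `Γ^K = A + B / K`. -/
def matGamma (P : Measure Ω) (X : Ω → EuclideanSpace ℝ (Fin d))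
    (Y : Ω → EuclideanSpace ℝ (Fin p)) (f : EuclideanSpace ℝ (Fin p) → ℝ)
    (u : EuclideanSpace ℝ (Fin d) → EuclideanSpace ℝ (Fin q)) (K : ℕ) :
    Matrix (Fin q) (Fin q) ℝ :=
  matA P X Y f u + (K : ℝ)⁻¹ • matB P X Y f u

end Population

/-! ### The sample and the estimator -/

/-- The nested sample: the pairs `(X_i, (Y_i^{(k)})_k)` are independent over `i`; each `X_i` has the
law of `X`; given `X_i = x`, the variables `Y_i^{(k)}` are independent over `k` with common law
`L(Y | X = x)`, i.e. the finite-dimensional laws of `(X_i, (Y_i^{(k)})_k)` are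
`P_X(dx) ∏_k L(Y | X = x)(dy_k)`. -/
structure IsNestedSample {d p : ℕ} {Ω Ω' : Type*} [MeasurableSpace Ω] [MeasurableSpace Ω']
    (P : Measure Ω) [IsProbabilityMeasure P] (X : Ω → EuclideanSpace ℝ (Fin d))
    (Y : Ω → EuclideanSpace ℝ (Fin p)) (P' : Measure Ω')
    (Xs : ℕ → Ω' → EuclideanSpace ℝ (Fin d)) (Ys : ℕ → ℕ → Ω' → EuclideanSpace ℝ (Fin p)) :
    Prop where
  measurable_X : ∀ i, Measurable (Xs i)
  measurable_Y : ∀ i k, Measurable (Ys i k)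
  indep : iIndepFun (fun i ω => (Xs i ω, fun k => Ys i k ω)) P'
  law : ∀ (i n : ℕ) (s : Set (EuclideanSpace ℝ (Fin d)))
    (t : ℕ → Set (EuclideanSpace ℝ (Fin p))), MeasurableSet s → (∀ k, MeasurableSet (t k)) →
    P' {ω | Xs i ω ∈ s ∧ ∀ k < n, Ys i k ω ∈ t k}
      = ∫⁻ x in s, ∏ k ∈ Finset.range n, condDistrib Y X P x (t k) ∂(P.map X)

section Sample

variable {d p q : ℕ} {Ω' : Type*}

/-- `(2 / N) ∑_{i < N} u(X_i) u(X_i)ᵀ`. -/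
def empH (u : EuclideanSpace ℝ (Fin d) → EuclideanSpace ℝ (Fin q))
    (Xs : ℕ → Ω' → EuclideanSpace ℝ (Fin d)) (N : ℕ) (ω : Ω') : Matrix (Fin q) (Fin q) ℝ :=
  Matrix.of fun a b => 2 / (N : ℝ) * ∑ i ∈ Finset.range N, u (Xs i ω) a * u (Xs i ω) b

/-- `(1 / N) ∑_{i < N} ((1 / K) ∑_{k < K} f(Y_i^{(k)})) u(X_i)`. -/
def empMoment (f : EuclideanSpace ℝ (Fin p) → ℝ)
    (u : EuclideanSpace ℝ (Fin d) → EuclideanSpace ℝ (Fin q))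
    (Xs : ℕ → Ω' → EuclideanSpace ℝ (Fin d)) (Ys : ℕ → ℕ → Ω' → EuclideanSpace ℝ (Fin p))
    (K N : ℕ) (ω : Ω') : EuclideanSpace ℝ (Fin q) :=
  (1 / (N : ℝ)) • ∑ i ∈ Finset.range N,
    ((1 / (K : ℝ)) * ∑ k ∈ Finset.range K, f (Ys i k ω)) • u (Xs i ω)

/-- The eigenvalue-floored least-squares estimator `θ_N^{K,ε}`. -/
def thetaHat (f : EuclideanSpace ℝ (Fin p) → ℝ)
    (u : EuclideanSpace ℝ (Fin d) → EuclideanSpace ℝ (Fin q))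
    (Xs : ℕ → Ω' → EuclideanSpace ℝ (Fin d)) (Ys : ℕ → ℕ → Ω' → EuclideanSpace ℝ (Fin p))
    (ε : ℝ) (K N : ℕ) (ω : Ω') : EuclideanSpace ℝ (Fin q) :=
  (2 : ℝ) • Matrix.toEuclideanLin (eigenFloor (empH u Xs N ω) ε)⁻¹ (empMoment f u Xs Ys K N ω)

end Sample

/-- The expected suboptimality `E[v^∞(θ_N^{K,ε})] - v^∞(θ⋆)`. -/
def meanExcess {d p q : ℕ} {Ω Ω' : Type*} [MeasurableSpace Ω] [MeasurableSpace Ω']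
    (P : Measure Ω) (X : Ω → EuclideanSpace ℝ (Fin d)) (Y : Ω → EuclideanSpace ℝ (Fin p))
    (f : EuclideanSpace ℝ (Fin p) → ℝ)
    (u : EuclideanSpace ℝ (Fin d) → EuclideanSpace ℝ (Fin q)) (P' : Measure Ω')
    (Xs : ℕ → Ω' → EuclideanSpace ℝ (Fin d)) (Ys : ℕ → ℕ → Ω' → EuclideanSpace ℝ (Fin p))
    (ε : ℝ) (K N : ℕ) : ℝ :=
  ∫ ω, vInf P X Y f u (thetaHat f u Xs Ys ε K N ω) ∂P' - vInf P X Y f u (thetaStar P X Y f u)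

/-- The infimum of the expected suboptimality over all `N, K ≥ 1` of cost `N + N K κ ≤ c`. -/
def bestExcess {d p q : ℕ} {Ω Ω' : Type*} [MeasurableSpace Ω] [MeasurableSpace Ω']
    (P : Measure Ω) (X : Ω → EuclideanSpace ℝ (Fin d)) (Y : Ω → EuclideanSpace ℝ (Fin p))
    (f : EuclideanSpace ℝ (Fin p) → ℝ)
    (u : EuclideanSpace ℝ (Fin d) → EuclideanSpace ℝ (Fin q)) (P' : Measure Ω')
    (Xs : ℕ → Ω' → EuclideanSpace ℝ (Fin d)) (Ys : ℕ → ℕ → Ω' → EuclideanSpace ℝ (Fin p))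
    (ε κ c : ℝ) : ℝ :=
  sInf {e : ℝ | ∃ N K : ℕ, 1 ≤ N ∧ 1 ≤ K ∧ (N : ℝ) + N * K * κ ≤ c ∧
    e = meanExcess P X Y f u P' Xs Ys ε K N}

/-- `K⋆ = ν(tr(B H⁻¹) / (κ tr(A H⁻¹)))`. -/
def Kstar {d p q : ℕ} {Ω : Type*} [MeasurableSpace Ω]
    (P : Measure Ω) (X : Ω → EuclideanSpace ℝ (Fin d)) (Y : Ω → EuclideanSpace ℝ (Fin p))
    (f : EuclideanSpace ℝ (Fin p) → ℝ)
    (u : EuclideanSpace ℝ (Fin d) → EuclideanSpace ℝ (Fin q)) (κ : ℝ) : ℕ :=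
  nu ((matB P X Y f u * (matH P X u)⁻¹).trace / (κ * (matA P X Y f u * (matH P X u)⁻¹).trace))

/-- `N⋆ = ⌊c / (1 + K⋆ κ)⌋`. -/
def Nstar {d p q : ℕ} {Ω : Type*} [MeasurableSpace Ω]
    (P : Measure Ω) (X : Ω → EuclideanSpace ℝ (Fin d)) (Y : Ω → EuclideanSpace ℝ (Fin p))
    (f : EuclideanSpace ℝ (Fin p) → ℝ)
    (u : EuclideanSpace ℝ (Fin d) → EuclideanSpace ℝ (Fin q)) (κ c : ℝ) : ℕ :=
  ⌊c / (1 + (Kstar P X Y f u κ : ℝ) * κ)⌋₊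

end

end NestedRegression

set_option linter.unusedSectionVars false

namespace NestedRegression

/-! ### The eigenvalue floor -/

section EigenFloor

open scoped MatrixOrder

variable {q : ℕ} {S : Matrix (Fin q) (Fin q) ℝ} {ε : ℝ}

/-! Write `G` for the empirical Gram matrix, `F` for its floor, `m` for the empirical moment, `θ`
for the target, and `r = m - G θ / 2`. Then `r` is an average of i.i.d. scores `(w - θ · U) U`,
centered by the normal equation, with covariance `Γ^K` (`matGamma_apply`: residual and noises are
orthogonal, and averaging `K` noises divides `B` by `K`).

The estimator satisfies `θ_N - θ = 2 H⁻¹ r + R` with `R = 2 (F⁻¹ - H⁻¹) r - F⁻¹ (F - G) θ`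
(`linError_eq`). As `H ≥ 2 ε`, the floor is inactive once `|G - H| ≤ ε`, so `|R|² ≤ Δ (|r|² + |G -
H|²)` for a weight `Δ` that is bounded, because `F⁻¹ ≤ 1 / ε`, and tends to `0` almost surely
(`linError_sq_le`). Moreover `N (|r|² + |G - H|²)` is a finite sum of squares of normalized centered
i.i.d. sums, hence uniformly integrable; a truncation proves this from second moments
(`uniformTail_sq_sum`). Therefore `N E|R|² → 0` (`UniformTail.tendsto_lintegral_mul`).

The first four claims follow. Consistency is the strong law, and the limit law is the central limit
theorem for `2 H⁻¹ r` plus Slutsky. The excess risk is the quadratic form `(θ_N - θ)ᵀ H (θ_N - θ) /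
2` (`vInf_sub_vInf`): it is dominated by the uniformly integrable sequence, and differs by `o(1 /
N)` in mean from `2 rᵀ H⁻¹ r`, whose mean is exactly `2 tr(Γ H⁻¹) / N`.

The budget problem needs control uniform in `K`. The estimator is linear in the responses, with
weights depending on the covariates only, and given the covariates the noises are centered and
uncorrelated. Hence the mean excess risk is exactly `α N + β N / K` (`integral_quadForm_thetaHat`),
where `N α N → 2 tr(A H⁻¹)` and `N β N → 2 tr(B H⁻¹)`. If `A ≠ 0`, then `α N > 0` for every `N ≥ 1`
(`integral_quadForm_pos`), so small samples cannot compete under a large budget. What remains is to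
minimize `(1 + K κ) (a + b / K)` over integers, which `ν` does (`add_div_nu_le`). -/

theorem eigenFloor_isHermitian (S : Matrix (Fin q) (Fin q) ℝ) (ε : ℝ) :
    (eigenFloor S ε).IsHermitian :=
  cfc_predicate (fun l : ℝ => max l ε) S

theorem dotProduct_mulVec_mono {S T : Matrix (Fin q) (Fin q) ℝ} (h : S ≤ T) (v : Fin q → ℝ) :
    v ⬝ᵥ S *ᵥ v ≤ v ⬝ᵥ T *ᵥ v := by
  have := (Matrix.le_iff.mp h).dotProduct_mulVec_nonneg v
  rw [Matrix.sub_mulVec, dotProduct_sub] at this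
  simpa using this

theorem algebraMap_eq_smul_one (r : ℝ) :
    algebraMap ℝ (Matrix (Fin q) (Fin q) ℝ) r = r • 1 := Algebra.algebraMap_eq_smul_one r

theorem smul_one_le_eigenFloor (hS : S.IsHermitian) (ε : ℝ) :
    ε • (1 : Matrix (Fin q) (Fin q) ℝ) ≤ eigenFloor S ε := by
  rw [← algebraMap_eq_smul_one]
  exact algebraMap_le_cfc _ _ _ (fun x _ => le_max_right _ _) (by fun_prop) hS

theorem le_eigenFloor (hS : S.IsHermitian) (ε : ℝ) : S ≤ eigenFloor S ε := by
  conv_lhs => rw [← cfc_id ℝ S hS]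
  exact cfc_mono (fun x _ => le_max_left _ _) (by fun_prop) (by fun_prop)

theorem eigenFloor_eq_self (h : ε • (1 : Matrix (Fin q) (Fin q) ℝ) ≤ S)
    (hS : S.IsHermitian) : eigenFloor S ε = S := by
  conv_rhs => rw [← cfc_id ℝ S hS]
  refine cfc_congr fun x hx => ?_
  rw [← algebraMap_eq_smul_one] at h
  have : ε ≤ x := (algebraMap_le_iff_le_spectrum (R := ℝ) (a := S) (r := ε)).mp h x hx
  simp [this]

/-- On a nonnegative spectrum `max l ε - l` lies in `[0, ε]`; a negative eigenvalue would break the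
upper bound, hence `PosSemidef`. The squared form is the one that bounds `|(F - S) v|²`. -/
theorem sq_eigenFloor_sub_le (hS : S.PosSemidef) (hε : 0 ≤ ε) :
    (eigenFloor S ε - S) * (eigenFloor S ε - S) ≤ (ε ^ 2) • (1 : Matrix (Fin q) (Fin q) ℝ) := by
  have h1 : eigenFloor S ε - S = cfc (fun l : ℝ => max l ε - l) S := by
    conv_lhs => rhs; rw [← cfc_id ℝ S hS.1]
    rw [eigenFloor, cfc_sub (fun l : ℝ => max l ε) (fun l => l) S (by fun_prop) (by fun_prop)]
    rfl
  rw [h1, ← cfc_mul _ _ S (by fun_prop) (by fun_prop), ← algebraMap_eq_smul_one]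
  refine cfc_le_algebraMap _ _ _ (fun x hx => ?_) (by fun_prop) hS.1
  have hx0 : 0 ≤ x := spectrum_nonneg_of_nonneg hS.nonneg hx
  have h2 : 0 ≤ max x ε - x := by simp
  have h3 : max x ε - x ≤ ε := by
    rw [sub_le_iff_le_add]; exact max_le (by linarith) (by linarith)
  nlinarith

theorem dotProduct_eigenFloor_sub_mulVec_le (hS : S.PosSemidef) (hε : 0 ≤ ε) (v : Fin q → ℝ) :
    ((eigenFloor S ε - S) *ᵥ v) ⬝ᵥ ((eigenFloor S ε - S) *ᵥ v) ≤ ε ^ 2 * (v ⬝ᵥ v) := by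
  have h := dotProduct_mulVec_mono (sq_eigenFloor_sub_le hS hε) v
  have hT : (eigenFloor S ε - S)ᵀ = eigenFloor S ε - S := by
    have := (eigenFloor_isHermitian S ε).sub hS.1
    simpa [Matrix.IsHermitian, Matrix.conjTranspose_eq_transpose_of_trivial] using this
  rw [← Matrix.mulVec_mulVec, Matrix.dotProduct_mulVec, ← Matrix.mulVec_transpose, hT] at h
  simpa [Matrix.smul_mulVec] using h

theorem dotProduct_self_nonneg_real (v : Fin q → ℝ) : 0 ≤ v ⬝ᵥ v :=
  Finset.sum_nonneg fun i _ => mul_self_nonneg (v i)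

theorem eigenFloor_posDef (hS : S.IsHermitian) (hε : 0 < ε) : (eigenFloor S ε).PosDef := by
  refine Matrix.posDef_iff_dotProduct_mulVec.mpr ⟨eigenFloor_isHermitian S ε, fun v hv => ?_⟩
  have h := dotProduct_mulVec_mono (smul_one_le_eigenFloor hS ε) v
  have h1 : 0 < v ⬝ᵥ v := 
    (dotProduct_self_nonneg_real v).lt_of_ne' fun h0 => hv (dotProduct_self_eq_zero.mp h0)
  have h2 : v ⬝ᵥ (ε • (1 : Matrix (Fin q) (Fin q) ℝ)) *ᵥ v = ε * (v ⬝ᵥ v) := by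
    simp [Matrix.smul_mulVec]
  rw [h2] at h
  simpa using (mul_pos hε h1).trans_le h

theorem isUnit_det_eigenFloor (hS : S.IsHermitian) (hε : 0 < ε) :
    IsUnit (eigenFloor S ε).det :=
  (Matrix.isUnit_iff_isUnit_det _).mp (eigenFloor_posDef hS hε).isUnit

theorem dotProduct_sq_le (v w : Fin q → ℝ) : (v ⬝ᵥ w) ^ 2 ≤ (v ⬝ᵥ v) * (w ⬝ᵥ w) := by
  simpa [dotProduct, sq] using Finset.sum_mul_sq_le_sq_mul_sq Finset.univ v w

/-- With `v = F⁻¹ w`, coercivity gives `ε |v|² ≤ v · w`, and Cauchy–Schwarz finishes. -/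
theorem dotProduct_inv_eigenFloor_mulVec_le (hS : S.IsHermitian) (hε : 0 < ε) (w : Fin q → ℝ) :
    ((eigenFloor S ε)⁻¹ *ᵥ w) ⬝ᵥ ((eigenFloor S ε)⁻¹ *ᵥ w) ≤ (ε ^ 2)⁻¹ * (w ⬝ᵥ w) := by
  set v := (eigenFloor S ε)⁻¹ *ᵥ w with hv
  have hw : eigenFloor S ε *ᵥ v = w := by
    rw [hv, Matrix.mulVec_mulVec, Matrix.mul_nonsing_inv _ (isUnit_det_eigenFloor hS hε),
      Matrix.one_mulVec]
  have h := dotProduct_mulVec_mono (smul_one_le_eigenFloor hS ε) v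
  have h2 : v ⬝ᵥ (ε • (1 : Matrix (Fin q) (Fin q) ℝ)) *ᵥ v = ε * (v ⬝ᵥ v) := by
    simp [Matrix.smul_mulVec]
  rw [h2, hw] at h
  have h3 := dotProduct_sq_le v w
  have h4 := dotProduct_self_nonneg_real v
  have h5 := dotProduct_self_nonneg_real w
  rw [← div_eq_inv_mul, le_div_iff₀ (by positivity)]
  rcases h4.eq_or_lt with h0 | h0
  · rw [← h0]; simpa using h5
  · have h6 : (ε * (v ⬝ᵥ v)) ^ 2 ≤ (v ⬝ᵥ v) * (w ⬝ᵥ w) :=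
      (pow_le_pow_left₀ (by positivity) h 2).trans h3
    have h7 : (v ⬝ᵥ v) * ((v ⬝ᵥ v) * ε ^ 2) ≤ (v ⬝ᵥ v) * (w ⬝ᵥ w) := by nlinarith
    exact le_of_mul_le_mul_left h7 h0

theorem sq_inv_eigenFloor_apply_le (hS : S.IsHermitian) (hε : 0 < ε) (a b : Fin q) :
    ((eigenFloor S ε)⁻¹ a b) ^ 2 ≤ (ε ^ 2)⁻¹ := by
  have h := dotProduct_inv_eigenFloor_mulVec_le hS hε (Pi.single b 1)
  rw [Matrix.mulVec_single_one] at h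
  have h2 : (Pi.single b (1 : ℝ) : Fin q → ℝ) ⬝ᵥ Pi.single b 1 = 1 := by simp
  rw [h2, mul_one] at h
  refine le_trans ?_ h
  simp only [dotProduct, Matrix.col_apply, ← sq]
  exact Finset.single_le_sum (f := fun i => (eigenFloor S ε)⁻¹ i b ^ 2)
    (fun i _ => sq_nonneg _) (Finset.mem_univ a)

theorem abs_inv_eigenFloor_apply_le (hS : S.IsHermitian) (hε : 0 < ε) (a b : Fin q) :
    |(eigenFloor S ε)⁻¹ a b| ≤ ε⁻¹ := by
  have h := sq_inv_eigenFloor_apply_le hS hε a b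
  rw [← inv_pow] at h
  exact abs_le_of_sq_le_sq h (by positivity)

theorem dotProduct_mulVec_sq_le (T : Matrix (Fin q) (Fin q) ℝ) (v : Fin q → ℝ) :
    (T *ᵥ v) ⬝ᵥ (T *ᵥ v) ≤ (∑ a, ∑ b, T a b ^ 2) * (v ⬝ᵥ v) := by
  rw [Finset.sum_mul]
  refine Finset.sum_le_sum fun a _ => ?_
  have := dotProduct_sq_le (T a) v
  rw [← sq]
  refine this.trans (le_of_eq ?_)
  simp [dotProduct, sq]

/-- The Frobenius norm bounds the quadratic form of `S - H` by `ε |v|²`. Half of the margin `2 ε` of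
`H` absorbs it and the other half remains. -/
theorem smul_one_le_of_sum_sq_sub_le {H : Matrix (Fin q) (Fin q) ℝ} (hε : 0 ≤ ε)
    (hH : (H - (2 * ε) • (1 : Matrix (Fin q) (Fin q) ℝ)).PosSemidef) (hS : S.IsHermitian)
    (h : ∑ a, ∑ b, (S a b - H a b) ^ 2 ≤ ε ^ 2) : ε • (1 : Matrix (Fin q) (Fin q) ℝ) ≤ S := by
  refine Matrix.le_iff.mpr (Matrix.posSemidef_iff_dotProduct_mulVec.mpr ⟨?_, fun v => ?_⟩)
  · exact hS.sub (by simp [Matrix.IsHermitian])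
  · have h1 := hH.dotProduct_mulVec_nonneg v
    have h2 := dotProduct_mulVec_sq_le (S - H) v
    have h3 := dotProduct_sq_le v ((S - H) *ᵥ v)
    have h4 := dotProduct_self_nonneg_real v
    simp only [Matrix.sub_apply] at h2
    have h5 : (v ⬝ᵥ (S - H) *ᵥ v) ^ 2 ≤ (ε * (v ⬝ᵥ v)) ^ 2 := by
      calc _ ≤ (v ⬝ᵥ v) * (ε ^ 2 * (v ⬝ᵥ v)) :=
            h3.trans (mul_le_mul_of_nonneg_left (h2.trans (mul_le_mul_of_nonneg_right h h4)) h4)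
        _ = _ := by ring
    have h6 := (abs_le.mp (abs_le_of_sq_le_sq h5 (by positivity))).1
    simp only [star_trivial, Matrix.sub_mulVec, dotProduct_sub, Matrix.smul_mulVec,
      Matrix.one_mulVec, dotProduct_smul, smul_eq_mul] at h1 h6 ⊢
    linarith

theorem eigenFloor_eq_self_of_sum_sq_sub_le {H : Matrix (Fin q) (Fin q) ℝ} (hε : 0 ≤ ε)
    (hH : (H - (2 * ε) • (1 : Matrix (Fin q) (Fin q) ℝ)).PosSemidef) (hS : S.IsHermitian)
    (h : ∑ a, ∑ b, (S a b - H a b) ^ 2 ≤ ε ^ 2) : eigenFloor S ε = S :=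
  eigenFloor_eq_self (smul_one_le_of_sum_sq_sub_le hε hH hS h) hS

theorem measurable_aeval_apply {Ω : Type*} [MeasurableSpace Ω]
    {S : Ω → Matrix (Fin q) (Fin q) ℝ} (hS : ∀ a b, Measurable fun ω => S ω a b)
    (p : Polynomial ℝ) (a b : Fin q) :
    Measurable fun ω => (Polynomial.aeval (S ω) p) a b := by
  have hpow : ∀ (n : ℕ) (a b : Fin q), Measurable fun ω => (S ω ^ n) a b := by
    intro n
    induction n with
    | zero => intro a b; simp
    | succ n ih =>
      intro a b
      simp only [pow_succ, Matrix.mul_apply]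
      exact Finset.measurable_fun_sum _ fun c _ => (ih a c).mul (hS c b)
  simp only [Polynomial.aeval_eq_sum_range, Matrix.sum_apply, Matrix.smul_apply, smul_eq_mul]
  exact Finset.measurable_fun_sum _ fun n _ => (hpow n a b).const_mul _

/-- No measurable choice of eigenvectors is needed: polynomials in `S` have measurable entries, and
Weierstrass polynomials for `max · ε` on the growing intervals `[-n, n]` converge at each
eigenvalue, hence entrywise after diagonalization. -/
theorem measurable_eigenFloor_apply {Ω : Type*} [MeasurableSpace Ω]
    {S : Ω → Matrix (Fin q) (Fin q) ℝ} (hS : ∀ a b, Measurable fun ω => S ω a b)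
    (hSh : ∀ ω, (S ω).IsHermitian) (ε : ℝ) (a b : Fin q) :
    Measurable fun ω => eigenFloor (S ω) ε a b := by
  have hp : ∀ n : ℕ, ∃ p : Polynomial ℝ, ∀ x ∈ Set.Icc (-(n : ℝ)) n,
      |p.eval x - max x ε| < 1 / (n + 1) := fun n =>
    exists_polynomial_near_of_continuousOn _ _ (fun x => max x ε) (by fun_prop) _ (by positivity)
  choose p hp using hp
  have hlim : ∀ x : ℝ, Tendsto (fun n => (p n).eval x) atTop (𝓝 (max x ε)) := by
    intro x
    rw [tendsto_iff_dist_tendsto_zero]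
    refine squeeze_zero' (.of_forall fun _ => dist_nonneg) ?_
      tendsto_one_div_add_atTop_nhds_zero_nat
    obtain ⟨m, hm⟩ := exists_nat_ge |x|
    filter_upwards [eventually_ge_atTop m] with n hn
    have : |x| ≤ n := hm.trans (by exact_mod_cast hn)
    exact (hp n x ⟨(abs_le.mp this).1, (abs_le.mp this).2⟩).le
  refine measurable_of_tendsto_metrizable (fun n => measurable_aeval_apply hS (p n) a b) ?_
  refine tendsto_pi_nhds.mpr fun ω => ?_
  have hω := hSh ω
  have h1 : ∀ f : ℝ → ℝ, cfc f (S ω) = (hω.eigenvectorUnitary : Matrix (Fin q) (Fin q) ℝ)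
      * Matrix.diagonal (fun i => f (hω.eigenvalues i)) * star (hω.eigenvectorUnitary :
        Matrix (Fin q) (Fin q) ℝ) := by
    intro f
    rw [hω.cfc_eq, Matrix.IsHermitian.cfc, Unitary.conjStarAlgAut_apply]
    rfl
  have h2 : ∀ n, Polynomial.aeval (S ω) (p n) = cfc (fun x => (p n).eval x) (S ω) := fun n =>
    (cfc_polynomial (p n) (S ω) hω).symm
  simp only [h2, eigenFloor, h1]
  simp only [Matrix.mul_apply (N := star _), Matrix.mul_diagonal]
  exact tendsto_finsetSum _ fun c _ => (((hlim _).const_mul _).mul_const _)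

/-- Cramer's formula: adjugate entries and the determinant are polynomial in the entries. The
convention `0⁻¹ = 0` covers singular matrices. -/
theorem measurable_inv_apply {Ω : Type*} [MeasurableSpace Ω]
    {S : Ω → Matrix (Fin q) (Fin q) ℝ} (hS : ∀ a b, Measurable fun ω => S ω a b) (a b : Fin q) :
    Measurable fun ω => (S ω)⁻¹ a b := by
  have hdet : ∀ T : Ω → Matrix (Fin q) (Fin q) ℝ, (∀ a b, Measurable fun ω => T ω a b) →
      Measurable fun ω => (T ω).det := by
    intro T hT
    simp only [Matrix.det_apply]
    exact Finset.measurable_fun_sum _ fun σ _ =>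
      (Finset.measurable_fun_prod _ fun i _ => hT _ _).const_smul _
  simp only [Matrix.inv_def, Ring.inverse_eq_inv', Matrix.smul_apply, smul_eq_mul,
    Matrix.adjugate_apply]
  refine (hdet S hS).inv.mul (hdet _ fun c d => ?_)
  by_cases h : c = b
  · subst h; simp
  · simpa [Matrix.updateRow_ne h] using hS c d

end EigenFloor

/-! ### Uniform integrability through truncated excesses -/

section UniformTail

open scoped ENNReal

variable {Ω : Type*} [MeasurableSpace Ω] {μ : Measure Ω}

/-- The excesses `(g N - C)⁺` have small integrals, uniformly in `N`, for large `C`. -/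
def UniformTail (μ : Measure Ω) (g : ℕ → Ω → ℝ) : Prop :=
  ∀ δ : ℝ, 0 < δ → ∃ C : ℝ, 0 ≤ C ∧ ∀ N, ∫⁻ ω, ENNReal.ofReal (g N ω - C) ∂μ ≤ ENNReal.ofReal δ

/-- Positive parts are subadditive, so the levels add. This is the advantage of truncated excesses
over integrals on `{g ≥ C}`. -/
theorem UniformTail.add {g h : ℕ → Ω → ℝ} (hg : UniformTail μ g) (hh : UniformTail μ h)
    (hgm : ∀ N, Measurable (g N)) : UniformTail μ fun N ω => g N ω + h N ω := by
  intro δ hδ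
  obtain ⟨C, hC, H⟩ := hg (δ / 2) (by positivity)
  obtain ⟨D, hD, H'⟩ := hh (δ / 2) (by positivity)
  refine ⟨C + D, by positivity, fun N => ?_⟩
  calc ∫⁻ ω, ENNReal.ofReal (g N ω + h N ω - (C + D)) ∂μ
      ≤ ∫⁻ ω, ENNReal.ofReal (g N ω - C) + ENNReal.ofReal (h N ω - D) ∂μ := by
        refine lintegral_mono fun ω => ?_
        rw [show g N ω + h N ω - (C + D) = (g N ω - C) + (h N ω - D) by ring]
        exact ENNReal.ofReal_add_le
    _ = ∫⁻ ω, ENNReal.ofReal (g N ω - C) ∂μ + ∫⁻ ω, ENNReal.ofReal (h N ω - D) ∂μ :=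
        lintegral_add_left ((hgm N).sub_const C).ennreal_ofReal _
    _ ≤ ENNReal.ofReal (δ / 2) + ENNReal.ofReal (δ / 2) := add_le_add (H N) (H' N)
    _ = ENNReal.ofReal δ := by
        rw [← ENNReal.ofReal_add (by positivity) (by positivity), add_halves]

theorem UniformTail.sum {ι : Type*} {s : Finset ι} {g : ι → ℕ → Ω → ℝ}
    (hg : ∀ i ∈ s, UniformTail μ (g i)) (hgm : ∀ i N, Measurable (g i N)) :
    UniformTail μ fun N ω => ∑ i ∈ s, g i N ω := by
  classical
  induction s using Finset.induction_on with
  | empty => exact fun δ hδ => ⟨0, le_rfl, by simp⟩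
  | insert a s ha ih =>
    simp only [Finset.sum_insert ha]
    exact (hg a (by simp)).add (ih fun i hi => hg i (by simp [hi])) (hgm a)

theorem UniformTail.const_mul {g : ℕ → Ω → ℝ} (hg : UniformTail μ g) {c : ℝ} (hc : 0 ≤ c) :
    UniformTail μ fun N ω => c * g N ω := by
  intro δ hδ
  -- Dividing by `c + 1` rather than `c` allows `c = 0`.
  obtain ⟨C, hC, H⟩ := hg (δ / (c + 1)) (by positivity)
  refine ⟨c * C, by positivity, fun N => ?_⟩
  simp_rw [← mul_sub, ENNReal.ofReal_mul hc]
  rw [lintegral_const_mul' _ _ ENNReal.ofReal_ne_top]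
  refine (mul_le_mul_right (H N) _).trans ?_
  rw [← ENNReal.ofReal_mul hc]
  refine ENNReal.ofReal_le_ofReal ?_
  rw [mul_div_assoc', div_le_iff₀ (by positivity)]
  nlinarith

/-- Where `|h| ≥ 2 C`, also `g ≥ 2 C`, so `|h| ≤ g ≤ 2 (g - C)`: the tail of `h` is at most twice
the excess of `g` over `C`. -/
theorem UniformTail.uniformIntegrable [IsFiniteMeasure μ] {g h : ℕ → Ω → ℝ}
    (hg : UniformTail μ g) (hm : ∀ N, Measurable (h N)) (hgh : ∀ N ω, |h N ω| ≤ g N ω) :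
    UniformIntegrable h 1 μ := by
  refine uniformIntegrable_of le_rfl ENNReal.one_ne_top (fun N => (hm N).aestronglyMeasurable) ?_
  intro δ hδ
  obtain ⟨C, hC, H⟩ := hg (δ / 2) (by positivity)
  refine ⟨(2 * C).toNNReal, fun N => ?_⟩
  rw [eLpNorm_one_eq_lintegral_enorm]
  calc _ ≤ ∫⁻ ω, 2 * ENNReal.ofReal (g N ω - C) ∂μ := by
        refine lintegral_mono fun ω => ?_
        by_cases hω : ω ∈ {x | (2 * C).toNNReal ≤ ‖h N x‖₊}
        · rw [Set.indicator_of_mem hω]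
          have h1 : 2 * C ≤ |h N ω| := by
            have := (Real.toNNReal_le_iff_le_coe).mp hω
            simpa using this
          rw [← ofReal_norm, Real.norm_eq_abs, ← ENNReal.ofReal_ofNat,
            ← ENNReal.ofReal_mul (by norm_num)]
          exact ENNReal.ofReal_le_ofReal (by linarith [hgh N ω])
        · rw [Set.indicator_of_notMem hω]; simp
    _ = 2 * ∫⁻ ω, ENNReal.ofReal (g N ω - C) ∂μ := lintegral_const_mul' _ _ (by simp)
    _ ≤ 2 * ENNReal.ofReal (δ / 2) := mul_le_mul_right (H N) _
    _ = ENNReal.ofReal δ := by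
        rw [← ENNReal.ofReal_ofNat, ← ENNReal.ofReal_mul (by norm_num)]
        congr 1; ring

/-- A uniformly integrable family times a bounded sequence of weights tending to `0` almost
everywhere tends to `0` in mean. -/
theorem UniformTail.tendsto_lintegral_mul [IsFiniteMeasure μ] {g w : ℕ → Ω → ℝ}
    (hg : UniformTail μ g) (hwm : ∀ N, Measurable (w N)) {c : ℝ}
    (hw0 : ∀ N ω, 0 ≤ w N ω) (hwc : ∀ N ω, w N ω ≤ c)
    (hw : ∀ᵐ ω ∂μ, Tendsto (fun N => w N ω) atTop (𝓝 0)) :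
    Tendsto (fun N => ∫⁻ ω, ENNReal.ofReal (w N ω * g N ω) ∂μ) atTop (𝓝 0) := by
  have hlim : Tendsto (fun N => ∫⁻ ω, ENNReal.ofReal (w N ω) ∂μ) atTop (𝓝 0) := by
    have := tendsto_lintegral_of_dominated_convergence (μ := μ) (f := fun _ => 0)
      (F := fun N ω => ENNReal.ofReal (w N ω)) (fun _ => ENNReal.ofReal c)
      (fun N => (hwm N).ennreal_ofReal)
      (fun N => .of_forall fun ω => ENNReal.ofReal_le_ofReal (hwc N ω))
      (by rw [lintegral_const]; exact ENNReal.mul_ne_top (by simp) (by simp)) ?_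
    · simpa using this
    · filter_upwards [hw] with ω hω
      simpa [Function.comp_def] using (ENNReal.continuous_ofReal.tendsto 0).comp hω
  -- A point of `Ω` is needed to read off `0 ≤ c`.
  rcases isEmpty_or_nonempty Ω with hΩ | ⟨⟨ω₀⟩⟩
  · simp
  have hc : 0 ≤ c := (hw0 0 ω₀).trans (hwc 0 ω₀)
  refine ENNReal.tendsto_nhds_zero.mpr fun δ hδ => ?_
  rcases eq_or_ne δ ∞ with rfl | hδt
  · exact .of_forall fun _ => le_top
  have hδ' : 0 < δ.toReal := ENNReal.toReal_pos hδ.ne' hδt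
  obtain ⟨C, hC, H⟩ := hg (δ.toReal / (2 * (c + 1))) (by positivity)
  have hlim2 := ENNReal.Tendsto.const_mul (a := ENNReal.ofReal C) hlim (.inr ENNReal.ofReal_ne_top)
  rw [mul_zero] at hlim2
  filter_upwards [ENNReal.tendsto_nhds_zero.mp hlim2 (ENNReal.ofReal (δ.toReal / 2))
    (by simpa using hδ')] with N hN
  -- Split `w g = C w + w (g - C)`. The first part tends to `0` by dominated convergence, the second
  -- is at most `c (g - C)⁺`, small uniformly in `N`.
  calc ∫⁻ ω, ENNReal.ofReal (w N ω * g N ω) ∂μ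
      ≤ ∫⁻ ω, ENNReal.ofReal C * ENNReal.ofReal (w N ω)
          + ENNReal.ofReal c * ENNReal.ofReal (g N ω - C) ∂μ := by
        refine lintegral_mono fun ω => ?_
        rw [← ENNReal.ofReal_mul hC, ← ENNReal.ofReal_mul hc,
          show w N ω * g N ω = C * w N ω + w N ω * (g N ω - C) by ring]
        refine ENNReal.ofReal_add_le.trans (add_le_add_right ?_ _)
        rcases le_total 0 (g N ω - C) with h | h
        · exact ENNReal.ofReal_le_ofReal (mul_le_mul_of_nonneg_right (hwc N ω) h)
        · rw [ENNReal.ofReal_of_nonpos (mul_nonpos_of_nonneg_of_nonpos (hw0 N ω) h)]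
          exact zero_le
    _ = ENNReal.ofReal C * ∫⁻ ω, ENNReal.ofReal (w N ω) ∂μ
          + ENNReal.ofReal c * ∫⁻ ω, ENNReal.ofReal (g N ω - C) ∂μ := by
        rw [lintegral_add_left ((hwm N).ennreal_ofReal.const_mul _),
          lintegral_const_mul' _ _ ENNReal.ofReal_ne_top,
          lintegral_const_mul' _ _ ENNReal.ofReal_ne_top]
    _ ≤ ENNReal.ofReal (δ.toReal / 2) + ENNReal.ofReal (δ.toReal / 2) := by
        refine add_le_add hN ((mul_le_mul_right (H N) _).trans ?_)
        rw [← ENNReal.ofReal_mul hc]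
        refine ENNReal.ofReal_le_ofReal ?_
        rw [mul_div_assoc', div_le_div_iff₀ (by positivity) (by positivity)]
        nlinarith
    _ = δ := by
        rw [← ENNReal.ofReal_add (by positivity) (by positivity), add_halves,
          ENNReal.ofReal_toReal hδt]

end UniformTail

/-! ### Sums of independent identically distributed variables -/

section IID

variable {Ω 𝒱 : Type*} [MeasurableSpace Ω] [MeasurableSpace 𝒱] {μ : Measure Ω}
  [IsProbabilityMeasure μ] {V : ℕ → Ω → 𝒱}

/-- Off-diagonal products factor by independence and vanish as soon as one factor, here `φ`, is
centered. -/
theorem integral_sum_mul_sum (hV : iIndepFun V μ) (hid : ∀ i, IdentDistrib (V i) (V 0) μ μ)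
    {φ ψ : 𝒱 → ℝ} (hφ : Measurable φ) (hψ : Measurable ψ)
    (hφ2 : MemLp (fun ω => φ (V 0 ω)) 2 μ) (hψ2 : MemLp (fun ω => ψ (V 0 ω)) 2 μ)
    (hφ0 : ∫ ω, φ (V 0 ω) ∂μ = 0) (n : ℕ) :
    ∫ ω, (∑ i ∈ Finset.range n, φ (V i ω)) * (∑ i ∈ Finset.range n, ψ (V i ω)) ∂μ
      = n * ∫ ω, φ (V 0 ω) * ψ (V 0 ω) ∂μ := by
  have hφi : ∀ i, MemLp (fun ω => φ (V i ω)) 2 μ := fun i =>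
    ((hid i).comp hφ).memLp_iff.mpr hφ2
  have hψi : ∀ i, MemLp (fun ω => ψ (V i ω)) 2 μ := fun i =>
    ((hid i).comp hψ).memLp_iff.mpr hψ2
  have hint : ∀ i j, Integrable (fun ω => φ (V i ω) * ψ (V j ω)) μ := fun i j =>
    (hφi i).integrable_mul (hψi j)
  have hoff : ∀ i j, i ≠ j → ∫ ω, φ (V i ω) * ψ (V j ω) ∂μ = 0 := by
    intro i j hij
    have h1 : IndepFun (fun ω => φ (V i ω)) (fun ω => ψ (V j ω)) μ :=
      (hV.indepFun hij).comp hφ hψ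
    rw [h1.integral_fun_mul_eq_mul_integral (hφi i).1 (hψi j).1]
    have : ∫ ω, φ (V i ω) ∂μ = ∫ ω, φ (V 0 ω) ∂μ := ((hid i).comp hφ).integral_eq
    rw [this, hφ0, zero_mul]
  have hdiag : ∀ i, ∫ ω, φ (V i ω) * ψ (V i ω) ∂μ = ∫ ω, φ (V 0 ω) * ψ (V 0 ω) ∂μ := fun i =>
    ((hid i).comp (hφ.mul hψ)).integral_eq
  simp_rw [Finset.sum_mul_sum]
  rw [integral_finsetSum _ fun i _ => integrable_finsetSum _ fun j _ => hint i j]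
  simp_rw [fun i => integral_finsetSum (Finset.range n) fun j _ => hint i j]
  have : ∀ i ∈ Finset.range n, ∑ j ∈ Finset.range n, ∫ ω, φ (V i ω) * ψ (V j ω) ∂μ
      = ∫ ω, φ (V 0 ω) * ψ (V 0 ω) ∂μ := by
    intro i hi
    rw [Finset.sum_eq_single_of_mem i hi fun j _ hj => hoff i j hj.symm, hdiag]
  rw [Finset.sum_congr rfl this]
  simp

/-- Binomial expansion of `(S + ζ n) ^ 4` with `ζ n` independent of `S`: the odd terms contain `E[ζ
n]` or `E[S]` and vanish. The surviving cross term `6 E[S²] E[ζ n²]` is why the second moment is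
carried through the same induction. -/
theorem integral_sum_pow_four_le {ζ : ℕ → Ω → ℝ} (hζ : iIndepFun ζ μ)
    (hm : ∀ i, Measurable (ζ i)) {b : ℝ} (hb : ∀ i ω, |ζ i ω| ≤ b)
    (h0 : ∀ i, ∫ ω, ζ i ω ∂μ = 0) (n : ℕ) :
    ∫ ω, (∑ i ∈ Finset.range n, ζ i ω) ^ 2 ∂μ ≤ n * b ^ 2 ∧
    ∫ ω, (∑ i ∈ Finset.range n, ζ i ω) ^ 4 ∂μ ≤ 3 * (n : ℝ) ^ 2 * b ^ 4 := by
  obtain ⟨ω₀⟩ : Nonempty Ω := nonempty_of_isProbabilityMeasure μ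
  have hb0 : 0 ≤ b := (abs_nonneg _).trans (hb 0 ω₀)
  have hSm : ∀ n, Measurable fun ω => ∑ i ∈ Finset.range n, ζ i ω := fun n =>
    Finset.measurable_fun_sum _ fun i _ => hm i
  have hSb : ∀ n ω, |∑ i ∈ Finset.range n, ζ i ω| ≤ n * b := fun n ω =>
    (Finset.abs_sum_le_sum_abs _ _).trans
      ((Finset.sum_le_sum fun i _ => hb i ω).trans (by simp))
  have hint : ∀ n k l, Integrable (fun ω => (∑ i ∈ Finset.range n, ζ i ω) ^ k * ζ n ω ^ l) μ := by
    intro n k l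
    refine Integrable.of_bound (((hSm n).pow_const k).mul ((hm n).pow_const l)).aestronglyMeasurable
      ((n * b) ^ k * b ^ l) (.of_forall fun ω => ?_)
    rw [Real.norm_eq_abs, abs_mul, abs_pow, abs_pow]
    gcongr
    · exact hSb n ω
    · exact hb n ω
  have hprod : ∀ n k l, ∫ ω, (∑ i ∈ Finset.range n, ζ i ω) ^ k * ζ n ω ^ l ∂μ
      = (∫ ω, (∑ i ∈ Finset.range n, ζ i ω) ^ k ∂μ) * ∫ ω, ζ n ω ^ l ∂μ := by
    intro n k l
    have h1 : IndepFun (fun ω => ∑ i ∈ Finset.range n, ζ i ω) (ζ n) μ := by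
      have := hζ.indepFun_finsetSum_of_notMem (fun i => hm i) (s := Finset.range n) (i := n)
        (by simp)
      convert this using 1
      ext ω; simp
    have h2 := h1.comp (φ := fun x : ℝ => x ^ k) (ψ := fun x : ℝ => x ^ l) (by fun_prop)
      (by fun_prop)
    exact h2.integral_fun_mul_eq_mul_integral ((hSm n).pow_const k).aestronglyMeasurable
      ((hm n).pow_const l).aestronglyMeasurable
  have hmom : ∀ n l, ∫ ω, ζ n ω ^ l ∂μ ≤ b ^ l := by
    intro n l
    refine (integral_mono (g := fun _ => b ^ l) (by simpa using hint n 0 l) (by simp)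
      fun ω => ?_).trans (by simp)
    exact (le_abs_self _).trans (by rw [abs_pow]; exact pow_le_pow_left₀ (abs_nonneg _) (hb n ω) l)
  induction n with
  | zero => simp
  | succ n ih =>
    obtain ⟨ih2, ih4⟩ := ih
    have hS0 : ∫ ω, (∑ i ∈ Finset.range n, ζ i ω) ∂μ = 0 := by
      rw [integral_finsetSum _ fun i _ => ?_]
      · simp [h0]
      · exact Integrable.of_bound (hm i).aestronglyMeasurable b (.of_forall (hb i))
    have hS20 : 0 ≤ ∫ ω, (∑ i ∈ Finset.range n, ζ i ω) ^ 2 ∂μ :=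
      integral_nonneg fun ω => by positivity
    have hz2 : 0 ≤ ∫ ω, ζ n ω ^ 2 ∂μ := integral_nonneg fun ω => by positivity
    constructor
    · have e : ∀ ω, (∑ i ∈ Finset.range (n + 1), ζ i ω) ^ 2
          = (∑ i ∈ Finset.range n, ζ i ω) ^ 2 * ζ n ω ^ 0
            + (2 * ((∑ i ∈ Finset.range n, ζ i ω) ^ 1 * ζ n ω ^ 1)
            + (∑ i ∈ Finset.range n, ζ i ω) ^ 0 * ζ n ω ^ 2) := by
        intro ω; rw [Finset.sum_range_succ]; ring
      simp_rw [e]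
      rw [integral_add (hint n 2 0) (((hint n 1 1).const_mul 2).fun_add (hint n 0 2)),
        integral_add ((hint n 1 1).const_mul 2) (hint n 0 2), integral_const_mul,
        hprod, hprod, hprod]
      simp only [pow_zero, pow_one, h0, hS0, integral_const, probReal_univ, smul_eq_mul, mul_one,
        one_mul, mul_zero, zero_add]
      push_cast
      linarith [hmom n 2]
    · have e : ∀ ω, (∑ i ∈ Finset.range (n + 1), ζ i ω) ^ 4
          = (∑ i ∈ Finset.range n, ζ i ω) ^ 4 * ζ n ω ^ 0
            + (4 * ((∑ i ∈ Finset.range n, ζ i ω) ^ 3 * ζ n ω ^ 1)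
            + (6 * ((∑ i ∈ Finset.range n, ζ i ω) ^ 2 * ζ n ω ^ 2)
            + (4 * ((∑ i ∈ Finset.range n, ζ i ω) ^ 1 * ζ n ω ^ 3)
            + (∑ i ∈ Finset.range n, ζ i ω) ^ 0 * ζ n ω ^ 4))) := by
        intro ω; rw [Finset.sum_range_succ]; ring
      simp_rw [e]
      have i4 := (hint n 1 3).const_mul 4
      have i3 := (hint n 2 2).const_mul 6
      have i2 := (hint n 3 1).const_mul 4
      rw [integral_add (hint n 4 0) (i2.fun_add (i3.fun_add (i4.fun_add (hint n 0 4)))),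
        integral_add i2 (i3.fun_add (i4.fun_add (hint n 0 4))), integral_add i3 (i4.fun_add (hint n 0 4)),
        integral_add i4 (hint n 0 4), integral_const_mul, integral_const_mul, integral_const_mul,
        hprod, hprod, hprod, hprod, hprod]
      simp only [pow_zero, pow_one, h0, hS0, integral_const, probReal_univ, smul_eq_mul, mul_one,
        one_mul, mul_zero, zero_mul, zero_add]
      push_cast
      have h22 : (∫ ω, (∑ i ∈ Finset.range n, ζ i ω) ^ 2 ∂μ) * ∫ ω, ζ n ω ^ 2 ∂μ
          ≤ (n * b ^ 2) * b ^ 2 := mul_le_mul ih2 (hmom n 2) hz2 (by positivity)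
      -- The count closes because `3 n² + 6 n + 1 ≤ 3 (n + 1)²`.
      nlinarith [hmom n 4, pow_nonneg hb0 4]

theorem memLp_sum (hid : ∀ i, IdentDistrib (V i) (V 0) μ μ) {φ : 𝒱 → ℝ} (hφ : Measurable φ)
    (hφ2 : MemLp (fun ω => φ (V 0 ω)) 2 μ) (n : ℕ) :
    MemLp (fun ω => ∑ i ∈ Finset.range n, φ (V i ω)) 2 μ :=
  memLp_finsetSum _ fun i _ => ((hid i).comp hφ).memLp_iff.mpr hφ2

/-- The squared normalized sums of centered i.i.d. square-integrable variables are uniformly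
integrable. -/
theorem uniformTail_sq_sum (hV : iIndepFun V μ) (hVm : ∀ i, Measurable (V i))
    (hid : ∀ i, IdentDistrib (V i) (V 0) μ μ)
    {φ : 𝒱 → ℝ} (hφ : Measurable φ) (hφ2 : MemLp (fun ω => φ (V 0 ω)) 2 μ)
    (hφ0 : ∫ ω, φ (V 0 ω) ∂μ = 0) :
    UniformTail μ fun N ω => ((√(N : ℝ))⁻¹ * ∑ i ∈ Finset.range N, φ (V i ω)) ^ 2 := by
  intro δ hδ
  -- truncation at level `M`
  set τ : ℕ → 𝒱 → ℝ := fun M v => if |φ v| ≤ M then φ v else 0 with hτ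
  have hτm : ∀ M, Measurable (τ M) := fun M =>
    Measurable.ite (measurableSet_le hφ.abs measurable_const) hφ measurable_const
  have hτb : ∀ M v, |τ M v| ≤ M := by
    intro M v; simp only [hτ]; split_ifs with h
    · exact h
    · simp
  have hτφ : ∀ M v, |φ v - τ M v| ≤ |φ v| := by
    intro M v; simp only [hτ]; split_ifs <;> simp
  have hlim : Tendsto (fun M : ℕ => ∫ ω, (φ (V 0 ω) - τ M (V 0 ω)) ^ 2 ∂μ) atTop (𝓝 0) := by
    have := tendsto_integral_of_dominated_convergence (μ := μ) (f := fun _ => (0 : ℝ))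
      (F := fun (M : ℕ) ω => (φ (V 0 ω) - τ M (V 0 ω)) ^ 2) (fun ω => φ (V 0 ω) ^ 2)
      (fun M => (((hφ.sub (hτm M)).comp (hVm 0)).pow_const 2).aestronglyMeasurable)
      hφ2.integrable_sq (fun M => .of_forall fun ω => by
        rw [Real.norm_eq_abs, abs_pow, ← sq_abs (φ (V 0 ω))]
        exact pow_le_pow_left₀ (abs_nonneg _) (hτφ M _) 2) (.of_forall fun ω => by
        obtain ⟨m, hm⟩ := exists_nat_ge |φ (V 0 ω)|
        refine tendsto_const_nhds.congr' ?_
        filter_upwards [eventually_ge_atTop m] with M hM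
        have : |φ (V 0 ω)| ≤ M := hm.trans (by exact_mod_cast hM)
        simp [hτ, this])
    simpa using this
  -- `φ` splits into `φ₁`, the recentered truncation, bounded and so controlled by fourth moments,
  -- and a centered remainder `φ₂` of second moment at most `δ / 4`.
  obtain ⟨M, hM⟩ := (hlim.eventually_lt_const (show (0 : ℝ) < δ / 4 by positivity)).exists
  set c := ∫ ω, τ M (V 0 ω) ∂μ with hc
  set φ₁ : 𝒱 → ℝ := fun v => τ M v - c with hφ₁
  set φ₂ : 𝒱 → ℝ := fun v => φ v - φ₁ v with hφ₂
  have hφ₁m : Measurable φ₁ := (hτm M).sub_const c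
  have hφ₂m : Measurable φ₂ := hφ.sub hφ₁m
  have hτ2 : MemLp (fun ω => τ M (V 0 ω)) 2 μ :=
    MemLp.of_bound ((hτm M).comp (hVm 0)).aestronglyMeasurable M (.of_forall fun ω => hτb M _)
  have hφ₁2 : MemLp (fun ω => φ₁ (V 0 ω)) 2 μ := hτ2.sub (memLp_const c)
  have hφ₂2 : MemLp (fun ω => φ₂ (V 0 ω)) 2 μ := hφ2.sub hφ₁2
  have hφ₁0 : ∫ ω, φ₁ (V 0 ω) ∂μ = 0 := by
    simp only [hφ₁]
    rw [integral_sub (hτ2.integrable one_le_two) (by simp)]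
    simp [hc]
  have hφ₂0 : ∫ ω, φ₂ (V 0 ω) ∂μ = 0 := by
    simp only [hφ₂]
    rw [integral_sub (hφ2.integrable one_le_two) (hφ₁2.integrable one_le_two), hφ0, hφ₁0, sub_zero]
  -- Recentering costs nothing: the second moment of `φ₂` is the variance of `φ - τ M`, at most its
  -- second moment.
  have hsmall : ∫ ω, φ₂ (V 0 ω) * φ₂ (V 0 ω) ∂μ ≤ δ / 4 := by
    have h1 := variance_le_expectation_sq (μ := μ) (X := fun ω => φ (V 0 ω) - τ M (V 0 ω))
      (hφ2.sub hτ2).1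
    have h2 : Var[fun ω => φ (V 0 ω) - τ M (V 0 ω); μ] = ∫ ω, φ₂ (V 0 ω) * φ₂ (V 0 ω) ∂μ := by
      rw [variance_eq_integral (X := fun ω => φ (V 0 ω) - τ M (V 0 ω)) (hφ2.sub hτ2).1.aemeasurable]
      refine integral_congr_ae (.of_forall fun ω => ?_)
      have h3 : ∫ ω, (φ (V 0 ω) - τ M (V 0 ω)) ∂μ = 0 - c := by
        rw [integral_sub (hφ2.integrable one_le_two) (hτ2.integrable one_le_two), hφ0]
      simp only [h3, hφ₂, hφ₁]
      ring
    rw [← h2]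
    exact h1.trans hM.le
  set b : ℝ := M + |c| with hb
  have hφ₁b : ∀ v, |φ₁ v| ≤ b := fun v =>
    (abs_sub _ _).trans (add_le_add (hτb M v) le_rfl)
  have h4 := integral_sum_pow_four_le (μ := μ) (ζ := fun i ω => φ₁ (V i ω))
    (hV.comp (fun _ => φ₁) fun _ => hφ₁m) (fun i => hφ₁m.comp (hVm i)) (fun i ω => hφ₁b _)
    (fun i => by rw [← hφ₁0]; exact ((hid i).comp hφ₁m).integral_eq)
  -- From `(T₁ + T₂)² - C ≤ 2 T₂² + (2 T₁² - C)` and `2 x - C ≤ x² / C`, the excess has mean at most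
  -- `2 · δ / 4 + 3 b⁴ / C`, and `C ≥ 6 b⁴ / δ` makes the last term at most `δ / 2`. The `+ 1` keeps
  -- `C` positive when `b = 0`.
  refine ⟨6 * b ^ 4 / δ + 1, by positivity, fun N => ?_⟩
  set C := 6 * b ^ 4 / δ + 1 with hC
  have hC0 : 0 < C := by positivity
  set T₁ : Ω → ℝ := fun ω => (√(N : ℝ))⁻¹ * ∑ i ∈ Finset.range N, φ₁ (V i ω) with hT₁
  set T₂ : Ω → ℝ := fun ω => (√(N : ℝ))⁻¹ * ∑ i ∈ Finset.range N, φ₂ (V i ω) with hT₂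
  have hsplit : ∀ ω, (√(N : ℝ))⁻¹ * ∑ i ∈ Finset.range N, φ (V i ω) = T₁ ω + T₂ ω := by
    intro ω
    simp only [hT₁, hT₂, ← mul_add, ← Finset.sum_add_distrib]
    simp [hφ₂]
  have hs2 : ((√(N : ℝ))⁻¹) ^ 2 = (N : ℝ)⁻¹ := by
    rw [inv_pow, Real.sq_sqrt (by positivity)]
  -- An inequality, since for `N = 0` the product is `0`.
  have hNN : (N : ℝ)⁻¹ * N ≤ 1 := by
    rcases eq_or_ne (N : ℝ) 0 with h | h
    · simp [h]
    · rw [inv_mul_cancel₀ h]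
  have hE2 : ∫ ω, T₂ ω ^ 2 ∂μ ≤ δ / 4 := by
    have : ∀ ω, T₂ ω ^ 2 = (N : ℝ)⁻¹ * ((∑ i ∈ Finset.range N, φ₂ (V i ω))
        * ∑ i ∈ Finset.range N, φ₂ (V i ω)) := by
      intro ω; simp only [hT₂, mul_pow, hs2]; ring
    simp_rw [this]
    rw [integral_const_mul, integral_sum_mul_sum hV hid hφ₂m hφ₂m hφ₂2 hφ₂2 hφ₂0, ← mul_assoc]
    have h0 : 0 ≤ ∫ ω, φ₂ (V 0 ω) * φ₂ (V 0 ω) ∂μ := integral_nonneg fun ω => mul_self_nonneg _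
    exact (mul_le_of_le_one_left h0 hNN).trans hsmall
  have hE4 : ∫ ω, T₁ ω ^ 4 ∂μ ≤ 3 * b ^ 4 := by
    have : ∀ ω, T₁ ω ^ 4 = ((N : ℝ)⁻¹) ^ 2 * (∑ i ∈ Finset.range N, φ₁ (V i ω)) ^ 4 := by
      intro ω; simp only [hT₁, mul_pow]; rw [← hs2]; ring
    simp_rw [this]
    rw [integral_const_mul]
    calc ((N : ℝ)⁻¹) ^ 2 * ∫ ω, (∑ i ∈ Finset.range N, φ₁ (V i ω)) ^ 4 ∂μ
        ≤ ((N : ℝ)⁻¹) ^ 2 * (3 * (N : ℝ) ^ 2 * b ^ 4) := by gcongr; exact (h4 N).2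
      _ = ((N : ℝ)⁻¹ * N) ^ 2 * (3 * b ^ 4) := by ring
      _ ≤ 1 * (3 * b ^ 4) := by
          gcongr
          exact pow_le_one₀ (by positivity) hNN
      _ = 3 * b ^ 4 := one_mul _
  have hT₂i : Integrable (fun ω => T₂ ω ^ 2) μ :=
    ((memLp_sum hid hφ₂m hφ₂2 N).const_mul _).integrable_sq
  have hT₁m : Measurable T₁ :=
    (Finset.measurable_fun_sum _ fun i _ => hφ₁m.comp (hVm i)).const_mul _
  have hT₁i : Integrable (fun ω => T₁ ω ^ 4) μ := by
    refine Integrable.of_bound (hT₁m.pow_const 4).aestronglyMeasurable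
      (((√(N : ℝ))⁻¹ * (N * b)) ^ 4) (.of_forall fun ω => ?_)
    rw [Real.norm_eq_abs, abs_pow, hT₁, abs_mul, abs_of_nonneg (a := (√(N : ℝ))⁻¹) (by positivity)]
    gcongr
    exact (Finset.abs_sum_le_sum_abs _ _).trans
      ((Finset.sum_le_sum fun i _ => hφ₁b _).trans (by simp))
  calc ∫⁻ ω, ENNReal.ofReal (((√(N : ℝ))⁻¹ * ∑ i ∈ Finset.range N, φ (V i ω)) ^ 2 - C) ∂μ
      ≤ ∫⁻ ω, ENNReal.ofReal (2 * T₂ ω ^ 2 + C⁻¹ * T₁ ω ^ 4) ∂μ := by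
        refine lintegral_mono fun ω => ENNReal.ofReal_le_ofReal ?_
        rw [hsplit]
        have h1 : 2 * T₁ ω ^ 2 - C ≤ C⁻¹ * T₁ ω ^ 4 := by
          rw [← div_eq_inv_mul, le_div_iff₀ hC0]
          nlinarith [sq_nonneg (T₁ ω ^ 2 - C)]
        nlinarith [sq_nonneg (T₁ ω - T₂ ω)]
    _ = ENNReal.ofReal (∫ ω, 2 * T₂ ω ^ 2 + C⁻¹ * T₁ ω ^ 4 ∂μ) :=
        (ofReal_integral_eq_lintegral_ofReal ((hT₂i.const_mul 2).add (hT₁i.const_mul _))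
          (.of_forall fun ω => by simp only [Pi.zero_apply, Pi.add_apply]; positivity)).symm
    _ ≤ ENNReal.ofReal δ := by
        refine ENNReal.ofReal_le_ofReal ?_
        rw [integral_add (hT₂i.const_mul 2) (hT₁i.const_mul _), integral_const_mul,
          integral_const_mul]
        have h1 : C⁻¹ * ∫ ω, T₁ ω ^ 4 ∂μ ≤ δ / 2 := by
          rw [← div_eq_inv_mul, div_le_iff₀ hC0]
          refine hE4.trans ?_
          have : δ * (6 * b ^ 4 / δ) = 6 * b ^ 4 := by field_simp
          rw [hC]; nlinarith
        linarith

end IID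

/-! ### The multivariate central limit theorem -/

section CLT

variable {Ω 𝒱 : Type*} [MeasurableSpace Ω] [MeasurableSpace 𝒱] {μ : Measure Ω}
  [IsProbabilityMeasure μ] {V : ℕ → Ω → 𝒱} {q : ℕ}

theorem real_inner_eq_sum (x y : EuclideanSpace ℝ (Fin q)) :
    inner ℝ x y = ∑ a, x a * y a := by
  rw [PiLp.inner_apply]
  exact Finset.sum_congr rfl fun a _ => by simp [mul_comm]

theorem measurable_euclidean {α : Type*} [MeasurableSpace α] {g : α → EuclideanSpace ℝ (Fin q)}
    (h : ∀ a, Measurable fun ω => g ω a) : Measurable g :=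
  (WithLp.measurable_toLp 2 (Fin q → ℝ)).comp (measurable_pi_iff.mpr h)

theorem Measurable.euclidean_apply {α : Type*} [MeasurableSpace α]
    {g : α → EuclideanSpace ℝ (Fin q)} (h : Measurable g) (a : Fin q) :
    Measurable fun ω => g ω a :=
  measurable_pi_iff.mp ((WithLp.measurable_ofLp 2 (Fin q → ℝ)).comp h) a

/-- The covariance matrix of a centered square-integrable vector is positive semidefinite. -/
theorem posSemidef_of_integral {ξ : Ω → Fin q → ℝ} (hξ : ∀ a, MemLp (fun ω => ξ ω a) 2 μ)
    {Γ : Matrix (Fin q) (Fin q) ℝ} (hΓ : ∀ a b, Γ a b = ∫ ω, ξ ω a * ξ ω b ∂μ) :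
    Γ.PosSemidef ∧ ∀ t : Fin q → ℝ, t ⬝ᵥ Γ *ᵥ t = ∫ ω, (∑ a, t a * ξ ω a) ^ 2 ∂μ := by
  have hq : ∀ t : Fin q → ℝ, t ⬝ᵥ Γ *ᵥ t = ∫ ω, (∑ a, t a * ξ ω a) ^ 2 ∂μ := by
    intro t
    have hint : ∀ a b, Integrable (fun ω => t a * t b * (ξ ω a * ξ ω b)) μ := fun a b =>
      ((hξ a).integrable_mul (hξ b)).const_mul _
    have : ∀ ω, (∑ a, t a * ξ ω a) ^ 2 = ∑ a, ∑ b, t a * t b * (ξ ω a * ξ ω b) := by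
      intro ω
      rw [sq, Finset.sum_mul_sum]
      exact Finset.sum_congr rfl fun a _ => Finset.sum_congr rfl fun b _ => by ring
    simp_rw [this]
    rw [integral_finsetSum _ fun a _ => integrable_finsetSum _ fun b _ => hint a b]
    simp_rw [fun a => integral_finsetSum Finset.univ fun b _ => hint a b, integral_const_mul, ← hΓ,
      dotProduct, Matrix.mulVec, dotProduct, Finset.mul_sum]
    exact Finset.sum_congr rfl fun a _ => Finset.sum_congr rfl fun b _ => by ring
  refine ⟨Matrix.posSemidef_iff_dotProduct_mulVec.mpr ⟨?_, fun t => ?_⟩, hq⟩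
  · ext a b
    rw [Matrix.conjTranspose_apply, star_trivial, hΓ, hΓ]
    simp_rw [mul_comm]
  · rw [star_trivial, hq]
    exact integral_nonneg fun ω => sq_nonneg _

/-- **Multivariate central limit theorem.** -/
theorem tendstoInDistribution_inv_sqrt_smul_sum (hV : iIndepFun V μ)
    (hVm : ∀ i, Measurable (V i)) (hid : ∀ i, IdentDistrib (V i) (V 0) μ μ)
    {φ : 𝒱 → EuclideanSpace ℝ (Fin q)} (hφ : Measurable φ)
    (hφ2 : ∀ a, MemLp (fun ω => φ (V 0 ω) a) 2 μ)
    (hφ0 : ∀ a, ∫ ω, φ (V 0 ω) a ∂μ = 0) {Γ : Matrix (Fin q) (Fin q) ℝ}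
    (hΓ : ∀ a b, Γ a b = ∫ ω, φ (V 0 ω) a * φ (V 0 ω) b ∂μ) :
    TendstoInDistribution (fun (N : ℕ) ω => (√(N : ℝ))⁻¹ • ∑ i ∈ Finset.range N, φ (V i ω)) atTop
      id (fun _ => μ) (multivariateGaussian 0 Γ) := by
  obtain ⟨hpsd, hquad⟩ := posSemidef_of_integral (ξ := fun ω => (φ (V 0 ω)).ofLp) hφ2 hΓ
  have hTm : ∀ N : ℕ, Measurable fun ω => (√(N : ℝ))⁻¹ • ∑ i ∈ Finset.range N, φ (V i ω) := fun N =>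
    (measurable_const_smul (√(N : ℝ))⁻¹).comp
      (Finset.measurable_fun_sum _ fun i _ => hφ.comp (hVm i))
  refine ⟨fun N => (hTm N).aemeasurable, aemeasurable_id, ?_⟩
  refine ProbabilityMeasure.tendsto_iff_tendsto_charFun.2 fun t => ?_
  -- Cramér–Wold: the characteristic function of the vector sum at `t` is that of the scalar sum of
  -- `ψ = ⟨φ, t⟩` at frequency `1`, and the variance of `ψ` is `tᵀ Γ t`.
  set ψ : 𝒱 → ℝ := fun v => inner ℝ (φ v) t with hψ
  have hψm : Measurable ψ := hφ.inner measurable_const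
  have hψs : ∀ v, ψ v = ∑ a, t a * φ v a := fun v => by
    simp only [hψ, real_inner_eq_sum]; exact Finset.sum_congr rfl fun a _ => mul_comm _ _
  have hψ2 : MemLp (fun ω => ψ (V 0 ω)) 2 μ := by
    simp_rw [hψs]
    exact memLp_finsetSum _ fun a _ => (hφ2 a).const_mul _
  have hψ0 : ∫ ω, ψ (V 0 ω) ∂μ = 0 := by
    simp_rw [hψs]
    rw [integral_finsetSum _ fun a _ => ((hφ2 a).integrable one_le_two).const_mul _]
    simp [integral_const_mul, hφ0]
  have hvar : Var[fun ω => ψ (V 0 ω); μ] = t.ofLp ⬝ᵥ Γ *ᵥ t.ofLp := by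
    rw [variance_of_integral_eq_zero hψ2.1.aemeasurable hψ0, hquad]
    simp_rw [hψs]
  have hclt := tendstoInDistribution_inv_sqrt_mul_sum_sub (P := μ) (X := fun i ω => ψ (V i ω))
    (Y := id) HasLaw.id hψ2 (hV.comp (fun _ => ψ) fun _ => hψm) fun i => (hid i).comp hψm
  have h1 := ProbabilityMeasure.tendsto_iff_tendsto_charFun.1 hclt.tendsto 1
  simp only [ProbabilityMeasure.coe_mk, Measure.map_id, charFun_gaussianReal] at h1 ⊢
  rw [charFun_multivariateGaussian hpsd]
  convert! h1 using 1
  · ext N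
    rw [charFun_apply, charFun_apply, integral_map (hTm N).aemeasurable, integral_map]
    · refine integral_congr_ae (.of_forall fun ω => ?_)
      simp only [hψ0]
      simp [inner_smul_left, sum_inner, hψ]
    · exact (hclt.forall_aemeasurable N)
    · fun_prop
    · fun_prop
  · rw [hvar, Real.coe_toNNReal _ (by simpa using hpsd.dotProduct_mulVec_nonneg t.ofLp)]
    simp

end CLT

/-! ### Linearization of the floored least-squares estimator -/

section Linearization

variable {q : ℕ}

/-- `|M|²` for the Frobenius norm. -/
def sqFrobenius (M : Matrix (Fin q) (Fin q) ℝ) : ℝ := ∑ a, ∑ b, M a b ^ 2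

theorem sqFrobenius_nonneg (M : Matrix (Fin q) (Fin q) ℝ) : 0 ≤ sqFrobenius M :=
  Finset.sum_nonneg fun _ _ => Finset.sum_nonneg fun _ _ => sq_nonneg _

/-- The weight controlling the linearization error for the Gram matrix `G`. -/
noncomputable def errorWeight (H : Matrix (Fin q) (Fin q) ℝ) (ε : ℝ) (θ : Fin q → ℝ)
    (G : Matrix (Fin q) (Fin q) ℝ) : ℝ :=
  8 * sqFrobenius ((eigenFloor G ε)⁻¹ - H⁻¹)
    + if ε ^ 2 < sqFrobenius (G - H) then 2 * (ε ^ 2)⁻¹ * (θ ⬝ᵥ θ) else 0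

theorem errorWeight_nonneg (H : Matrix (Fin q) (Fin q) ℝ) (ε : ℝ) (θ : Fin q → ℝ)
    (G : Matrix (Fin q) (Fin q) ℝ) : 0 ≤ errorWeight H ε θ G := by
  have h1 := sqFrobenius_nonneg ((eigenFloor G ε)⁻¹ - H⁻¹)
  have h2 := dotProduct_self_nonneg_real θ
  unfold errorWeight
  split_ifs <;> positivity

theorem sqFrobenius_sub_le (M N : Matrix (Fin q) (Fin q) ℝ) :
    sqFrobenius (M - N) ≤ 2 * sqFrobenius M + 2 * sqFrobenius N := by
  simp only [sqFrobenius, Finset.mul_sum, ← Finset.sum_add_distrib, Matrix.sub_apply]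
  exact Finset.sum_le_sum fun a _ => Finset.sum_le_sum fun b _ => by
    nlinarith [sq_nonneg (M a b + N a b)]

/-- This is what the floor is for: the entries of `F⁻¹` are at most `1 / ε`, so the bound is uniform
in `G`, however degenerate. -/
theorem errorWeight_le (H : Matrix (Fin q) (Fin q) ℝ) {ε : ℝ} (hε : 0 < ε) (θ : Fin q → ℝ) :
    ∃ c, ∀ G : Matrix (Fin q) (Fin q) ℝ, G.IsHermitian → errorWeight H ε θ G ≤ c := by
  refine ⟨8 * (2 * (∑ _a : Fin q, ∑ _b : Fin q, (ε ^ 2)⁻¹) + 2 * sqFrobenius H⁻¹)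
    + 2 * (ε ^ 2)⁻¹ * (θ ⬝ᵥ θ), fun G hG => ?_⟩
  have h1 := sqFrobenius_sub_le (eigenFloor G ε)⁻¹ H⁻¹
  have h2 : sqFrobenius (eigenFloor G ε)⁻¹ ≤ ∑ _a : Fin q, ∑ _b : Fin q, (ε ^ 2)⁻¹ :=
    Finset.sum_le_sum fun a _ => Finset.sum_le_sum fun b _ => sq_inv_eigenFloor_apply_le hG hε a b
  have h3 := dotProduct_self_nonneg_real θ
  have h4 : 0 ≤ 2 * (ε ^ 2)⁻¹ * (θ ⬝ᵥ θ) := by positivity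
  unfold errorWeight
  split_ifs <;> linarith

theorem dotProduct_add_self_le (v w : Fin q → ℝ) :
    (v + w) ⬝ᵥ (v + w) ≤ 2 * (v ⬝ᵥ v) + 2 * (w ⬝ᵥ w) := by
  simp only [dotProduct, Finset.mul_sum, ← Finset.sum_add_distrib, Pi.add_apply]
  exact Finset.sum_le_sum fun a _ => by nlinarith [sq_nonneg (v a - w a)]

theorem dotProduct_sub_self_le (v w : Fin q → ℝ) :
    (v - w) ⬝ᵥ (v - w) ≤ 2 * (v ⬝ᵥ v) + 2 * (w ⬝ᵥ w) := by
  simp only [dotProduct, Finset.mul_sum, ← Finset.sum_add_distrib, Pi.sub_apply]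
  exact Finset.sum_le_sum fun a _ => by nlinarith [sq_nonneg (v a + w a)]

/-- The linearization error of the floored estimator with Gram matrix `G` and moment vector `m`. -/
noncomputable def linError (H : Matrix (Fin q) (Fin q) ℝ) (ε : ℝ) (θ : Fin q → ℝ)
    (G : Matrix (Fin q) (Fin q) ℝ) (m : Fin q → ℝ) : Fin q → ℝ :=
  (2 : ℝ) • ((eigenFloor G ε)⁻¹ *ᵥ m) - θ - (2 : ℝ) • (H⁻¹ *ᵥ (m - (1 / 2 : ℝ) • (G *ᵥ θ)))

variable {H G : Matrix (Fin q) (Fin q) ℝ} {ε : ℝ}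

/-- Substitute `m = r + G θ / 2` and `θ = F⁻¹ F θ`. The error separates into the error of the
inverse acting on `r` and the bias caused by flooring. -/
theorem linError_eq (hG : G.IsHermitian) (hε : 0 < ε) (θ m : Fin q → ℝ) :
    linError H ε θ G m
      = (2 : ℝ) • (((eigenFloor G ε)⁻¹ - H⁻¹) *ᵥ (m - (1 / 2 : ℝ) • (G *ᵥ θ)))
        - (eigenFloor G ε)⁻¹ *ᵥ ((eigenFloor G ε - G) *ᵥ θ) := by
  have h1 : (eigenFloor G ε)⁻¹ *ᵥ (eigenFloor G ε *ᵥ θ) = θ := by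
    rw [Matrix.mulVec_mulVec, Matrix.nonsing_inv_mul _ (isUnit_det_eigenFloor hG hε),
      Matrix.one_mulVec]
  simp only [linError, Matrix.sub_mulVec, Matrix.mulVec_sub, h1, Matrix.mulVec_smul, smul_sub,
    smul_smul]
  norm_num
  abel

/-- In `|x - y|² ≤ 2 |x|² + 2 |y|²` the first term of `linError_eq` gives `8 |F⁻¹ - H⁻¹|² |r|²`. The
second is nonzero only if `|G - H| > ε`, which converts its bound into a multiple of `|G - H|²`. -/
theorem linError_sq_le (hH : (H - (2 * ε) • (1 : Matrix (Fin q) (Fin q) ℝ)).PosSemidef)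
    (hG : G.PosSemidef) (hε : 0 < ε) (θ m : Fin q → ℝ) :
    linError H ε θ G m ⬝ᵥ linError H ε θ G m ≤ errorWeight H ε θ G *
      ((m - (1 / 2 : ℝ) • (G *ᵥ θ)) ⬝ᵥ (m - (1 / 2 : ℝ) • (G *ᵥ θ)) + sqFrobenius (G - H)) := by
  set r := m - (1 / 2 : ℝ) • (G *ᵥ θ) with hr
  rw [linError_eq hG.1 hε]
  refine (dotProduct_sub_self_le _ _).trans ?_
  rw [← hr]
  have h1 := dotProduct_mulVec_sq_le ((eigenFloor G ε)⁻¹ - H⁻¹) r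
  have h2 := dotProduct_inv_eigenFloor_mulVec_le hG.1 hε ((eigenFloor G ε - G) *ᵥ θ)
  have h3 := dotProduct_eigenFloor_sub_mulVec_le hG hε.le θ
  have hJ := sqFrobenius_nonneg (G - H)
  have hr0 := dotProduct_self_nonneg_real r
  have hθ0 := dotProduct_self_nonneg_real θ
  have hD := sqFrobenius_nonneg ((eigenFloor G ε)⁻¹ - H⁻¹)
  have h4 : ((eigenFloor G ε)⁻¹ *ᵥ ((eigenFloor G ε - G) *ᵥ θ)) ⬝ᵥ
        ((eigenFloor G ε)⁻¹ *ᵥ ((eigenFloor G ε - G) *ᵥ θ))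
      ≤ (if ε ^ 2 < sqFrobenius (G - H) then (ε ^ 2)⁻¹ * (θ ⬝ᵥ θ) else 0)
        * sqFrobenius (G - H) := by
    split_ifs with h
    -- The flooring bias is at most `ε⁻² · ε² |θ|²`; on this event the factor `ε²` is replaced by
    -- `|G - H|²`.
    · have h5 : (ε ^ 2)⁻¹ * (ε ^ 2 * (θ ⬝ᵥ θ)) ≤ (ε ^ 2)⁻¹ * (sqFrobenius (G - H) * (θ ⬝ᵥ θ)) := by
        gcongr
      have h6 := h2.trans (mul_le_mul_of_nonneg_left h3 (by positivity))
      linarith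
    · rw [eigenFloor_eq_self_of_sum_sq_sub_le hε.le hH hG.1 (not_lt.mp h)]
      simp
  have h7 : 0 ≤ (if ε ^ 2 < sqFrobenius (G - H) then (ε ^ 2)⁻¹ * (θ ⬝ᵥ θ) else 0) := by
    split_ifs <;> positivity
  have h8 : errorWeight H ε θ G = 8 * sqFrobenius ((eigenFloor G ε)⁻¹ - H⁻¹)
      + 2 * (if ε ^ 2 < sqFrobenius (G - H) then (ε ^ 2)⁻¹ * (θ ⬝ᵥ θ) else 0) := by
    unfold errorWeight; split_ifs <;> ring
  rw [h8]
  set W := (if ε ^ 2 < sqFrobenius (G - H) then (ε ^ 2)⁻¹ * (θ ⬝ᵥ θ) else 0)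
  set D := sqFrobenius ((eigenFloor G ε)⁻¹ - H⁻¹)
  change _ ≤ D * _ at h1
  have h9 : ((2 : ℝ) • (((eigenFloor G ε)⁻¹ - H⁻¹) *ᵥ r)) ⬝ᵥ
      ((2 : ℝ) • (((eigenFloor G ε)⁻¹ - H⁻¹) *ᵥ r)) ≤ 4 * (D * (r ⬝ᵥ r)) := by
    rw [smul_dotProduct, dotProduct_smul, smul_smul, smul_eq_mul]
    nlinarith
  nlinarith [mul_nonneg hD hJ, mul_nonneg h7 hr0]

theorem abs_quadForm_le (H : Matrix (Fin q) (Fin q) ℝ) (v : Fin q → ℝ) :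
    |1 / 2 * (v ⬝ᵥ H *ᵥ v)| ≤ (1 + sqFrobenius H) * (v ⬝ᵥ v) := by
  have h1 := dotProduct_mulVec_sq_le H v
  change _ ≤ sqFrobenius H * _ at h1
  have h2 := dotProduct_sq_le v (H *ᵥ v)
  have h3 := dotProduct_self_nonneg_real v
  have h4 := sqFrobenius_nonneg H
  refine abs_le_of_sq_le_sq ?_ (by positivity)
  have h5 : (v ⬝ᵥ H *ᵥ v) ^ 2 ≤ (v ⬝ᵥ v) * (sqFrobenius H * (v ⬝ᵥ v)) :=
    h2.trans (mul_le_mul_of_nonneg_left h1 h3)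
  have h6 : 0 ≤ (v ⬝ᵥ v) ^ 2 := sq_nonneg _
  nlinarith [mul_nonneg h4 h6, mul_nonneg (mul_nonneg h4 h4) h6]

/-- Since `H H⁻¹ = 1`, the leading part of the form is `2 rᵀ H⁻¹ r` and the remainder is `2 r · R +
Rᵀ H R / 2`. The cross term is only of first order in `R`, whence the `√Δ`. -/
theorem abs_quadForm_add_sub_le (hH : H.PosDef) (r R : Fin q → ℝ) {Δ J : ℝ}
    (hΔ : 0 ≤ Δ) (hJ : 0 ≤ J) (hR : R ⬝ᵥ R ≤ Δ * (r ⬝ᵥ r + J)) :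
    |1 / 2 * (((2 : ℝ) • (H⁻¹ *ᵥ r) + R) ⬝ᵥ H *ᵥ ((2 : ℝ) • (H⁻¹ *ᵥ r) + R))
        - 2 * (r ⬝ᵥ H⁻¹ *ᵥ r)|
      ≤ (2 * √Δ + (1 + sqFrobenius H) * Δ) * (r ⬝ᵥ r + J) := by
  have hu : IsUnit H.det := (Matrix.isUnit_iff_isUnit_det _).mp hH.isUnit
  have hT : Hᵀ = H := by
    have := hH.1
    simpa [Matrix.IsHermitian, Matrix.conjTranspose_eq_transpose_of_trivial] using this
  have e1 : H *ᵥ (H⁻¹ *ᵥ r) = r := by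
    rw [Matrix.mulVec_mulVec, Matrix.mul_nonsing_inv _ hu, Matrix.one_mulVec]
  have e2 : (H⁻¹ *ᵥ r) ⬝ᵥ H *ᵥ R = r ⬝ᵥ R := by
    rw [Matrix.dotProduct_mulVec, ← Matrix.mulVec_transpose, hT, e1]
  have e3 : 1 / 2 * (((2 : ℝ) • (H⁻¹ *ᵥ r) + R) ⬝ᵥ H *ᵥ ((2 : ℝ) • (H⁻¹ *ᵥ r) + R))
        - 2 * (r ⬝ᵥ H⁻¹ *ᵥ r) = 2 * (r ⬝ᵥ R) + 1 / 2 * (R ⬝ᵥ H *ᵥ R) := by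
    simp only [Matrix.mulVec_add, Matrix.mulVec_smul, add_dotProduct, dotProduct_add,
      smul_dotProduct, dotProduct_smul, smul_eq_mul, e1, e2]
    rw [dotProduct_comm R r, dotProduct_comm (H⁻¹ *ᵥ r) r]
    ring
  rw [e3]
  have hr := dotProduct_self_nonneg_real r
  have h1 := abs_quadForm_le H R
  have h2 : |r ⬝ᵥ R| ≤ √Δ * (r ⬝ᵥ r + J) := by
    refine abs_le_of_sq_le_sq ?_ (by positivity)
    rw [mul_pow, Real.sq_sqrt hΔ]
    calc (r ⬝ᵥ R) ^ 2 ≤ (r ⬝ᵥ r) * (R ⬝ᵥ R) := dotProduct_sq_le r R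
      _ ≤ (r ⬝ᵥ r + J) * (Δ * (r ⬝ᵥ r + J)) :=
          mul_le_mul (by linarith) hR (dotProduct_self_nonneg_real R) (by positivity)
      _ = _ := by ring
  have h3 := mul_le_mul_of_nonneg_left hR (by linarith [sqFrobenius_nonneg H] :
    0 ≤ 1 + sqFrobenius H)
  calc |2 * (r ⬝ᵥ R) + 1 / 2 * (R ⬝ᵥ H *ᵥ R)|
      ≤ |2 * (r ⬝ᵥ R)| + |1 / 2 * (R ⬝ᵥ H *ᵥ R)| := abs_add_le _ _
    _ ≤ 2 * (√Δ * (r ⬝ᵥ r + J)) + (1 + sqFrobenius H) * (Δ * (r ⬝ᵥ r + J)) := by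
        rw [abs_mul, abs_two]; linarith
    _ = _ := by ring

end Linearization

/-! ### The floored least-squares estimator of an i.i.d. sample -/

section FlooredLeastSquares

variable {Ω 𝒱 : Type*} [MeasurableSpace Ω] [MeasurableSpace 𝒱] {q : ℕ}

/-- `(2 / N) ∑_{i < N} U(x_i) U(x_i)ᵀ`. -/
noncomputable def sampleGram (U : 𝒱 → EuclideanSpace ℝ (Fin q)) (N : ℕ) (x : ℕ → 𝒱) :
    Matrix (Fin q) (Fin q) ℝ :=
  Matrix.of fun a b => 2 / (N : ℝ) * ∑ i ∈ Finset.range N, U (x i) a * U (x i) b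

/-- `(1 / N) ∑_{i < N} w(x_i) U(x_i)`. -/
noncomputable def sampleMoment (w : 𝒱 → ℝ) (U : 𝒱 → EuclideanSpace ℝ (Fin q)) (N : ℕ)
    (x : ℕ → 𝒱) : EuclideanSpace ℝ (Fin q) :=
  (1 / (N : ℝ)) • ∑ i ∈ Finset.range N, w (x i) • U (x i)

/-- The floored least-squares estimator for responses `w` and regressors `U`. -/
noncomputable def floorEstimator (ε : ℝ) (w : 𝒱 → ℝ) (U : 𝒱 → EuclideanSpace ℝ (Fin q)) (N : ℕ)
    (x : ℕ → 𝒱) : EuclideanSpace ℝ (Fin q) :=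
  (2 : ℝ) • Matrix.toEuclideanLin (eigenFloor (sampleGram U N x) ε)⁻¹ (sampleMoment w U N x)

theorem sampleGram_posSemidef (U : 𝒱 → EuclideanSpace ℝ (Fin q)) (N : ℕ) (x : ℕ → 𝒱) :
    (sampleGram U N x).PosSemidef := by
  have : sampleGram U N x = (2 / (N : ℝ)) • ∑ i ∈ Finset.range N,
      Matrix.vecMulVec (U (x i)).ofLp (star (U (x i)).ofLp) := by
    ext a b
    simp [sampleGram, Matrix.sum_apply, Matrix.vecMulVec_apply]
  rw [this]
  exact (Matrix.posSemidef_sum _ fun i _ => Matrix.posSemidef_vecMulVec_self_star _).smul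
    (by positivity)

theorem sampleMoment_apply (w : 𝒱 → ℝ) (U : 𝒱 → EuclideanSpace ℝ (Fin q)) (N : ℕ) (x : ℕ → 𝒱)
    (a : Fin q) :
    sampleMoment w U N x a = 1 / (N : ℝ) * ∑ i ∈ Finset.range N, w (x i) * U (x i) a := by
  simp [sampleMoment]

theorem floorEstimator_ofLp (ε : ℝ) (w : 𝒱 → ℝ) (U : 𝒱 → EuclideanSpace ℝ (Fin q)) (N : ℕ)
    (x : ℕ → 𝒱) : (floorEstimator ε w U N x).ofLp
      = (2 : ℝ) • ((eigenFloor (sampleGram U N x) ε)⁻¹ *ᵥ (sampleMoment w U N x).ofLp) := rfl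

/-- The score `(w - θ · U) U`. -/
noncomputable def score (w : 𝒱 → ℝ) (U : 𝒱 → EuclideanSpace ℝ (Fin q))
    (θ : EuclideanSpace ℝ (Fin q)) (v : 𝒱) : EuclideanSpace ℝ (Fin q) :=
  (w v - inner ℝ θ (U v)) • U v

theorem score_apply (w : 𝒱 → ℝ) (U : 𝒱 → EuclideanSpace ℝ (Fin q))
    (θ : EuclideanSpace ℝ (Fin q)) (v : 𝒱) (a : Fin q) :
    score w U θ v a = w v * U v a - ∑ b, θ b * (U v a * U v b) := by
  simp only [score, PiLp.smul_apply, smul_eq_mul, real_inner_eq_sum, sub_mul, Finset.sum_mul]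
  congr 1
  exact Finset.sum_congr rfl fun b _ => by ring

theorem sampleMoment_sub (w : 𝒱 → ℝ) (U : 𝒱 → EuclideanSpace ℝ (Fin q))
    (θ : EuclideanSpace ℝ (Fin q)) (N : ℕ) (x : ℕ → 𝒱) (a : Fin q) :
    ((sampleMoment w U N x).ofLp - (1 / 2 : ℝ) • (sampleGram U N x *ᵥ θ.ofLp)) a
      = 1 / (N : ℝ) * ∑ i ∈ Finset.range N, score w U θ (x i) a := by
  simp only [Pi.sub_apply, Pi.smul_apply, smul_eq_mul, sampleMoment_apply, Matrix.mulVec,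
    dotProduct, score_apply, Finset.sum_sub_distrib, mul_sub, sampleGram, Matrix.of_apply]
  congr 1
  rw [Finset.sum_comm, Finset.mul_sum, Finset.mul_sum]
  refine Finset.sum_congr rfl fun b _ => ?_
  rw [← Finset.mul_sum]
  ring

/-- An i.i.d. sample `V` with responses `w` and regressors `U`, with second moment matrix `H / 2`
and normal equation `H θ = 2 E[w U]`. -/
structure RegressionSample (μ : Measure Ω) (V : ℕ → Ω → 𝒱) (w : 𝒱 → ℝ)
    (U : 𝒱 → EuclideanSpace ℝ (Fin q)) (H : Matrix (Fin q) (Fin q) ℝ)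
    (θ : EuclideanSpace ℝ (Fin q)) : Prop where
  indep : iIndepFun V μ
  measurable_V : ∀ i, Measurable (V i)
  ident : ∀ i, IdentDistrib (V i) (V 0) μ μ
  measurable_w : Measurable w
  measurable_U : Measurable U
  memLp_gram : ∀ a b, MemLp (fun ω => U (V 0 ω) a * U (V 0 ω) b) 2 μ
  memLp_moment : ∀ a, MemLp (fun ω => w (V 0 ω) * U (V 0 ω) a) 2 μ
  gram : ∀ a b, H a b = 2 * ∫ ω, U (V 0 ω) a * U (V 0 ω) b ∂μ
  normal : ∀ a, (H *ᵥ θ.ofLp) a = 2 * ∫ ω, w (V 0 ω) * U (V 0 ω) a ∂μ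

namespace RegressionSample

variable {μ : Measure Ω} [IsProbabilityMeasure μ] {V : ℕ → Ω → 𝒱} {w : 𝒱 → ℝ}
  {U : 𝒱 → EuclideanSpace ℝ (Fin q)} {H : Matrix (Fin q) (Fin q) ℝ}
  {θ : EuclideanSpace ℝ (Fin q)}

section Basic

variable (h : RegressionSample μ V w U H θ)
include h

theorem measurable_U_apply (a : Fin q) : Measurable fun v => U v a :=
  Measurable.euclidean_apply h.measurable_U a

theorem measurable_score : Measurable (score w U θ) :=
  (h.measurable_w.sub (measurable_const.inner h.measurable_U)).smul h.measurable_U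

theorem measurable_score_apply (a : Fin q) : Measurable fun v => score w U θ v a :=
  Measurable.euclidean_apply h.measurable_score a

theorem memLp_score (a : Fin q) : MemLp (fun ω => score w U θ (V 0 ω) a) 2 μ := by
  simp_rw [score_apply]
  exact (h.memLp_moment a).sub (memLp_finsetSum _ fun b _ => (h.memLp_gram a b).const_mul _)

theorem integral_score (a : Fin q) : ∫ ω, score w U θ (V 0 ω) a ∂μ = 0 := by
  have hi : ∀ b, Integrable (fun ω => θ b * (U (V 0 ω) a * U (V 0 ω) b)) μ := fun b =>
    ((h.memLp_gram a b).integrable one_le_two).const_mul _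
  simp_rw [score_apply]
  rw [integral_sub ((h.memLp_moment a).integrable one_le_two) (integrable_finsetSum _ fun b _ => hi b),
    integral_finsetSum _ fun b _ => hi b]
  simp_rw [integral_const_mul]
  have h1 := h.normal a
  simp only [Matrix.mulVec, dotProduct, h.gram] at h1
  have h2 : ∑ b, 2 * (∫ ω, U (V 0 ω) a * U (V 0 ω) b ∂μ) * θ b
      = 2 * ∑ b, θ b * ∫ ω, U (V 0 ω) a * U (V 0 ω) b ∂μ := by
    rw [Finset.mul_sum]; exact Finset.sum_congr rfl fun b _ => by ring
  linarith

theorem measurable_gramDev (a b : Fin q) :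
    Measurable fun v => 2 * (U v a * U v b) - H a b :=
  (((h.measurable_U_apply a).mul (h.measurable_U_apply b)).const_mul 2).sub_const _

theorem memLp_gramDev (a b : Fin q) :
    MemLp (fun ω => 2 * (U (V 0 ω) a * U (V 0 ω) b) - H a b) 2 μ :=
  ((h.memLp_gram a b).const_mul 2).sub (memLp_const _)

theorem integral_gramDev (a b : Fin q) :
    ∫ ω, (2 * (U (V 0 ω) a * U (V 0 ω) b) - H a b) ∂μ = 0 := by
  rw [integral_sub (((h.memLp_gram a b).integrable one_le_two).const_mul 2) (by simp),
    integral_const_mul, h.gram a b]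
  simp

end Basic

/-- The dominating sequence `N (|r_N|² + |G_N - H|²)`. -/
noncomputable def domSeq (V : ℕ → Ω → 𝒱) (w : 𝒱 → ℝ) (U : 𝒱 → EuclideanSpace ℝ (Fin q))
    (H : Matrix (Fin q) (Fin q) ℝ) (θ : EuclideanSpace ℝ (Fin q)) (N : ℕ) (ω : Ω) : ℝ :=
  ∑ a, ((√(N : ℝ))⁻¹ * ∑ i ∈ Finset.range N, score w U θ (V i ω) a) ^ 2
    + ∑ a, ∑ b, ((√(N : ℝ))⁻¹ * ∑ i ∈ Finset.range N,
        (2 * (U (V i ω) a * U (V i ω) b) - H a b)) ^ 2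

theorem natCast_mul_sq_mean (N : ℕ) (s : ℝ) :
    (N : ℝ) * (1 / (N : ℝ) * s) ^ 2 = ((√(N : ℝ))⁻¹ * s) ^ 2 := by
  rcases Nat.eq_zero_or_pos N with rfl | hN
  · simp
  · have : (0 : ℝ) < N := by exact_mod_cast hN
    rw [mul_pow, mul_pow, inv_pow, Real.sq_sqrt this.le]
    field_simp

/-- The averaged score `r_N`. -/
noncomputable def meanScore (w : 𝒱 → ℝ) (U : 𝒱 → EuclideanSpace ℝ (Fin q))
    (θ : EuclideanSpace ℝ (Fin q)) (N : ℕ) (x : ℕ → 𝒱) : Fin q → ℝ :=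
  (sampleMoment w U N x).ofLp - (1 / 2 : ℝ) • (sampleGram U N x *ᵥ θ.ofLp)

theorem natCast_mul_eq_domSeq (N : ℕ) (ω : Ω) :
    (N : ℝ) * (meanScore w U θ N (fun i => V i ω) ⬝ᵥ meanScore w U θ N (fun i => V i ω)
      + sqFrobenius (sampleGram U N (fun i => V i ω) - H)) = domSeq V w U H θ N ω := by
  rw [mul_add, domSeq, dotProduct, sqFrobenius, Finset.mul_sum, Finset.mul_sum]
  congr 1
  · refine Finset.sum_congr rfl fun a _ => ?_
    rw [meanScore, sampleMoment_sub, ← natCast_mul_sq_mean, sq]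
  · refine Finset.sum_congr rfl fun a _ => ?_
    rw [Finset.mul_sum]
    refine Finset.sum_congr rfl fun b _ => ?_
    -- For `N = 0` the factor `N` kills one side and `(√0)⁻¹ = 0` the other.
    rcases Nat.eq_zero_or_pos N with rfl | hN
    · simp
    · rw [← natCast_mul_sq_mean]
      have : (N : ℝ) ≠ 0 := by positivity
      congr 2
      simp only [Matrix.sub_apply, sampleGram, Matrix.of_apply, Finset.sum_sub_distrib,
        Finset.sum_const, Finset.card_range, ← Finset.mul_sum, nsmul_eq_mul]
      field_simp

section Main

variable (h : RegressionSample μ V w U H θ)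
include h

theorem measurable_sq_sum {φ : 𝒱 → ℝ} (hφ : Measurable φ) (N : ℕ) :
    Measurable fun ω => ((√(N : ℝ))⁻¹ * ∑ i ∈ Finset.range N, φ (V i ω)) ^ 2 :=
  ((Finset.measurable_fun_sum _ fun i _ => hφ.comp (h.measurable_V i)).const_mul _).pow_const 2

theorem uniformTail_domSeq : UniformTail μ (domSeq V w U H θ) := by
  have t1 := fun a : Fin q => uniformTail_sq_sum h.indep h.measurable_V h.ident
    (h.measurable_score_apply a) (h.memLp_score a) (h.integral_score a)
  have t2 := fun a b : Fin q => uniformTail_sq_sum h.indep h.measurable_V h.ident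
    (h.measurable_gramDev a b) (h.memLp_gramDev a b) (h.integral_gramDev a b)
  have m1 := fun a : Fin q => h.measurable_sq_sum (h.measurable_score_apply a)
  have m2 := fun a b : Fin q => h.measurable_sq_sum (h.measurable_gramDev a b)
  have s1 := UniformTail.sum (s := Finset.univ) (fun a _ => t1 a) m1
  have s2 := fun a => UniformTail.sum (s := Finset.univ) (fun b _ => t2 a b) (m2 a)
  have s3 := UniformTail.sum (s := Finset.univ) (fun a _ => s2 a)
    fun a N => Finset.measurable_fun_sum _ fun b _ => m2 a b N
  have s4 := s1.add s3 fun N => Finset.measurable_fun_sum _ fun a _ => m1 a N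
  exact s4

theorem strong_law {φ : 𝒱 → ℝ} (hφ : Measurable φ) (hi : Integrable (fun ω => φ (V 0 ω)) μ) :
    ∀ᵐ ω ∂μ, Tendsto (fun N : ℕ => 1 / (N : ℝ) * ∑ i ∈ Finset.range N, φ (V i ω)) atTop
      (𝓝 (∫ ω, φ (V 0 ω) ∂μ)) := by
  filter_upwards [strong_law_ae_real (fun i ω => φ (V i ω)) hi
    (fun i j hij => (h.indep.indepFun hij).comp hφ hφ) fun i => (h.ident i).comp hφ] with ω hω
  simpa [div_eq_inv_mul] using hω

theorem tendsto_sampleGram (a b : Fin q) : ∀ᵐ ω ∂μ,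
    Tendsto (fun N : ℕ => sampleGram U N (fun i => V i ω) a b) atTop (𝓝 (H a b)) := by
  filter_upwards [h.strong_law (φ := fun v => U v a * U v b)
    ((h.measurable_U_apply a).mul (h.measurable_U_apply b))
    ((h.memLp_gram a b).integrable one_le_two)] with ω hω
  rw [h.gram a b]
  refine (hω.const_mul 2).congr fun N => ?_
  simp only [sampleGram, Matrix.of_apply]
  ring

theorem tendsto_meanScore (a : Fin q) : ∀ᵐ ω ∂μ,
    Tendsto (fun N : ℕ => meanScore w U θ N (fun i => V i ω) a) atTop (𝓝 0) := by
  filter_upwards [h.strong_law (h.measurable_score_apply a)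
    ((h.memLp_score a).integrable one_le_two)] with ω hω
  rw [← h.integral_score a]
  exact hω.congr fun N => (sampleMoment_sub w U θ N _ a).symm

theorem measurable_sampleGram (N : ℕ) (a b : Fin q) :
    Measurable fun ω => sampleGram U N (fun i => V i ω) a b :=
  (Finset.measurable_fun_sum _ fun i _ =>
    ((h.measurable_U_apply a).mul (h.measurable_U_apply b)).comp (h.measurable_V i)).const_mul _

theorem measurable_inv_floor (N : ℕ) (ε : ℝ) (a b : Fin q) :
    Measurable fun ω => (eigenFloor (sampleGram U N fun i => V i ω) ε)⁻¹ a b :=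
  measurable_inv_apply (fun c d => measurable_eigenFloor_apply (h.measurable_sampleGram N)
    (fun _ => (sampleGram_posSemidef _ _ _).1) ε c d) a b

theorem measurable_errorWeight (ε : ℝ) (N : ℕ) :
    Measurable fun ω => errorWeight H ε θ.ofLp (sampleGram U N fun i => V i ω) := by
  have m1 : Measurable fun ω => sqFrobenius ((eigenFloor (sampleGram U N fun i => V i ω) ε)⁻¹ - H⁻¹) :=
    Finset.measurable_fun_sum _ fun a _ => Finset.measurable_fun_sum _ fun b _ =>
      ((h.measurable_inv_floor N ε a b).sub_const _).pow_const 2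
  have m2 : Measurable fun ω => sqFrobenius ((sampleGram U N fun i => V i ω) - H) :=
    Finset.measurable_fun_sum _ fun a _ => Finset.measurable_fun_sum _ fun b _ =>
      ((h.measurable_sampleGram N a b).sub_const _).pow_const 2
  exact (m1.const_mul 8).add (Measurable.ite (measurableSet_lt measurable_const m2)
    measurable_const measurable_const)

theorem tendsto_sqFrobenius : ∀ᵐ ω ∂μ,
    Tendsto (fun N : ℕ => sqFrobenius ((sampleGram U N fun i => V i ω) - H)) atTop (𝓝 0) := by
  have h1 := ae_all_iff.mpr fun a => ae_all_iff.mpr fun b => h.tendsto_sampleGram a b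
  filter_upwards [h1] with ω hω
  have : (0 : ℝ) = ∑ a : Fin q, ∑ b : Fin q, (H a b - H a b) ^ 2 := by simp
  rw [this]
  exact tendsto_finsetSum _ fun a _ => tendsto_finsetSum _ fun b _ =>
    ((hω a b).sub_const _).pow 2

variable {ε : ℝ} (hε : 0 < ε) (hH : H.PosDef)
  (hHε : (H - (2 * ε) • (1 : Matrix (Fin q) (Fin q) ℝ)).PosSemidef)
include hε hH hHε

/-- Almost surely `G` is eventually within `ε` of `H`. From then on the indicator is off and the
floor inactive, and continuity of the inverse at `H` disposes of the rest. -/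
theorem tendsto_errorWeight : ∀ᵐ ω ∂μ, Tendsto (fun N : ℕ =>
    errorWeight H ε θ.ofLp (sampleGram U N fun i => V i ω)) atTop (𝓝 0) := by
  have h1 := ae_all_iff.mpr fun a => ae_all_iff.mpr fun b => h.tendsto_sampleGram a b
  filter_upwards [h1, h.tendsto_sqFrobenius] with ω hω hJ
  have hG : Tendsto (fun N : ℕ => sampleGram U N fun i => V i ω) atTop (𝓝 H) :=
    tendsto_pi_nhds.mpr fun a => tendsto_pi_nhds.mpr fun b => hω a b
  have hdet : H.det ≠ 0 := hH.det_pos.ne'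
  have hinv : Tendsto (fun N : ℕ => (sampleGram U N fun i => V i ω)⁻¹) atTop (𝓝 H⁻¹) := by
    refine (continuousAt_matrix_inv H ?_).tendsto.comp hG
    rw [Ring.inverse_eq_inv']
    exact continuousAt_inv₀ hdet
  have hD : Tendsto (fun N : ℕ => 8 * sqFrobenius ((sampleGram U N fun i => V i ω)⁻¹ - H⁻¹)) atTop
      (𝓝 0) := by
    have : (0 : ℝ) = 8 * ∑ a : Fin q, ∑ b : Fin q, (H⁻¹ a b - H⁻¹ a b) ^ 2 := by simp
    rw [this]
    exact (tendsto_finsetSum _ fun a _ => tendsto_finsetSum _ fun b _ =>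
      ((tendsto_pi_nhds.mp (tendsto_pi_nhds.mp hinv a) b).sub_const _).pow 2).const_mul 8
  refine hD.congr' ?_
  filter_upwards [hJ.eventually_le_const (show (0 : ℝ) < ε ^ 2 by positivity)] with N hN
  rw [errorWeight, if_neg (not_lt.mpr hN), add_zero,
    eigenFloor_eq_self_of_sum_sq_sub_le hε.le hHε (sampleGram_posSemidef _ _ _).1 hN]

end Main

end RegressionSample

end FlooredLeastSquares

/-! ### Limit theorems for the floored estimator -/

namespace RegressionSample

section

variable {Ω 𝒱 : Type*} [MeasurableSpace Ω] [MeasurableSpace 𝒱] {q : ℕ}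
  {μ : Measure Ω} [IsProbabilityMeasure μ] {V : ℕ → Ω → 𝒱} {w : 𝒱 → ℝ}
  {U : 𝒱 → EuclideanSpace ℝ (Fin q)} {H : Matrix (Fin q) (Fin q) ℝ}
  {θ : EuclideanSpace ℝ (Fin q)}

theorem floorEstimator_sub_ofLp (H : Matrix (Fin q) (Fin q) ℝ) (θ : EuclideanSpace ℝ (Fin q))
    (ε : ℝ) (N : ℕ) (x : ℕ → 𝒱) : (floorEstimator ε w U N x - θ).ofLp
      = (2 : ℝ) • (H⁻¹ *ᵥ meanScore w U θ N x)
        + linError H ε θ.ofLp (sampleGram U N x) (sampleMoment w U N x).ofLp := by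
  rw [WithLp.ofLp_sub, floorEstimator_ofLp, linError, meanScore]
  abel

variable (h : RegressionSample μ V w U H θ)
include h

theorem measurable_sampleMoment (N : ℕ) (a : Fin q) :
    Measurable fun ω => (sampleMoment w U N fun i => V i ω) a := by
  simp_rw [sampleMoment_apply]
  exact (Finset.measurable_fun_sum _ fun i _ =>
    (h.measurable_w.mul (h.measurable_U_apply a)).comp (h.measurable_V i)).const_mul _

theorem measurable_floorEstimator (ε : ℝ) (N : ℕ) :
    Measurable fun ω => floorEstimator ε w U N fun i => V i ω := by
  refine measurable_euclidean fun a => ?_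
  simp only [floorEstimator_ofLp, Pi.smul_apply, Matrix.mulVec, dotProduct, smul_eq_mul]
  exact (Finset.measurable_fun_sum _ fun b _ => (h.measurable_inv_floor N ε a b).mul
    (h.measurable_sampleMoment N b)).const_mul 2

variable {ε : ℝ} (hε : 0 < ε) (hH : H.PosDef)
  (hHε : (H - (2 * ε) • (1 : Matrix (Fin q) (Fin q) ℝ)).PosSemidef)
include hε hH hHε

/-- Strong consistency. -/
theorem tendsto_floorEstimator : ∀ᵐ ω ∂μ,
    Tendsto (fun N => floorEstimator ε w U N fun i => V i ω) atTop (𝓝 θ) := by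
  filter_upwards [h.tendsto_errorWeight hε hH hHε, h.tendsto_sqFrobenius,
    ae_all_iff.mpr h.tendsto_meanScore] with ω hΔ hJ hr
  have hrr : Tendsto (fun N => meanScore w U θ N (fun i => V i ω)
      ⬝ᵥ meanScore w U θ N (fun i => V i ω)) atTop (𝓝 0) := by
    have : (0 : ℝ) = ∑ _a : Fin q, (0 : ℝ) * 0 := by simp
    rw [this]
    exact tendsto_finsetSum _ fun a _ => (hr a).mul (hr a)
  have hb := hΔ.mul (hrr.add hJ)
  simp only [add_zero, mul_zero] at hb
  -- Here the weight, the mean score and `G - H` all tend to `0` pathwise, so `linError_sq_le` makes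
  -- the remainder vanish.
  have hR2 : Tendsto (fun N => linError H ε θ.ofLp (sampleGram U N fun i => V i ω)
        (sampleMoment w U N fun i => V i ω).ofLp ⬝ᵥ linError H ε θ.ofLp
        (sampleGram U N fun i => V i ω) (sampleMoment w U N fun i => V i ω).ofLp)
      atTop (𝓝 0) :=
    squeeze_zero (fun N => dotProduct_self_nonneg_real _)
      (fun N => linError_sq_le hHε (sampleGram_posSemidef _ _ _) hε _ _) hb
  have hR : ∀ a, Tendsto (fun N => linError H ε θ.ofLp (sampleGram U N fun i => V i ω)
        (sampleMoment w U N fun i => V i ω).ofLp a) atTop (𝓝 0) := by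
    intro a
    have h1 : Tendsto (fun N => √(linError H ε θ.ofLp (sampleGram U N fun i => V i ω)
        (sampleMoment w U N fun i => V i ω).ofLp ⬝ᵥ linError H ε θ.ofLp
        (sampleGram U N fun i => V i ω) (sampleMoment w U N fun i => V i ω).ofLp)) atTop (𝓝 0) := by
      simpa [Function.comp_def] using (Real.continuous_sqrt.tendsto 0).comp hR2
    refine squeeze_zero_norm (fun N => ?_) h1
    rw [Real.norm_eq_abs]
    refine Real.abs_le_sqrt ?_
    rw [sq]
    exact Finset.single_le_sum (f := fun a => _ * _) (fun i _ => mul_self_nonneg _)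
      (Finset.mem_univ a)
  have hsub : ∀ a, Tendsto (fun N => (floorEstimator ε w U N (fun i => V i ω) - θ).ofLp a)
      atTop (𝓝 0) := by
    intro a
    simp only [floorEstimator_sub_ofLp H, Pi.add_apply, Pi.smul_apply, smul_eq_mul, Matrix.mulVec,
      dotProduct]
    have : (0 : ℝ) = 2 * ∑ b : Fin q, H⁻¹ a b * 0 + 0 := by simp
    rw [this]
    exact ((tendsto_finsetSum _ fun b _ => (hr b).const_mul _).const_mul 2).add (hR a)
  have hpi : Tendsto (fun N => (floorEstimator ε w U N fun i => V i ω).ofLp) atTop (𝓝 θ.ofLp) := by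
    refine tendsto_pi_nhds.mpr fun a => ?_
    have := (hsub a).add_const (θ a)
    simpa using this
  exact ((PiLp.continuous_toLp 2 _).tendsto θ.ofLp).comp hpi

omit h hH in
theorem natCast_mul_linError_le (N : ℕ) (ω : Ω) :
    (N : ℝ) * (linError H ε θ.ofLp (sampleGram U N fun i => V i ω)
        (sampleMoment w U N fun i => V i ω).ofLp ⬝ᵥ linError H ε θ.ofLp
        (sampleGram U N fun i => V i ω) (sampleMoment w U N fun i => V i ω).ofLp)
      ≤ errorWeight H ε θ.ofLp (sampleGram U N fun i => V i ω) * domSeq V w U H θ N ω := by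
  rw [← natCast_mul_eq_domSeq, mul_left_comm]
  exact mul_le_mul_of_nonneg_left
    (linError_sq_le hHε (sampleGram_posSemidef _ _ _) hε _ _) (by positivity)

theorem tendsto_lintegral_errorWeight_mul :
    Tendsto (fun N => ∫⁻ ω, ENNReal.ofReal (errorWeight H ε θ.ofLp (sampleGram U N fun i => V i ω)
      * domSeq V w U H θ N ω) ∂μ) atTop (𝓝 0) := by
  obtain ⟨c, hc⟩ := errorWeight_le H hε θ.ofLp
  exact h.uniformTail_domSeq.tendsto_lintegral_mul (h.measurable_errorWeight ε)
    (fun _ _ => errorWeight_nonneg _ _ _ _) (fun _ _ => hc _ (sampleGram_posSemidef _ _ _).1)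
    (h.tendsto_errorWeight hε hH hHε)

/-- Asymptotic normality. -/
theorem tendstoInDistribution_floorEstimator {Γ : Matrix (Fin q) (Fin q) ℝ}
    (hΓ : ∀ a b, Γ a b = ∫ ω, score w U θ (V 0 ω) a * score w U θ (V 0 ω) b ∂μ) :
    TendstoInDistribution
      (fun (N : ℕ) ω => √(N : ℝ) • (floorEstimator ε w U N (fun i => V i ω) - θ)) atTop
      id (fun _ => μ) (multivariateGaussian 0 ((4 : ℝ) • (H⁻¹ * Γ * H⁻¹))) := by
  set φ : 𝒱 → EuclideanSpace ℝ (Fin q) := fun v =>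
    WithLp.toLp 2 ((2 : ℝ) • (H⁻¹ *ᵥ (score w U θ v).ofLp)) with hφ
  have hφa : ∀ v a, φ v a = 2 * ∑ b, H⁻¹ a b * score w U θ v b := fun v a => rfl
  have hφm : Measurable φ := by
    refine measurable_euclidean fun a => ?_
    simp_rw [hφa]
    exact (Finset.measurable_fun_sum _ fun b _ => (h.measurable_score_apply b).const_mul _).const_mul 2
  have hφ2 : ∀ a, MemLp (fun ω => φ (V 0 ω) a) 2 μ := fun a => by
    simp_rw [hφa]
    exact (memLp_finsetSum _ fun b _ => (h.memLp_score b).const_mul _).const_mul 2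
  have hφ0 : ∀ a, ∫ ω, φ (V 0 ω) a ∂μ = 0 := fun a => by
    simp_rw [hφa]
    rw [integral_const_mul, integral_finsetSum _ fun b _ =>
      ((h.memLp_score b).integrable one_le_two).const_mul _]
    simp [integral_const_mul, h.integral_score]
  have hHT : ∀ a b, H⁻¹ a b = H⁻¹ b a := fun a b => by
    have := hH.inv.1.apply a b
    simpa using this.symm
  have hcov : ∀ a b, ((4 : ℝ) • (H⁻¹ * Γ * H⁻¹)) a b = ∫ ω, φ (V 0 ω) a * φ (V 0 ω) b ∂μ := by
    intro a b
    have hi : ∀ c d, Integrable (fun ω => 4 * (H⁻¹ a c * H⁻¹ b d)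
        * (score w U θ (V 0 ω) c * score w U θ (V 0 ω) d)) μ := fun c d =>
      ((h.memLp_score c).integrable_mul (h.memLp_score d)).const_mul _
    have e : ∀ ω, φ (V 0 ω) a * φ (V 0 ω) b = ∑ d, ∑ c, 4 * (H⁻¹ a c * H⁻¹ b d)
        * (score w U θ (V 0 ω) c * score w U θ (V 0 ω) d) := by
      intro ω
      rw [hφa, hφa, mul_mul_mul_comm, Finset.sum_mul_sum, Finset.sum_comm, Finset.mul_sum]
      refine Finset.sum_congr rfl fun d _ => ?_
      rw [Finset.mul_sum]
      exact Finset.sum_congr rfl fun c _ => by ring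
    simp_rw [e]
    rw [integral_finsetSum _ fun d _ => integrable_finsetSum _ fun c _ => hi c d]
    simp_rw [fun d => integral_finsetSum Finset.univ fun c _ => hi c d, integral_const_mul, ← hΓ]
    simp only [Matrix.smul_apply, Matrix.mul_apply, smul_eq_mul, Finset.sum_mul, Finset.mul_sum]
    refine Finset.sum_congr rfl fun d _ => Finset.sum_congr rfl fun c _ => ?_
    rw [hHT b d]; ring
  have hclt := tendstoInDistribution_inv_sqrt_smul_sum h.indep h.measurable_V h.ident hφm hφ2 hφ0
    hcov
  have hYm : ∀ N : ℕ, Measurable fun ω =>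
      √(N : ℝ) • (floorEstimator ε w U N (fun i => V i ω) - θ) := fun N =>
    (measurable_const_smul (√(N : ℝ))).comp ((h.measurable_floorEstimator ε N).sub_const θ)
  -- Slutsky: the estimator and the linearized sum differ by `√N R`, which tends to `0` in `L²`.
  refine tendstoInDistribution_of_tendstoInMeasure_sub _ _ hclt ?_ fun N => (hYm N).aemeasurable
  have hdiff : ∀ (N : ℕ) ω, (√(N : ℝ) • (floorEstimator ε w U N (fun i => V i ω) - θ)
      - (√(N : ℝ))⁻¹ • ∑ i ∈ Finset.range N, φ (V i ω)).ofLp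
      = √(N : ℝ) • linError H ε θ.ofLp (sampleGram U N fun i => V i ω)
        (sampleMoment w U N fun i => V i ω).ofLp := by
    intro N ω
    have hs : √(N : ℝ) * (1 / (N : ℝ)) = (√(N : ℝ))⁻¹ := by
      rw [mul_one_div, Real.sqrt_div_self', one_div]
    have e1 : ∀ a, (∑ i ∈ Finset.range N, φ (V i ω)).ofLp a
        = 2 * ∑ b, H⁻¹ a b * ∑ i ∈ Finset.range N, score w U θ (V i ω) b := by
      intro a
      rw [WithLp.ofLp_sum, Finset.sum_apply]
      simp_rw [hφa, Finset.mul_sum]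
      exact Finset.sum_comm
    have e3 : ∀ b, meanScore w U θ N (fun i => V i ω) b
        = 1 / (N : ℝ) * ∑ i ∈ Finset.range N, score w U θ (V i ω) b := fun b =>
      sampleMoment_sub w U θ N _ b
    have e4 : ∀ a, (H⁻¹ *ᵥ meanScore w U θ N fun i => V i ω) a
        = 1 / (N : ℝ) * ∑ b, H⁻¹ a b * ∑ i ∈ Finset.range N, score w U θ (V i ω) b := by
      intro a
      rw [Matrix.mulVec, dotProduct, Finset.mul_sum]
      exact Finset.sum_congr rfl fun b _ => by rw [e3]; ring
    ext a
    rw [WithLp.ofLp_sub, WithLp.ofLp_smul, WithLp.ofLp_smul, floorEstimator_sub_ofLp H]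
    simp only [Pi.sub_apply, Pi.smul_apply, Pi.add_apply, smul_eq_mul, e1, e4]
    rw [← hs]
    ring
  refine tendstoInMeasure_of_tendsto_eLpNorm (p := 2) two_ne_zero (fun N => ?_)
    aestronglyMeasurable_const ?_
  · exact ((hYm N).aestronglyMeasurable).sub (hclt.forall_aemeasurable N).aestronglyMeasurable
  have hlim := h.tendsto_lintegral_errorWeight_mul hε hH hHε
  have hlim2 := (ENNReal.continuous_rpow_const (y := (1 / 2 : ℝ))).tendsto 0 |>.comp hlim
  rw [ENNReal.zero_rpow_of_pos (by norm_num)] at hlim2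
  refine tendsto_of_tendsto_of_tendsto_of_le_of_le tendsto_const_nhds hlim2
    (fun _ => zero_le) fun N => ?_
  rw [eLpNorm_eq_lintegral_rpow_enorm_toReal two_ne_zero ENNReal.ofNat_ne_top]
  simp only [ENNReal.toReal_ofNat, Function.comp_apply]
  refine ENNReal.rpow_le_rpow (lintegral_mono fun ω => ?_) (by norm_num)
  rw [sub_zero, ← ofReal_norm, ENNReal.rpow_ofNat, ← ENNReal.ofReal_pow (norm_nonneg _)]
  refine ENNReal.ofReal_le_ofReal ?_
  refine le_trans (le_of_eq ?_) (natCast_mul_linError_le hε hHε N ω)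
  rw [EuclideanSpace.real_norm_sq_eq, dotProduct, Finset.mul_sum]
  refine Finset.sum_congr rfl fun a _ => ?_
  have := congrFun (hdiff N ω) a
  simp only [Pi.sub_apply]
  rw [this, Pi.smul_apply, smul_eq_mul, mul_pow, Real.sq_sqrt (by positivity), sq]

omit h hH in
theorem natCast_mul_quadForm_le : ∃ c, 0 ≤ c ∧ ∀ (N : ℕ) (ω : Ω),
    |(N : ℝ) * (1 / 2 * ((floorEstimator ε w U N (fun i => V i ω) - θ).ofLp ⬝ᵥ
      H *ᵥ (floorEstimator ε w U N (fun i => V i ω) - θ).ofLp))| ≤ c * domSeq V w U H θ N ω := by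
  obtain ⟨c₀, hc₀⟩ := errorWeight_le H hε θ.ofLp
  have hc₀0 : 0 ≤ c₀ := (errorWeight_nonneg H ε θ.ofLp 0).trans
    (hc₀ 0 Matrix.isHermitian_zero)
  have hF := sqFrobenius_nonneg H⁻¹
  have hF' := sqFrobenius_nonneg H
  -- From `|2 H⁻¹ r + R|² ≤ 8 |H⁻¹ r|² + 2 |R|²`, with `c₀` a bound on the error weight.
  refine ⟨(1 + sqFrobenius H) * (8 * sqFrobenius H⁻¹ + 2 * c₀), by positivity, fun N ω => ?_⟩
  rw [abs_mul, abs_of_nonneg (by positivity : (0 : ℝ) ≤ N), ← natCast_mul_eq_domSeq, mul_left_comm]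
  refine mul_le_mul_of_nonneg_left ((abs_quadForm_le H _).trans ?_) (by positivity)
  rw [mul_assoc]
  refine mul_le_mul_of_nonneg_left ?_ (by positivity)
  rw [floorEstimator_sub_ofLp H]
  refine (dotProduct_add_self_le _ _).trans ?_
  have h1 := linError_sq_le hHε (sampleGram_posSemidef U N fun i => V i ω) hε θ.ofLp
    (sampleMoment w U N fun i => V i ω).ofLp
  rw [← meanScore.eq_1 w U θ N] at h1
  set r := meanScore w U θ N fun i => V i ω
  have hr := dotProduct_self_nonneg_real r
  have hJ := sqFrobenius_nonneg ((sampleGram U N fun i => V i ω) - H)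
  have h2 := mul_le_mul_of_nonneg_right (hc₀ _ (sampleGram_posSemidef U N fun i => V i ω).1)
    (add_nonneg hr hJ)
  have h3 := dotProduct_mulVec_sq_le H⁻¹ r
  change _ ≤ sqFrobenius H⁻¹ * _ at h3
  rw [smul_dotProduct, dotProduct_smul, smul_smul, smul_eq_mul]
  nlinarith [mul_nonneg hF hJ]

omit hε hH hHε in
theorem measurable_quadForm (N : ℕ) : Measurable fun ω =>
    1 / 2 * ((floorEstimator ε w U N (fun i => V i ω) - θ).ofLp ⬝ᵥ
      H *ᵥ (floorEstimator ε w U N (fun i => V i ω) - θ).ofLp) := by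
  have h1 : ∀ a, Measurable fun ω => (floorEstimator ε w U N (fun i => V i ω) - θ).ofLp a :=
    fun a => (Measurable.euclidean_apply (h.measurable_floorEstimator ε N) a).sub_const _
  simp only [dotProduct, Matrix.mulVec]
  exact (Finset.measurable_fun_sum _ fun a _ => (h1 a).mul (Finset.measurable_fun_sum _ fun b _ =>
    (h1 b).const_mul _)).const_mul _

/-- Uniform integrability of the rescaled excess risk. -/
theorem uniformIntegrable_quadForm : UniformIntegrable (fun (N : ℕ) ω =>
    (N : ℝ) * (1 / 2 * ((floorEstimator ε w U N (fun i => V i ω) - θ).ofLp ⬝ᵥ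
      H *ᵥ (floorEstimator ε w U N (fun i => V i ω) - θ).ofLp))) 1 μ := by
  obtain ⟨c, hc, hb⟩ := natCast_mul_quadForm_le (V := V) (w := w) (U := U) (θ := θ) hε hHε
  exact (h.uniformTail_domSeq.const_mul hc).uniformIntegrable
    (fun N => (h.measurable_quadForm N).const_mul _) hb

theorem integrable_quadForm (N : ℕ) : Integrable (fun ω =>
    1 / 2 * ((floorEstimator ε w U N (fun i => V i ω) - θ).ofLp ⬝ᵥ
      H *ᵥ (floorEstimator ε w U N (fun i => V i ω) - θ).ofLp)) μ := by
  rcases Nat.eq_zero_or_pos N with rfl | hN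
  -- Without data the moment is an empty sum, so the estimator is constant. For `N ≥ 1` the factor
  -- `N` in the uniformly integrable family is divided out.
  · simp only [floorEstimator, sampleMoment, Finset.range_zero, Finset.sum_empty, smul_zero, map_zero]
    exact integrable_const _
  · have h1 := ((h.uniformIntegrable_quadForm hε hH hHε).memLp N).integrable le_rfl
    have h2 := h1.const_mul (N : ℝ)⁻¹
    have hN0 : (N : ℝ) ≠ 0 := by positivity
    simpa only [inv_mul_cancel_left₀ hN0] using h2

omit hε hH hHε in
theorem memLp_meanScore (N : ℕ) (a : Fin q) :
    MemLp (fun ω => meanScore w U θ N (fun i => V i ω) a) 2 μ := by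
  simp_rw [meanScore, sampleMoment_sub]
  exact (memLp_sum h.ident (h.measurable_score_apply a) (h.memLp_score a) N).const_mul _

/-- First-order expansion of the mean excess risk. -/
theorem tendsto_integral_quadForm {Γ : Matrix (Fin q) (Fin q) ℝ}
    (hΓ : ∀ a b, Γ a b = ∫ ω, score w U θ (V 0 ω) a * score w U θ (V 0 ω) b ∂μ) :
    Tendsto (fun N : ℕ => (N : ℝ) * ∫ ω,
      1 / 2 * ((floorEstimator ε w U N (fun i => V i ω) - θ).ofLp ⬝ᵥ
        H *ᵥ (floorEstimator ε w U N (fun i => V i ω) - θ).ofLp) ∂μ) atTop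
      (𝓝 (2 * (Γ * H⁻¹).trace)) := by
  set W : ℕ → Ω → ℝ := fun N ω => errorWeight H ε θ.ofLp (sampleGram U N fun i => V i ω) with hW
  set Q : ℕ → Ω → ℝ := fun N ω => 1 / 2 * ((floorEstimator ε w U N (fun i => V i ω) - θ).ofLp ⬝ᵥ
      H *ᵥ (floorEstimator ε w U N (fun i => V i ω) - θ).ofLp) with hQ
  set L : ℕ → Ω → ℝ := fun N ω => 2 * (meanScore w U θ N (fun i => V i ω) ⬝ᵥ
      H⁻¹ *ᵥ meanScore w U θ N (fun i => V i ω)) with hL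
  have hHT : ∀ a b, H⁻¹ a b = H⁻¹ b a := fun a b => by
    have := hH.inv.1.apply a b
    simpa using this.symm
  have hLe : ∀ N ω, L N ω = ∑ a, ∑ b, 2 * H⁻¹ a b * (meanScore w U θ N (fun i => V i ω) a
      * meanScore w U θ N (fun i => V i ω) b) := by
    intro N ω
    simp only [hL, dotProduct, Matrix.mulVec, Finset.mul_sum]
    exact Finset.sum_congr rfl fun a _ => Finset.sum_congr rfl fun b _ => by ring
  have hri : ∀ N a b, Integrable (fun ω => meanScore w U θ N (fun i => V i ω) a
      * meanScore w U θ N (fun i => V i ω) b) μ := fun N a b =>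
    (h.memLp_meanScore N a).integrable_mul (h.memLp_meanScore N b)
  have hLi : ∀ N, Integrable (L N) μ := fun N => by
    have : L N = fun ω => _ := funext (hLe N)
    rw [this]
    exact integrable_finsetSum _ fun a _ => integrable_finsetSum _ fun b _ =>
      (hri N a b).const_mul _
  -- The linearized risk has the exact mean `2 tr(Γ H⁻¹) / N`, so only the remainder needs a limit.
  have hLv : ∀ N : ℕ, 0 < N → (N : ℝ) * ∫ ω, L N ω ∂μ = 2 * (Γ * H⁻¹).trace := by
    intro N hN
    have hN0 : (N : ℝ) ≠ 0 := by positivity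
    simp_rw [hLe]
    rw [integral_finsetSum _ fun a _ => integrable_finsetSum _ fun b _ =>
      (hri N a b).const_mul _]
    simp_rw [fun a => integral_finsetSum Finset.univ fun b _ =>
      (hri N a b).const_mul (2 * H⁻¹ a b), integral_const_mul]
    have e : ∀ a b, (N : ℝ) * ∫ ω, meanScore w U θ N (fun i => V i ω) a
        * meanScore w U θ N (fun i => V i ω) b ∂μ = Γ a b := by
      intro a b
      simp_rw [meanScore, sampleMoment_sub, mul_mul_mul_comm (1 / (N : ℝ))]
      rw [integral_const_mul, integral_sum_mul_sum h.indep h.ident (h.measurable_score_apply a)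
        (h.measurable_score_apply b) (h.memLp_score a) (h.memLp_score b) (h.integral_score a), hΓ]
      field_simp
    simp only [Matrix.trace, Matrix.diag_apply, Matrix.mul_apply, Finset.mul_sum]
    refine Finset.sum_congr rfl fun a _ => Finset.sum_congr rfl fun b _ => ?_
    rw [← e a b, hHT b a]; ring
  obtain ⟨c, hc⟩ := errorWeight_le H hε θ.ofLp
  have hW0 : ∀ N ω, 0 ≤ W N ω := fun _ _ => errorWeight_nonneg _ _ _ _
  have hWc : ∀ N ω, W N ω ≤ c := fun _ _ => hc _ (sampleGram_posSemidef _ _ _).1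
  have hF := sqFrobenius_nonneg H
  -- The weight produced by `abs_quadForm_add_sub_le` is again bounded and null almost surely, so it
  -- may multiply the uniformly integrable sequence.
  have hlim : Tendsto (fun N => ∫⁻ ω, ENNReal.ofReal ((2 * √(W N ω) + (1 + sqFrobenius H) * W N ω)
      * domSeq V w U H θ N ω) ∂μ) atTop (𝓝 0) := by
    refine h.uniformTail_domSeq.tendsto_lintegral_mul (c := 2 * √c + (1 + sqFrobenius H) * c)
      (fun N => ?_) (fun N ω => ?_) (fun N ω => ?_) ?_
    · exact ((h.measurable_errorWeight ε N).sqrt.const_mul 2).add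
        ((h.measurable_errorWeight ε N).const_mul _)
    · have := hW0 N ω; positivity
    · have := hWc N ω; gcongr
    · filter_upwards [h.tendsto_errorWeight hε hH hHε] with ω hω
      have h1 := ((Real.continuous_sqrt.tendsto 0).comp hω).const_mul 2
      have h2 := h1.add (hω.const_mul (1 + sqFrobenius H))
      simpa using h2
  have hbound : ∀ (N : ℕ) ω, |(N : ℝ) * (Q N ω - L N ω)|
      ≤ (2 * √(W N ω) + (1 + sqFrobenius H) * W N ω) * domSeq V w U H θ N ω := by
    intro N ω
    rw [abs_mul, abs_of_nonneg (by positivity : (0 : ℝ) ≤ N), ← natCast_mul_eq_domSeq,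
      mul_left_comm]
    refine mul_le_mul_of_nonneg_left ?_ (by positivity)
    simp only [hQ, hL, floorEstimator_sub_ofLp H]
    exact abs_quadForm_add_sub_le hH _ _ (hW0 N ω) (sqFrobenius_nonneg _)
      (linError_sq_le hHε (sampleGram_posSemidef _ _ _) hε _ _)
  have hdiff : Tendsto (fun N : ℕ => ∫ ω, (N : ℝ) * (Q N ω - L N ω) ∂μ) atTop (𝓝 0) := by
    rw [← integral_zero Ω ℝ (μ := μ)]
    refine tendsto_integral_of_L1 (μ := μ) (fun _ => (0 : ℝ)) aestronglyMeasurable_const ?_ ?_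
    · exact .of_forall fun N => (((h.integrable_quadForm hε hH hHε N).sub (hLi N)).const_mul _)
    · refine tendsto_of_tendsto_of_tendsto_of_le_of_le tendsto_const_nhds hlim
        (fun _ => zero_le) fun N => lintegral_mono fun ω => ?_
      rw [sub_zero, ← ofReal_norm, Real.norm_eq_abs]
      exact ENNReal.ofReal_le_ofReal (hbound N ω)
  have hfin := hdiff.add_const (2 * (Γ * H⁻¹).trace)
  rw [zero_add] at hfin
  refine hfin.congr' ?_
  filter_upwards [eventually_gt_atTop 0] with N hN
  rw [← hLv N hN, integral_const_mul, integral_sub (h.integrable_quadForm hε hH hHε N) (hLi N)]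
  ring

end

end RegressionSample

/-! ### Laws of the nested sample -/

section Laws

variable {d p : ℕ} {Ω Ω' : Type*} [MeasurableSpace Ω] [MeasurableSpace Ω']
  {P : Measure Ω} [IsProbabilityMeasure P] {P' : Measure Ω'} [IsProbabilityMeasure P']
  {X : Ω → EuclideanSpace ℝ (Fin d)} {Y : Ω → EuclideanSpace ℝ (Fin p)}
  {Xs : ℕ → Ω' → EuclideanSpace ℝ (Fin d)} {Ys : ℕ → ℕ → Ω' → EuclideanSpace ℝ (Fin p)}

/-- The regression function `x ↦ E[f(Y) | X = x]`. -/
noncomputable def regMean (P : Measure Ω) [IsProbabilityMeasure P]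
    (X : Ω → EuclideanSpace ℝ (Fin d)) (Y : Ω → EuclideanSpace ℝ (Fin p))
    (f : EuclideanSpace ℝ (Fin p) → ℝ) (x : EuclideanSpace ℝ (Fin d)) : ℝ :=
  ∫ y, f y ∂(condDistrib Y X P x)

theorem measurable_regMean {f : EuclideanSpace ℝ (Fin p) → ℝ} (hf : Measurable f) :
    Measurable (regMean P X Y f) :=
  (StronglyMeasurable.integral_condDistrib (X := X) (Y := Y) (μ := P)
    (f := fun z : EuclideanSpace ℝ (Fin d) × EuclideanSpace ℝ (Fin p) => f z.2)
    (hf.comp measurable_snd).stronglyMeasurable).measurable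

/-- The block `(X_i, (Y_i^{(k)})_k)` of the sample. -/
def block (Xs : ℕ → Ω' → EuclideanSpace ℝ (Fin d)) (Ys : ℕ → ℕ → Ω' → EuclideanSpace ℝ (Fin p))
    (i : ℕ) (ω : Ω') : EuclideanSpace ℝ (Fin d) × (ℕ → EuclideanSpace ℝ (Fin p)) :=
  (Xs i ω, fun k => Ys i k ω)

namespace IsNestedSample

section

variable (hs : IsNestedSample P X Y P' Xs Ys)
include hs

theorem measurable_block (i : ℕ) : Measurable (block Xs Ys i) :=
  (hs.measurable_X i).prodMk (measurable_pi_iff.mpr fun k => hs.measurable_Y i k)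

theorem iIndepFun_block : iIndepFun (block Xs Ys) P' := hs.indep

/-- Rectangles determine the law. The sampling axiom is applied to the first `k + 1` draws with
every draw but the `k`-th unconstrained. -/
theorem map_pair (i k : ℕ) :
    P'.map (fun ω => (Xs i ω, Ys i k ω)) = P.map X ⊗ₘ condDistrib Y X P := by
  have hm : Measurable fun ω => (Xs i ω, Ys i k ω) :=
    (hs.measurable_X i).prodMk (hs.measurable_Y i k)
  have : IsProbabilityMeasure (P'.map fun ω => (Xs i ω, Ys i k ω)) :=
    Measure.isProbabilityMeasure_map hm.aemeasurable
  refine Measure.ext_prod fun {s t} hsm ht => ?_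
  rw [Measure.map_apply hm (hsm.prod ht), Measure.compProd_apply_prod hsm ht]
  have h := hs.law i (k + 1) s (fun j => if j = k then t else Set.univ) hsm fun j => by
    split_ifs
    · exact ht
    · exact MeasurableSet.univ
  have e1 : (fun ω => (Xs i ω, Ys i k ω)) ⁻¹' s ×ˢ t = {ω | Xs i ω ∈ s ∧ ∀ j < k + 1,
      Ys i j ω ∈ if j = k then t else Set.univ} := by
    ext ω
    simp only [Set.mem_preimage, Set.mem_prod, Set.mem_ofPred_eq]
    refine and_congr_right fun _ => ⟨fun h j _ => ?_, fun h => ?_⟩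
    · split_ifs with hj
      · rw [hj]; exact h
      · trivial
    · simpa using h k (Nat.lt_succ_self k)
  rw [e1, h]
  refine lintegral_congr fun x => ?_
  rw [Finset.prod_eq_single_of_mem k (by simp) fun j _ hj => by simp [hj]]
  simp

theorem identDistrib_pair (hX : Measurable X) (hY : Measurable Y) (i k : ℕ) :
    IdentDistrib (fun ω => (Xs i ω, Ys i k ω)) (fun ω => (X ω, Y ω)) P' P where
  aemeasurable_fst := ((hs.measurable_X i).prodMk (hs.measurable_Y i k)).aemeasurable
  aemeasurable_snd := (hX.prodMk hY).aemeasurable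
  map_eq := by rw [hs.map_pair, compProd_map_condDistrib hY.aemeasurable]

theorem map_triple (i : ℕ) {k l : ℕ} (hkl : k ≠ l) :
    P'.map (fun ω => (Xs i ω, Ys i k ω, Ys i l ω))
      = P.map X ⊗ₘ (condDistrib Y X P ×ₖ condDistrib Y X P) := by
  have hm : Measurable fun ω => (Xs i ω, Ys i k ω, Ys i l ω) :=
    (hs.measurable_X i).prodMk ((hs.measurable_Y i k).prodMk (hs.measurable_Y i l))
  have : IsProbabilityMeasure (P'.map fun ω => (Xs i ω, Ys i k ω, Ys i l ω)) :=
    Measure.isProbabilityMeasure_map hm.aemeasurable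
  refine Measure.ext_prod₃ fun {s t t'} hsm ht ht' => ?_
  rw [Measure.map_apply hm (hsm.prod (ht.prod ht')),
    Measure.compProd_apply_prod hsm (ht.prod ht')]
  have h := hs.law i (k + l + 1) s
    (fun j => if j = k then t else if j = l then t' else Set.univ) hsm fun j => by
      split_ifs
      · exact ht
      · exact ht'
      · exact MeasurableSet.univ
  have e1 : (fun ω => (Xs i ω, Ys i k ω, Ys i l ω)) ⁻¹' s ×ˢ t ×ˢ t' =
      {ω | Xs i ω ∈ s ∧ ∀ j < k + l + 1,
        Ys i j ω ∈ if j = k then t else if j = l then t' else Set.univ} := by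
    ext ω
    simp only [Set.mem_preimage, Set.mem_prod, Set.mem_ofPred_eq]
    refine and_congr_right fun _ => ⟨fun h j _ => ?_, fun h => ⟨?_, ?_⟩⟩
    · split_ifs with hj hj'
      · rw [hj]; exact h.1
      · rw [hj']; exact h.2
      · trivial
    · simpa using h k (by omega)
    · simpa [hkl.symm] using h l (by omega)
  rw [e1, h]
  refine lintegral_congr fun x => ?_
  rw [Kernel.prod_apply_prod, ← Finset.prod_subset
    (Finset.insert_subset_iff.mpr ⟨by simp, Finset.singleton_subset_iff.mpr (by simp)⟩ :
      ({k, l} : Finset ℕ) ⊆ Finset.range (k + l + 1)), Finset.prod_pair hkl]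
  · simp [hkl.symm]
  · intro j _ hj
    simp only [Finset.mem_insert, Finset.mem_singleton, not_or] at hj
    simp [hj.1, hj.2]

/-- The sampling axiom gives laws on finite cylinders that do not depend on `i`; products of
measurable sets with cylinders form a generating π-system. -/
theorem identDistrib_block (i : ℕ) : IdentDistrib (block Xs Ys i) (block Xs Ys 0) P' P' where
  aemeasurable_fst := (hs.measurable_block i).aemeasurable
  aemeasurable_snd := (hs.measurable_block 0).aemeasurable
  map_eq := by
    have : ∀ i, IsProbabilityMeasure (P'.map (block Xs Ys i)) := fun i =>
      Measure.isProbabilityMeasure_map (hs.measurable_block i).aemeasurable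
    have hspan : IsCountablySpanning
        (squareCylinders fun _ : ℕ => {s : Set (EuclideanSpace ℝ (Fin p)) | MeasurableSet s}) :=
      ⟨fun _ => Set.univ, fun _ => ⟨∅, fun _ => Set.univ, by simp, by simp⟩, Set.iUnion_const _⟩
    have hgen : (Prod.instMeasurableSpace : MeasurableSpace (EuclideanSpace ℝ (Fin d) ×
        (ℕ → EuclideanSpace ℝ (Fin p)))) = MeasurableSpace.generateFrom
          (Set.image2 (· ×ˢ ·) {s : Set (EuclideanSpace ℝ (Fin d)) | MeasurableSet s}
            (squareCylinders fun _ : ℕ => {s : Set (EuclideanSpace ℝ (Fin p)) | MeasurableSet s})) := by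
      rw [← generateFrom_prod_eq isCountablySpanning_measurableSet hspan,
        generateFrom_squareCylinders, MeasurableSpace.generateFrom_measurableSet]
    refine ext_of_generate_finite _ hgen (MeasurableSpace.isPiSystem_measurableSet.prod
      (isPiSystem_squareCylinders (fun _ => MeasurableSpace.isPiSystem_measurableSet)
        fun _ => by simp)) ?_ (by simp)
    rintro _ ⟨s, hs', _, ⟨I, t, ht, rfl⟩, rfl⟩
    have hsm : MeasurableSet s := by simpa using hs'
    have htm : ∀ k, MeasurableSet (t k) := fun k => by simpa using ht k trivial
    -- A cylinder over `I` is read among the first `I.sup id + 1` draws, with no constraint off `I`.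
    have hpre : ∀ i, (P'.map (block Xs Ys i)) (s ×ˢ (I : Set ℕ).pi t)
        = P' {ω | Xs i ω ∈ s ∧ ∀ k < I.sup id + 1, Ys i k ω ∈ if k ∈ I then t k else Set.univ} := by
      intro i
      rw [Measure.map_apply (hs.measurable_block i)
        (hsm.prod (MeasurableSet.pi I.countable_toSet fun k _ => htm k))]
      congr 1
      ext ω
      simp only [block, Set.mem_preimage, Set.mem_prod, Set.mem_ofPred_eq, Set.mem_pi,
        SetLike.mem_coe]
      refine and_congr_right fun _ => ⟨fun h k _ => ?_, fun h k hk => ?_⟩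
      · split_ifs with hk
        · exact h k hk
        · trivial
      · have hle : k ≤ I.sup id := Finset.le_sup (f := id) hk
        simpa [hk] using h k (by omega)
    have hmeas : ∀ k, MeasurableSet (if k ∈ I then t k else Set.univ) := fun k => by
      split_ifs
      · exact htm k
      · exact MeasurableSet.univ
    rw [hpre, hpre, hs.law i _ s _ hsm hmeas, hs.law 0 _ s _ hsm hmeas]

end

/-! ### Orthogonality of the noise -/

section Noise

variable {f : EuclideanSpace ℝ (Fin p) → ℝ}

/-- The noise `f(y) - E[f(Y) | X = x]`. -/
noncomputable def _root_.NestedRegression.noise (P : Measure Ω) [IsProbabilityMeasure P]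
    (X : Ω → EuclideanSpace ℝ (Fin d)) (Y : Ω → EuclideanSpace ℝ (Fin p))
    (f : EuclideanSpace ℝ (Fin p) → ℝ) (x : EuclideanSpace ℝ (Fin d))
    (y : EuclideanSpace ℝ (Fin p)) : ℝ :=
  f y - regMean P X Y f x

theorem measurable_noise (hf : Measurable f) : Measurable fun z : EuclideanSpace ℝ (Fin d) ×
    EuclideanSpace ℝ (Fin p) => noise P X Y f z.1 z.2 :=
  (hf.comp measurable_snd).sub ((measurable_regMean hf).comp measurable_fst)

/-- It holds for every `x`, not just almost every: if `f` is not integrable for the conditional law,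
neither is the noise, and its integral is `0` by convention. -/
theorem integral_noise (x : EuclideanSpace ℝ (Fin d)) :
    ∫ y, noise P X Y f x y ∂(condDistrib Y X P x) = 0 := by
  by_cases hi : Integrable f (condDistrib Y X P x)
  · simp only [noise]
    rw [integral_sub hi (by simp)]
    simp [regMean]
  · refine integral_undef fun h => hi ?_
    have := h.add (integrable_const (regMean P X Y f x))
    refine this.congr (.of_forall fun y => ?_)
    simp [noise]

variable (hs : IsNestedSample P X Y P' Xs Ys) (hf : Measurable f)
include hs hf

theorem integral_mul_noise (i k : ℕ) {χ : EuclideanSpace ℝ (Fin d) → ℝ} (hχ : Measurable χ) :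
    ∫ ω, χ (Xs i ω) * noise P X Y f (Xs i ω) (Ys i k ω) ∂P' = 0 := by
  set F : EuclideanSpace ℝ (Fin d) × EuclideanSpace ℝ (Fin p) → ℝ := fun z =>
    χ z.1 * noise P X Y f z.1 z.2 with hF
  have hFm : Measurable F := (hχ.comp measurable_fst).mul (measurable_noise hf)
  have h1 : ∫ ω, F (Xs i ω, Ys i k ω) ∂P' = ∫ z, F z ∂(P.map X ⊗ₘ condDistrib Y X P) := by
    rw [← hs.map_pair i k, integral_map
      ((hs.measurable_X i).prodMk (hs.measurable_Y i k)).aemeasurable hFm.aestronglyMeasurable]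
  change ∫ ω, F (Xs i ω, Ys i k ω) ∂P' = 0
  rw [h1]
  -- The same convention makes integrability assumptions on `χ` unnecessary.
  by_cases hi : Integrable F (P.map X ⊗ₘ condDistrib Y X P)
  · rw [Measure.integral_compProd hi]
    simp only [hF, integral_const_mul, integral_noise, mul_zero, integral_zero]
  · exact integral_undef hi

theorem integral_mul_noise_mul_noise (i : ℕ) {k l : ℕ} (hkl : k ≠ l)
    {χ : EuclideanSpace ℝ (Fin d) → ℝ} (hχ : Measurable χ) :
    ∫ ω, χ (Xs i ω) * (noise P X Y f (Xs i ω) (Ys i k ω) * noise P X Y f (Xs i ω) (Ys i l ω)) ∂P'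
      = 0 := by
  set F : EuclideanSpace ℝ (Fin d) × EuclideanSpace ℝ (Fin p) × EuclideanSpace ℝ (Fin p) → ℝ :=
    fun z => χ z.1 * (noise P X Y f z.1 z.2.1 * noise P X Y f z.1 z.2.2) with hF
  have hFm : Measurable F := (hχ.comp measurable_fst).mul
    (((measurable_noise hf).comp (measurable_fst.prodMk (measurable_fst.comp measurable_snd))).mul
      ((measurable_noise hf).comp (measurable_fst.prodMk (measurable_snd.comp measurable_snd))))
  have h1 : ∫ ω, F (Xs i ω, Ys i k ω, Ys i l ω) ∂P'
      = ∫ z, F z ∂(P.map X ⊗ₘ (condDistrib Y X P ×ₖ condDistrib Y X P)) := by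
    rw [← hs.map_triple i hkl, integral_map ((hs.measurable_X i).prodMk
      ((hs.measurable_Y i k).prodMk (hs.measurable_Y i l))).aemeasurable hFm.aestronglyMeasurable]
  change ∫ ω, F (Xs i ω, Ys i k ω, Ys i l ω) ∂P' = 0
  rw [h1]
  by_cases hi : Integrable F (P.map X ⊗ₘ (condDistrib Y X P ×ₖ condDistrib Y X P))
  · rw [Measure.integral_compProd hi]
    have : ∀ x, ∫ z : EuclideanSpace ℝ (Fin p) × EuclideanSpace ℝ (Fin p),
        noise P X Y f x z.1 * noise P X Y f x z.2
          ∂((condDistrib Y X P x).prod (condDistrib Y X P x)) = 0 := fun x => by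
      rw [integral_prod_mul, integral_noise, zero_mul]
    simp only [hF, integral_const_mul, Kernel.prod_apply, this, mul_zero, integral_zero]
  · exact integral_undef hi

omit hf in
/-- The blocks other than the `i`-th one. -/
theorem indepFun_others (i : ℕ) : IndepFun
    (fun ω r => if r = i then (0 : EuclideanSpace ℝ (Fin d) × (ℕ → EuclideanSpace ℝ (Fin p)))
      else block Xs Ys r ω) (block Xs Ys i) P' := by
  have h1 := indep_iSup_of_disjoint (fun r => (hs.measurable_block r).comap_le)
    ((iIndepFun_iff_iIndep _ _ _).mp hs.iIndepFun_block) (S := {i}ᶜ) (T := {i}) disjoint_compl_left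
  rw [IndepFun_iff_Indep]
  refine indep_of_indep_of_le_left (indep_of_indep_of_le_right h1 ?_) ?_
  · simp
  · rw [← measurable_iff_comap_le]
    refine @measurable_pi_lambda _ _ _ (_) _ _ fun r => ?_
    by_cases hr : r = i
    · simp [hr]
    · simp only [hr, if_false]
      have h2 : Measurable[MeasurableSpace.comap (block Xs Ys r) inferInstance] (block Xs Ys r) :=
        comap_measurable _
      exact h2.mono (le_iSup₂_of_le r (by simpa using hr) le_rfl) le_rfl

omit hf in
theorem measurable_others (i : ℕ) : Measurable
    (fun ω r => if r = i then (0 : EuclideanSpace ℝ (Fin d) × (ℕ → EuclideanSpace ℝ (Fin p)))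
      else block Xs Ys r ω) := by
  refine measurable_pi_iff.mpr fun r => ?_
  by_cases hr : r = i
  · simp [hr]
  · simpa [hr] using hs.measurable_block r

omit hf in
/-- An integral vanishes if it does so conditionally on the blocks other than the `i`-th one. -/
theorem integral_eq_zero_of_block (i : ℕ)
    {F : (ℕ → EuclideanSpace ℝ (Fin d) × (ℕ → EuclideanSpace ℝ (Fin p))) ×
      (EuclideanSpace ℝ (Fin d) × (ℕ → EuclideanSpace ℝ (Fin p))) → ℝ} (hF : Measurable F)
    (h0 : ∀ z, ∫ ω, F (z, block Xs Ys i ω) ∂P' = 0) :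
    ∫ ω, F (fun r => if r = i then 0 else block Xs Ys r ω, block Xs Ys i ω) ∂P' = 0 := by
  have hmap := (indepFun_iff_map_prod_eq_prod_map_map (hs.measurable_others i).aemeasurable
    (hs.measurable_block i).aemeasurable).mp (hs.indepFun_others i)
  rw [← integral_map ((hs.measurable_others i).prodMk (hs.measurable_block i)).aemeasurable
    hF.aestronglyMeasurable, hmap]
  set ν := P'.map fun ω r => if r = i then
    (0 : EuclideanSpace ℝ (Fin d) × (ℕ → EuclideanSpace ℝ (Fin p))) else block Xs Ys r ω
  have : IsProbabilityMeasure ν :=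
    Measure.isProbabilityMeasure_map (hs.measurable_others i).aemeasurable
  have : IsProbabilityMeasure (P'.map (block Xs Ys i)) :=
    Measure.isProbabilityMeasure_map (hs.measurable_block i).aemeasurable
  by_cases hi : Integrable F (ν.prod (P'.map (block Xs Ys i)))
  · rw [integral_prod _ hi]
    have : ∀ z, ∫ v, F (z, v) ∂(P'.map (block Xs Ys i)) = 0 := fun z => by
      have hFz : Measurable fun v => F (z, v) := hF.comp measurable_prodMk_left
      rw [integral_map (hs.measurable_block i).aemeasurable hFz.aestronglyMeasurable]
      exact h0 z
    simp [this]
  · exact integral_undef hi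

/-- The noise is centered given the covariates. -/
theorem integral_cov_mul_noise (i k : ℕ) {Φ : (ℕ → EuclideanSpace ℝ (Fin d)) → ℝ}
    (hΦ : Measurable Φ) :
    ∫ ω, Φ (fun r => Xs r ω) * noise P X Y f (Xs i ω) (Ys i k ω) ∂P' = 0 := by
  have hupd : Measurable fun zv : (ℕ → EuclideanSpace ℝ (Fin d) × (ℕ → EuclideanSpace ℝ (Fin p))) ×
      (EuclideanSpace ℝ (Fin d) × (ℕ → EuclideanSpace ℝ (Fin p))) =>
      fun r => if r = i then zv.2.1 else (zv.1 r).1 := by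
    refine measurable_pi_iff.mpr fun r => ?_
    split_ifs <;> fun_prop
  have h := hs.integral_eq_zero_of_block i
    (F := fun zv => Φ (fun r => if r = i then zv.2.1 else (zv.1 r).1)
      * noise P X Y f zv.2.1 (zv.2.2 k)) ((hΦ.comp hupd).mul
        ((measurable_noise hf).comp (f := fun zv : (ℕ → EuclideanSpace ℝ (Fin d) ×
          (ℕ → EuclideanSpace ℝ (Fin p))) × (EuclideanSpace ℝ (Fin d) ×
          (ℕ → EuclideanSpace ℝ (Fin p))) => (zv.2.1, zv.2.2 k)) (by fun_prop)))
    fun z => hs.integral_mul_noise hf i k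
      (χ := fun x => Φ (fun r => if r = i then x else (z r).1))
      (hΦ.comp (measurable_pi_iff.mpr fun r => by split_ifs <;> fun_prop))
  rw [← h]
  refine integral_congr_ae (.of_forall fun ω => ?_)
  simp only [block]
  congr 2
  ext1 r
  split_ifs with hr
  · rw [hr]
  · rfl

/-- The noises are uncorrelated given the covariates. -/
theorem integral_cov_mul_noise_mul_noise {i j k l : ℕ} (hne : (i, k) ≠ (j, l))
    {Φ : (ℕ → EuclideanSpace ℝ (Fin d)) → ℝ} (hΦ : Measurable Φ) :
    ∫ ω, Φ (fun r => Xs r ω) * (noise P X Y f (Xs i ω) (Ys i k ω)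
      * noise P X Y f (Xs j ω) (Ys j l ω)) ∂P' = 0 := by
  have hupd : Measurable fun zv : (ℕ → EuclideanSpace ℝ (Fin d) × (ℕ → EuclideanSpace ℝ (Fin p))) ×
      (EuclideanSpace ℝ (Fin d) × (ℕ → EuclideanSpace ℝ (Fin p))) =>
      fun r => if r = i then zv.2.1 else (zv.1 r).1 := by
    refine measurable_pi_iff.mpr fun r => ?_
    split_ifs <;> fun_prop
  have hn : ∀ k, Measurable fun zv : (ℕ → EuclideanSpace ℝ (Fin d) ×
      (ℕ → EuclideanSpace ℝ (Fin p))) × (EuclideanSpace ℝ (Fin d) ×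
      (ℕ → EuclideanSpace ℝ (Fin p))) => noise P X Y f zv.2.1 (zv.2.2 k) := fun k =>
    (measurable_noise hf).comp (f := fun zv : (ℕ → EuclideanSpace ℝ (Fin d) ×
      (ℕ → EuclideanSpace ℝ (Fin p))) × (EuclideanSpace ℝ (Fin d) ×
      (ℕ → EuclideanSpace ℝ (Fin p))) => (zv.2.1, zv.2.2 k)) (by fun_prop)
  have hz : ∀ z : ℕ → EuclideanSpace ℝ (Fin d) × (ℕ → EuclideanSpace ℝ (Fin p)),
      Measurable fun x : EuclideanSpace ℝ (Fin d) => Φ (fun r => if r = i then x else (z r).1) :=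
    fun z => hΦ.comp (measurable_pi_iff.mpr fun r => by split_ifs <;> fun_prop)
  have hfun : ∀ ω, (fun r => Xs r ω) = fun r => if r = i then (block Xs Ys i ω).1
      else (if r = i then (0 : EuclideanSpace ℝ (Fin d) × (ℕ → EuclideanSpace ℝ (Fin p)))
        else block Xs Ys r ω).1 := by
    intro ω
    ext1 r
    split_ifs with hr
    · rw [hr]; rfl
    · rfl
  -- Within a block, two distinct draws are independent given its covariate. In different blocks,
  -- block `j` is frozen into the weight and the single noise of block `i` is integrated.
  by_cases hij : i = j
  · subst hij
    have hkl : k ≠ l := fun h => hne (by rw [h])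
    have h := hs.integral_eq_zero_of_block i
      (F := fun zv => Φ (fun r => if r = i then zv.2.1 else (zv.1 r).1)
        * (noise P X Y f zv.2.1 (zv.2.2 k) * noise P X Y f zv.2.1 (zv.2.2 l)))
      ((hΦ.comp hupd).mul ((hn k).mul (hn l)))
      fun z => hs.integral_mul_noise_mul_noise hf i hkl
        (χ := fun x => Φ (fun r => if r = i then x else (z r).1)) (hz z)
    rw [← h]
    exact integral_congr_ae (.of_forall fun ω => by simp only [hfun ω]; rfl)
  · have hn' : Measurable fun zv : (ℕ → EuclideanSpace ℝ (Fin d) ×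
      (ℕ → EuclideanSpace ℝ (Fin p))) × (EuclideanSpace ℝ (Fin d) ×
      (ℕ → EuclideanSpace ℝ (Fin p))) => noise P X Y f (zv.1 j).1 ((zv.1 j).2 l) :=
    (measurable_noise hf).comp (f := fun zv : (ℕ → EuclideanSpace ℝ (Fin d) ×
      (ℕ → EuclideanSpace ℝ (Fin p))) × (EuclideanSpace ℝ (Fin d) ×
      (ℕ → EuclideanSpace ℝ (Fin p))) => ((zv.1 j).1, (zv.1 j).2 l)) (by fun_prop)
    have h := hs.integral_eq_zero_of_block i
      (F := fun zv => (Φ (fun r => if r = i then zv.2.1 else (zv.1 r).1)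
        * noise P X Y f (zv.1 j).1 ((zv.1 j).2 l)) * noise P X Y f zv.2.1 (zv.2.2 k))
      (((hΦ.comp hupd).mul hn').mul (hn k))
      fun z => hs.integral_mul_noise hf i k
        (χ := fun x => Φ (fun r => if r = i then x else (z r).1)
          * noise P X Y f (z j).1 ((z j).2 l)) ((hz z).mul_const _)
    rw [← h]
    refine integral_congr_ae (.of_forall fun ω => ?_)
    simp only [hfun ω, if_neg (Ne.symm hij)]
    change _ * (noise P X Y f (Xs i ω) (Ys i k ω) * noise P X Y f (Xs j ω) (Ys j l ω))
      = _ * noise P X Y f (Xs j ω) (Ys j l ω) * noise P X Y f (Xs i ω) (Ys i k ω)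
    ring

/-- The conditional variance of the noise is the same for all draws. -/
theorem integral_cov_mul_noise_sq (i k : ℕ) {Φ : (ℕ → EuclideanSpace ℝ (Fin d)) → ℝ}
    (hΦ : Measurable Φ) :
    ∫ ω, Φ (fun r => Xs r ω) * noise P X Y f (Xs i ω) (Ys i k ω) ^ 2 ∂P'
      = ∫ ω, Φ (fun r => Xs r ω) * noise P X Y f (Xs i ω) (Ys i 0 ω) ^ 2 ∂P' := by
  set F : (ℕ → EuclideanSpace ℝ (Fin d) × (ℕ → EuclideanSpace ℝ (Fin p))) ×
      (EuclideanSpace ℝ (Fin d) × EuclideanSpace ℝ (Fin p)) → ℝ := fun zv =>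
    Φ (fun r => if r = i then zv.2.1 else (zv.1 r).1) * noise P X Y f zv.2.1 zv.2.2 ^ 2 with hF
  have hFm : Measurable F := by
    refine (hΦ.comp (measurable_pi_iff.mpr fun r => ?_)).mul
      (((measurable_noise hf).comp measurable_snd).pow_const 2)
    split_ifs <;> fun_prop
  -- The joint law of the other blocks and `(X_i, Y_i^{(k)})` is a product in which `k` does not
  -- appear.
  have hrepr : ∀ k, ∫ ω, Φ (fun r => Xs r ω) * noise P X Y f (Xs i ω) (Ys i k ω) ^ 2 ∂P'
      = ∫ z, F z ∂((P'.map fun ω r => if r = i then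
        (0 : EuclideanSpace ℝ (Fin d) × (ℕ → EuclideanSpace ℝ (Fin p))) else block Xs Ys r ω).prod
          (P.map X ⊗ₘ condDistrib Y X P)) := by
    intro k
    have hind : IndepFun (fun ω r => if r = i then
        (0 : EuclideanSpace ℝ (Fin d) × (ℕ → EuclideanSpace ℝ (Fin p))) else block Xs Ys r ω)
        (fun ω => (Xs i ω, Ys i k ω)) P' :=
      (hs.indepFun_others i).comp measurable_id
        (ψ := fun v : EuclideanSpace ℝ (Fin d) × (ℕ → EuclideanSpace ℝ (Fin p)) => (v.1, v.2 k))
        (by fun_prop)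
    have hpm : Measurable fun ω => (Xs i ω, Ys i k ω) :=
      (hs.measurable_X i).prodMk (hs.measurable_Y i k)
    have hmap := (indepFun_iff_map_prod_eq_prod_map_map (hs.measurable_others i).aemeasurable
      hpm.aemeasurable).mp hind
    rw [hs.map_pair] at hmap
    rw [← hmap, integral_map ((hs.measurable_others i).prodMk hpm).aemeasurable
      hFm.aestronglyMeasurable]
    refine integral_congr_ae (.of_forall fun ω => ?_)
    simp only [hF]
    congr 2
    ext1 r
    split_ifs with hr
    · rw [hr]
    · rfl
  rw [hrepr k, hrepr 0]

end Noise

end IsNestedSample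

end Laws

/-! ### The population problem -/

section PopulationModel

variable {d p q : ℕ} {Ω Ω' : Type*} [MeasurableSpace Ω] [MeasurableSpace Ω']

/-- The measurability and integrability assumptions on the population. -/
structure RegressionModel (P : Measure Ω) [IsProbabilityMeasure P]
    (X : Ω → EuclideanSpace ℝ (Fin d)) (Y : Ω → EuclideanSpace ℝ (Fin p))
    (f : EuclideanSpace ℝ (Fin p) → ℝ)
    (u : EuclideanSpace ℝ (Fin d) → EuclideanSpace ℝ (Fin q)) : Prop where
  measurable_X : Measurable X
  measurable_Y : Measurable Y
  measurable_f : Measurable f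
  measurable_u : Measurable u
  memLp_f : MemLp (fun ω => f (Y ω)) 2 P
  memLp_gram : ∀ a b, MemLp (fun ω => u (X ω) a * u (X ω) b) 2 P
  memLp_moment : ∀ a, MemLp (fun ω => f (Y ω) * u (X ω) a) 2 P
  posDef : (matH P X u).PosDef

/-- For `t ≥ 0` and `s ≥ 2` one has `t² ≤ t ^ s + 1`, and the measure is finite. -/
theorem memLp_two_of_sq_le {α : Type*} [MeasurableSpace α] {μ : Measure α} [IsFiniteMeasure μ]
    {g : α → ℝ} (hg : Measurable g) {n : α → ℝ} {s : ℝ} (hs : 2 ≤ s)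
    (hn : ∀ ω, 0 ≤ n ω) (hgn : ∀ ω, |g ω| ≤ n ω) (hi : Integrable (fun ω => n ω ^ s) μ) :
    MemLp g 2 μ := by
  rw [memLp_two_iff_integrable_sq hg.aestronglyMeasurable]
  refine (hi.add (integrable_const 1)).mono' (hg.pow_const 2).aestronglyMeasurable
    (.of_forall fun ω => ?_)
  rw [Real.norm_eq_abs, abs_pow]
  have h1 : |g ω| ^ 2 ≤ n ω ^ 2 := pow_le_pow_left₀ (abs_nonneg _) (hgn ω) 2
  refine h1.trans ?_
  simp only [Pi.add_apply]
  rcases le_total (n ω) 1 with h | h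
  · have := Real.rpow_nonneg (hn ω) s
    nlinarith [hn ω]
  · have := Real.rpow_le_rpow_of_exponent_le h hs
    rw [Real.rpow_two] at this
    linarith

theorem RegressionModel.of_moments {P : Measure Ω} [IsProbabilityMeasure P]
    {X : Ω → EuclideanSpace ℝ (Fin d)} {Y : Ω → EuclideanSpace ℝ (Fin p)}
    (hX : Measurable X) (hY : Measurable Y)
    {f : EuclideanSpace ℝ (Fin p) → ℝ} (hf : Measurable f)
    (hf2 : Integrable (fun ω => f (Y ω) ^ 2) P)
    {u : EuclideanSpace ℝ (Fin d) → EuclideanSpace ℝ (Fin q)} (hu : Measurable u)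
    {η : ℝ} (hη : 0 < η)
    (hu_mom : Integrable (fun ω => ‖u (X ω)‖ ^ (4 + η)) P)
    (hfu_mom : Integrable (fun ω => ‖f (Y ω) • u (X ω)‖ ^ (2 + η)) P)
    (hH : (matH P X u).PosDef) : RegressionModel P X Y f u where
  measurable_X := hX
  measurable_Y := hY
  measurable_f := hf
  measurable_u := hu
  memLp_f := (memLp_two_iff_integrable_sq (hf.comp hY).aestronglyMeasurable).mpr hf2
  memLp_gram a b := by
    have hm : ∀ a, Measurable fun ω => u (X ω) a := fun a =>
      Measurable.euclidean_apply (hu.comp hX) a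
    refine memLp_two_of_sq_le ((hm a).mul (hm b)) (n := fun ω => ‖u (X ω)‖ ^ 2) (s := (4 + η) / 2)
      (by linarith) (fun _ => by positivity) (fun ω => ?_) ?_
    · rw [abs_mul, sq]
      exact mul_le_mul (PiLp.norm_apply_le (u (X ω)) a) (PiLp.norm_apply_le (u (X ω)) b)
        (abs_nonneg _) (norm_nonneg _)
    · refine hu_mom.congr (.of_forall fun ω => ?_)
      simp only
      rw [← Real.rpow_natCast, ← Real.rpow_mul (norm_nonneg _)]
      congr 1; push_cast; ring
  memLp_moment a := by
    have hm : Measurable fun ω => u (X ω) a := Measurable.euclidean_apply (hu.comp hX) a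
    refine memLp_two_of_sq_le ((hf.comp hY).mul hm) (n := fun ω => ‖f (Y ω) • u (X ω)‖)
      (s := 2 + η) (by linarith) (fun _ => norm_nonneg _) (fun ω => ?_) hfu_mom
    have := PiLp.norm_apply_le (f (Y ω) • u (X ω)) a
    simpa using this
  posDef := hH

namespace RegressionModel

variable {P : Measure Ω} [IsProbabilityMeasure P] {P' : Measure Ω'} [IsProbabilityMeasure P']
  {X : Ω → EuclideanSpace ℝ (Fin d)} {Y : Ω → EuclideanSpace ℝ (Fin p)}
  {f : EuclideanSpace ℝ (Fin p) → ℝ} {u : EuclideanSpace ℝ (Fin d) → EuclideanSpace ℝ (Fin q)}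

section Population

variable (h : RegressionModel P X Y f u)
include h

theorem measurable_u_apply (a : Fin q) : Measurable fun x => u x a :=
  Measurable.euclidean_apply h.measurable_u a

theorem condMean_ae_eq : condMean P X Y f =ᵐ[P] fun ω => regMean P X Y f (X ω) :=
  condExp_ae_eq_integral_condDistrib h.measurable_X h.measurable_Y.aemeasurable
    h.measurable_f.stronglyMeasurable (h.memLp_f.integrable one_le_two)

theorem memLp_u (a : Fin q) : MemLp (fun ω => u (X ω) a) 2 P := by
  have hm : Measurable fun ω => u (X ω) a := (h.measurable_u_apply a).comp h.measurable_X
  refine (memLp_two_iff_integrable_sq hm.aestronglyMeasurable).mpr ?_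
  exact ((h.memLp_gram a a).integrable one_le_two).congr (.of_forall fun ω => (sq _).symm)

theorem memLp_regMean : MemLp (fun ω => regMean P X Y f (X ω)) 2 P :=
  (memLp_congr_ae h.condMean_ae_eq).mp (h.memLp_f.condExp one_le_two)

theorem condExp_mul_u (a : Fin q) :
    P[fun ω => f (Y ω) * u (X ω) a | MeasurableSpace.comap X inferInstance]
      =ᵐ[P] fun ω => regMean P X Y f (X ω) * u (X ω) a := by
  have h1 : StronglyMeasurable[MeasurableSpace.comap X inferInstance] fun ω => u (X ω) a :=
    ((h.measurable_u_apply a).comp (comap_measurable X)).stronglyMeasurable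
  have h2 := condExp_mul_of_stronglyMeasurable_right (f := fun ω => f (Y ω)) h1
    ((h.memLp_moment a).integrable one_le_two) (h.memLp_f.integrable one_le_two)
  filter_upwards [h2, h.condMean_ae_eq] with ω h3 h4
  rw [← h4]
  exact h3

/-- A product of two square-integrable functions need not be square-integrable. Here it is the
conditional expectation of `f(Y) u(X)`, and conditioning contracts `L²`. -/
theorem memLp_regMean_mul_u (a : Fin q) :
    MemLp (fun ω => regMean P X Y f (X ω) * u (X ω) a) 2 P :=
  (memLp_congr_ae (h.condExp_mul_u a)).mp ((h.memLp_moment a).condExp one_le_two)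

theorem integral_regMean_mul_u (a : Fin q) :
    ∫ ω, regMean P X Y f (X ω) * u (X ω) a ∂P = ∫ ω, f (Y ω) * u (X ω) a ∂P := by
  rw [← integral_congr_ae (h.condExp_mul_u a), integral_condExp h.measurable_X.comap_le]

omit h [IsProbabilityMeasure P] in
theorem matH_apply (a b : Fin q) : matH P X u a b = 2 * ∫ ω, u (X ω) a * u (X ω) b ∂P := rfl

theorem matH_mulVec_thetaStar (a : Fin q) :
    (matH P X u *ᵥ (thetaStar P X Y f u).ofLp) a = 2 * ∫ ω, f (Y ω) * u (X ω) a ∂P := by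
  have hu : IsUnit (matH P X u).det := (Matrix.isUnit_iff_isUnit_det _).mp h.posDef.isUnit
  have e : (thetaStar P X Y f u).ofLp
      = (2 : ℝ) • ((matH P X u)⁻¹ *ᵥ (∫ ω, f (Y ω) • u (X ω) ∂P).ofLp) := rfl
  rw [e, Matrix.mulVec_smul, Matrix.mulVec_mulVec, Matrix.mul_nonsing_inv _ hu, Matrix.one_mulVec,
    Pi.smul_apply, smul_eq_mul, eval_integral_piLp]
  · rfl
  · exact fun b => (h.memLp_moment b).integrable one_le_two

/-- The residual `(E[f(Y) | X = x] - θ⋆ · u(x)) u(x)_a`. -/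
noncomputable def _root_.NestedRegression.residual (P : Measure Ω) [IsProbabilityMeasure P]
    (X : Ω → EuclideanSpace ℝ (Fin d)) (Y : Ω → EuclideanSpace ℝ (Fin p))
    (f : EuclideanSpace ℝ (Fin p) → ℝ)
    (u : EuclideanSpace ℝ (Fin d) → EuclideanSpace ℝ (Fin q)) (a : Fin q)
    (x : EuclideanSpace ℝ (Fin d)) : ℝ :=
  (regMean P X Y f x - inner ℝ (thetaStar P X Y f u) (u x)) * u x a

theorem measurable_residual (a : Fin q) : Measurable (residual P X Y f u a) :=
  ((measurable_regMean h.measurable_f).sub (measurable_const.inner h.measurable_u)).mul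
    (h.measurable_u_apply a)

omit h in
theorem residual_eq (a : Fin q) (x : EuclideanSpace ℝ (Fin d)) : residual P X Y f u a x
    = regMean P X Y f x * u x a - ∑ b, thetaStar P X Y f u b * (u x a * u x b) := by
  simp only [residual, real_inner_eq_sum, sub_mul, Finset.sum_mul]
  congr 1
  exact Finset.sum_congr rfl fun b _ => by ring

theorem memLp_residual (a : Fin q) : MemLp (fun ω => residual P X Y f u a (X ω)) 2 P := by
  simp_rw [residual_eq]
  exact (h.memLp_regMean_mul_u a).sub
    (memLp_finsetSum _ fun b _ => (h.memLp_gram a b).const_mul _)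

theorem integral_residual (a : Fin q) : ∫ ω, residual P X Y f u a (X ω) ∂P = 0 := by
  have hi : ∀ b, Integrable
      (fun ω => thetaStar P X Y f u b * (u (X ω) a * u (X ω) b)) P := fun b =>
    ((h.memLp_gram a b).integrable one_le_two).const_mul _
  simp_rw [residual_eq]
  rw [integral_sub ((h.memLp_regMean_mul_u a).integrable one_le_two)
    (integrable_finsetSum _ fun b _ => hi b), integral_finsetSum _ fun b _ => hi b]
  simp_rw [integral_const_mul]
  have h1 := h.matH_mulVec_thetaStar a
  simp only [Matrix.mulVec, dotProduct, matH_apply] at h1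
  have h2 : ∑ b, 2 * (∫ ω, u (X ω) a * u (X ω) b ∂P) * (thetaStar P X Y f u) b
      = 2 * ∑ b, (thetaStar P X Y f u) b * ∫ ω, u (X ω) a * u (X ω) b ∂P := by
    rw [Finset.mul_sum]; exact Finset.sum_congr rfl fun b _ => by ring
  rw [h.integral_regMean_mul_u]
  linarith

theorem memLp_noise_mul_u (a : Fin q) :
    MemLp (fun ω => noise P X Y f (X ω) (Y ω) * u (X ω) a) 2 P := by
  simp only [noise, sub_mul]
  exact (h.memLp_moment a).sub (h.memLp_regMean_mul_u a)

theorem matA_apply (a b : Fin q) : matA P X Y f u a b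
    = ∫ ω, residual P X Y f u a (X ω) * residual P X Y f u b (X ω) ∂P := by
  simp only [matA, Matrix.of_apply]
  refine integral_congr_ae ?_
  filter_upwards [h.condMean_ae_eq] with ω hω
  rw [hω]
  simp only [residual]
  ring

theorem matB_apply (a b : Fin q) : matB P X Y f u a b
    = ∫ ω, (noise P X Y f (X ω) (Y ω) * u (X ω) a) * (noise P X Y f (X ω) (Y ω) * u (X ω) b) ∂P := by
  simp only [matB, Matrix.of_apply]
  refine integral_congr_ae ?_
  filter_upwards [h.condMean_ae_eq] with ω hω
  rw [hω]
  simp only [noise]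
  ring

/-- The excess risk is a quadratic form. -/
theorem vInf_sub_vInf (θ : EuclideanSpace ℝ (Fin q)) :
    vInf P X Y f u θ - vInf P X Y f u (thetaStar P X Y f u)
      = 1 / 2 * ((θ - thetaStar P X Y f u).ofLp ⬝ᵥ
          matH P X u *ᵥ (θ - thetaStar P X Y f u).ofLp) := by
  set θs := thetaStar P X Y f u with hθs
  set δ := θ - θs with hδ
  have hin : ∀ θ : EuclideanSpace ℝ (Fin q), MemLp (fun ω => inner ℝ θ (u (X ω))) 2 P := by
    intro θ
    simp_rw [real_inner_eq_sum]
    exact memLp_finsetSum _ fun a _ => (h.memLp_u a).const_mul _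
  have hv : ∀ θ, vInf P X Y f u θ
      = ∫ ω, (inner ℝ θ (u (X ω)) - regMean P X Y f (X ω)) ^ 2 ∂P := by
    intro θ
    refine integral_congr_ae ?_
    filter_upwards [h.condMean_ae_eq] with ω hω
    rw [hω]
  have hD : ∀ θ, MemLp (fun ω => inner ℝ θ (u (X ω)) - regMean P X Y f (X ω)) 2 P := fun θ =>
    (hin θ).sub h.memLp_regMean
  rw [hv, hv, ← integral_sub (hD θ).integrable_sq (hD θs).integrable_sq]
  have hi1 : ∀ a b, Integrable (fun ω => δ a * δ b * (u (X ω) a * u (X ω) b)) P := fun a b =>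
    ((h.memLp_gram a b).integrable one_le_two).const_mul _
  have hi2 : ∀ a, Integrable (fun ω => -(2 * δ a) * residual P X Y f u a (X ω)) P := fun a =>
    ((h.memLp_residual a).integrable one_le_two).const_mul _
  -- Expansion around `θ⋆`: the linear part is a combination of residuals, which have mean zero by
  -- the normal equation.
  have e : ∀ ω, (inner ℝ θ (u (X ω)) - regMean P X Y f (X ω)) ^ 2
      - (inner ℝ θs (u (X ω)) - regMean P X Y f (X ω)) ^ 2
      = (∑ a, ∑ b, δ a * δ b * (u (X ω) a * u (X ω) b))
        + ∑ a, -(2 * δ a) * residual P X Y f u a (X ω) := by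
    intro ω
    have e1 : inner ℝ θ (u (X ω)) = inner ℝ δ (u (X ω)) + inner ℝ θs (u (X ω)) := by
      rw [← inner_add_left, hδ, sub_add_cancel]
    have e2 : ∑ a, ∑ b, δ a * δ b * (u (X ω) a * u (X ω) b)
        = inner ℝ δ (u (X ω)) * inner ℝ δ (u (X ω)) := by
      rw [real_inner_eq_sum, Finset.sum_mul_sum]
      exact Finset.sum_congr rfl fun a _ => Finset.sum_congr rfl fun b _ => by ring
    have e3 : ∑ a, -(2 * δ a) * residual P X Y f u a (X ω)
        = -2 * (regMean P X Y f (X ω) - inner ℝ θs (u (X ω))) * inner ℝ δ (u (X ω)) := by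
      rw [real_inner_eq_sum δ, Finset.mul_sum]
      exact Finset.sum_congr rfl fun a _ => by simp only [residual, ← hθs]; ring
    rw [e1, e2, e3]
    ring
  simp_rw [e]
  rw [integral_add (integrable_finsetSum _ fun a _ => integrable_finsetSum _ fun b _ => hi1 a b)
    (integrable_finsetSum _ fun a _ => hi2 a),
    integral_finsetSum _ fun a _ => integrable_finsetSum _ fun b _ => hi1 a b,
    integral_finsetSum _ fun a _ => hi2 a]
  simp_rw [fun a => integral_finsetSum Finset.univ fun b _ => hi1 a b, integral_const_mul,
    h.integral_residual, mul_zero, Finset.sum_const_zero, add_zero, dotProduct, Matrix.mulVec,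
    dotProduct, Finset.mul_sum, matH_apply]
  exact Finset.sum_congr rfl fun a _ => Finset.sum_congr rfl fun b _ => by ring

end Population

/-! ### The nested sample as an i.i.d. regression sample -/

section Sample

variable {Xs : ℕ → Ω' → EuclideanSpace ℝ (Fin d)} {Ys : ℕ → ℕ → Ω' → EuclideanSpace ℝ (Fin p)}

/-- The averaged response `(1 / K) ∑_{k < K} f(y_k)` of a block. -/
noncomputable def _root_.NestedRegression.blockResponse (d : ℕ)
    (f : EuclideanSpace ℝ (Fin p) → ℝ) (K : ℕ)
    (v : EuclideanSpace ℝ (Fin d) × (ℕ → EuclideanSpace ℝ (Fin p))) : ℝ :=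
  1 / (K : ℝ) * ∑ k ∈ Finset.range K, f (v.2 k)

/-- The regressor `u(x)` of a block. -/
def _root_.NestedRegression.blockRegressor (p : ℕ)
    (u : EuclideanSpace ℝ (Fin d) → EuclideanSpace ℝ (Fin q))
    (v : EuclideanSpace ℝ (Fin d) × (ℕ → EuclideanSpace ℝ (Fin p))) : EuclideanSpace ℝ (Fin q) :=
  u v.1

variable (h : RegressionModel P X Y f u) (hs : IsNestedSample P X Y P' Xs Ys)
include h hs

theorem identDistrib_pair (i k : ℕ) :
    IdentDistrib (fun ω => (Xs i ω, Ys i k ω)) (fun ω => (X ω, Y ω)) P' P :=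
  hs.identDistrib_pair h.measurable_X h.measurable_Y i k

theorem identDistrib_X (i : ℕ) : IdentDistrib (Xs i) X P' P :=
  (h.identDistrib_pair hs i 0).comp measurable_fst

theorem memLp_gram_sample (i : ℕ) (a b : Fin q) :
    MemLp (fun ω => u (Xs i ω) a * u (Xs i ω) b) 2 P' :=
  ((h.identDistrib_X hs i).comp
    ((h.measurable_u_apply a).mul (h.measurable_u_apply b))).memLp_iff.mpr (h.memLp_gram a b)

theorem identDistrib_moment (i k : ℕ) (a : Fin q) : IdentDistrib
    (fun ω => f (Ys i k ω) * u (Xs i ω) a) (fun ω => f (Y ω) * u (X ω) a) P' P :=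
  (h.identDistrib_pair hs i k).comp
    (u := fun z : EuclideanSpace ℝ (Fin d) × EuclideanSpace ℝ (Fin p) => f z.2 * u z.1 a)
    ((h.measurable_f.comp measurable_snd).mul ((h.measurable_u_apply a).comp measurable_fst))

theorem memLp_residual_sample (i : ℕ) (a : Fin q) :
    MemLp (fun ω => residual P X Y f u a (Xs i ω)) 2 P' :=
  ((h.identDistrib_X hs i).comp (h.measurable_residual a)).memLp_iff.mpr (h.memLp_residual a)

theorem memLp_noise_sample (i k : ℕ) (a : Fin q) :
    MemLp (fun ω => noise P X Y f (Xs i ω) (Ys i k ω) * u (Xs i ω) a) 2 P' :=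
  ((h.identDistrib_pair hs i k).comp
    (u := fun z : EuclideanSpace ℝ (Fin d) × EuclideanSpace ℝ (Fin p) =>
      noise P X Y f z.1 z.2 * u z.1 a)
    ((IsNestedSample.measurable_noise h.measurable_f).mul
      ((h.measurable_u_apply a).comp measurable_fst))).memLp_iff.mpr (h.memLp_noise_mul_u a)

/-- For fixed `K` a whole block is one observation, with averaged response. This reduces the nested
problem to ordinary i.i.d. regression. -/
theorem regressionSample {K : ℕ} (hK : 1 ≤ K) :
    RegressionSample P' (block Xs Ys) (blockResponse d f K) (blockRegressor p u) (matH P X u)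
      (thetaStar P X Y f u) where
  indep := hs.iIndepFun_block
  measurable_V := hs.measurable_block
  ident := hs.identDistrib_block
  measurable_w := (Finset.measurable_fun_sum _ fun k _ => h.measurable_f.comp
    ((measurable_pi_apply k).comp measurable_snd)).const_mul _
  measurable_U := h.measurable_u.comp measurable_fst
  memLp_gram := h.memLp_gram_sample hs 0
  memLp_moment a := by
    simp only [blockResponse, blockRegressor, block, mul_assoc, Finset.sum_mul]
    exact (memLp_finsetSum _ fun k _ =>
      (h.identDistrib_moment hs 0 k a).memLp_iff.mpr (h.memLp_moment a)).const_mul _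
  gram a b := by
    rw [matH_apply]
    congr 1
    exact (((h.identDistrib_X hs 0).comp
      ((h.measurable_u_apply a).mul (h.measurable_u_apply b))).integral_eq).symm
  normal a := by
    rw [h.matH_mulVec_thetaStar]
    congr 1
    simp only [blockResponse, blockRegressor, block, mul_assoc, Finset.sum_mul]
    rw [integral_const_mul, integral_finsetSum _ fun k _ =>
      ((h.identDistrib_moment hs 0 k a).memLp_iff.mpr (h.memLp_moment a)).integrable one_le_two]
    simp_rw [(h.identDistrib_moment hs 0 _ a).integral_eq]
    have : (K : ℝ) ≠ 0 := by positivity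
    simp [this]

/-- The two sources of error: the misspecification residual, fixed by the covariate, and the
averaged conditional noise. They produce `A` and `B / K`. -/
theorem score_block {K : ℕ} (hK : 1 ≤ K) (i : ℕ) (ω : Ω') (a : Fin q) :
    score (blockResponse d f K) (blockRegressor p u) (thetaStar P X Y f u) (block Xs Ys i ω) a
      = residual P X Y f u a (Xs i ω)
        + 1 / (K : ℝ) * ∑ k ∈ Finset.range K,
          noise P X Y f (Xs i ω) (Ys i k ω) * u (Xs i ω) a := by
  have : (K : ℝ) ≠ 0 := by positivity
  simp only [score, blockResponse, blockRegressor, block, residual, noise, PiLp.smul_apply,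
    smul_eq_mul, ← Finset.sum_mul, Finset.sum_sub_distrib, Finset.sum_const, Finset.card_range,
    nsmul_eq_mul]
  field_simp
  ring

theorem integral_noise_mul_noise (i k l : ℕ) (a b : Fin q) :
    ∫ ω, (noise P X Y f (Xs i ω) (Ys i k ω) * u (Xs i ω) a)
      * (noise P X Y f (Xs i ω) (Ys i l ω) * u (Xs i ω) b) ∂P'
      = if k = l then matB P X Y f u a b else 0 := by
  split_ifs with hkl
  · subst hkl
    rw [h.matB_apply]
    exact ((h.identDistrib_pair hs i k).comp
      (u := fun z : EuclideanSpace ℝ (Fin d) × EuclideanSpace ℝ (Fin p) =>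
        (noise P X Y f z.1 z.2 * u z.1 a) * (noise P X Y f z.1 z.2 * u z.1 b))
      (((IsNestedSample.measurable_noise h.measurable_f).mul
        ((h.measurable_u_apply a).comp measurable_fst)).mul
        ((IsNestedSample.measurable_noise h.measurable_f).mul
        ((h.measurable_u_apply b).comp measurable_fst)))).integral_eq
  · rw [← hs.integral_mul_noise_mul_noise h.measurable_f i hkl
      ((h.measurable_u_apply a).mul (h.measurable_u_apply b))]
    refine integral_congr_ae (.of_forall fun ω => ?_)
    simp only [Pi.mul_apply]
    ring

theorem integral_residual_mul_noise (i k : ℕ) (a b : Fin q) :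
    ∫ ω, residual P X Y f u a (Xs i ω) * (noise P X Y f (Xs i ω) (Ys i k ω) * u (Xs i ω) b) ∂P'
      = 0 := by
  rw [← hs.integral_mul_noise h.measurable_f i k
    ((h.measurable_residual a).mul (h.measurable_u_apply b))]
  refine integral_congr_ae (.of_forall fun ω => ?_)
  simp only [Pi.mul_apply]
  ring

/-- Residual–noise products have mean zero, and of the `K²` noise products only the `K` diagonal
ones survive, so `B` gets the factor `K / K²`. -/
theorem matGamma_apply {K : ℕ} (hK : 1 ≤ K) (a b : Fin q) : matGamma P X Y f u K a b
    = ∫ ω, score (blockResponse d f K) (blockRegressor p u) (thetaStar P X Y f u)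
        (block Xs Ys 0 ω) a * score (blockResponse d f K) (blockRegressor p u)
        (thetaStar P X Y f u) (block Xs Ys 0 ω) b ∂P' := by
  have hK0 : (K : ℝ) ≠ 0 := by positivity
  simp_rw [h.score_block hs hK]
  have hR := h.memLp_residual_sample hs 0
  have hE := fun k a => h.memLp_noise_sample hs 0 k a
  have e : ∀ ω, (residual P X Y f u a (Xs 0 ω) + 1 / (K : ℝ) * ∑ k ∈ Finset.range K,
        noise P X Y f (Xs 0 ω) (Ys 0 k ω) * u (Xs 0 ω) a)
      * (residual P X Y f u b (Xs 0 ω) + 1 / (K : ℝ) * ∑ k ∈ Finset.range K,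
        noise P X Y f (Xs 0 ω) (Ys 0 k ω) * u (Xs 0 ω) b)
      = residual P X Y f u a (Xs 0 ω) * residual P X Y f u b (Xs 0 ω)
        + (1 / (K : ℝ) * ∑ k ∈ Finset.range K, (residual P X Y f u a (Xs 0 ω)
            * (noise P X Y f (Xs 0 ω) (Ys 0 k ω) * u (Xs 0 ω) b)
          + residual P X Y f u b (Xs 0 ω)
            * (noise P X Y f (Xs 0 ω) (Ys 0 k ω) * u (Xs 0 ω) a))
        + (1 / (K : ℝ)) ^ 2 * ∑ k ∈ Finset.range K, ∑ l ∈ Finset.range K,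
          (noise P X Y f (Xs 0 ω) (Ys 0 k ω) * u (Xs 0 ω) a)
            * (noise P X Y f (Xs 0 ω) (Ys 0 l ω) * u (Xs 0 ω) b)) := by
    intro ω
    rw [← Finset.sum_mul_sum, Finset.sum_add_distrib, ← Finset.mul_sum, ← Finset.mul_sum]
    ring
  simp_rw [e]
  have i1 : Integrable (fun ω => residual P X Y f u a (Xs 0 ω) * residual P X Y f u b (Xs 0 ω)) P' :=
    (hR a).integrable_mul (hR b)
  have i2 : ∀ k a b, Integrable (fun ω => residual P X Y f u a (Xs 0 ω)
            * (noise P X Y f (Xs 0 ω) (Ys 0 k ω) * u (Xs 0 ω) b)) P' := fun k a b =>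
    (hR a).integrable_mul (hE k b)
  have i3 : ∀ k l, Integrable (fun ω => (noise P X Y f (Xs 0 ω) (Ys 0 k ω) * u (Xs 0 ω) a)
            * (noise P X Y f (Xs 0 ω) (Ys 0 l ω) * u (Xs 0 ω) b)) P' := fun k l =>
    (hE k a).integrable_mul (hE l b)
  have i4 := (integrable_finsetSum (Finset.range K) fun k _ =>
    (i2 k a b).fun_add (i2 k b a)).const_mul (1 / (K : ℝ))
  have i5 := (integrable_finsetSum (Finset.range K) fun k _ =>
    integrable_finsetSum (Finset.range K) fun l _ => i3 k l).const_mul ((1 / (K : ℝ)) ^ 2)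
  rw [integral_add i1 (i4.fun_add i5), integral_add i4 i5, integral_const_mul, integral_const_mul,
    integral_finsetSum _ fun k _ => (i2 k a b).fun_add (i2 k b a),
    integral_finsetSum _ fun k _ => integrable_finsetSum _ fun l _ => i3 k l]
  simp_rw [fun k => integral_finsetSum (Finset.range K) fun l _ => i3 k l,
    fun k => integral_add (i2 k a b) (i2 k b a), h.integral_residual_mul_noise hs,
    h.integral_noise_mul_noise hs]
  have hA : ∫ ω, residual P X Y f u a (Xs 0 ω) * residual P X Y f u b (Xs 0 ω) ∂P'
      = matA P X Y f u a b := by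
    rw [h.matA_apply]
    exact ((h.identDistrib_X hs 0).comp
      ((h.measurable_residual a).mul (h.measurable_residual b))).integral_eq
  have hsum : ∑ k ∈ Finset.range K, ∑ l ∈ Finset.range K,
      (if k = l then matB P X Y f u a b else 0) = K * matB P X Y f u a b := by
    rw [Finset.sum_congr rfl fun k hk => by rw [Finset.sum_ite_eq, if_pos hk]]
    simp
  rw [hA, hsum]
  simp only [matGamma, Matrix.add_apply, Matrix.smul_apply, smul_eq_mul, add_zero,
    Finset.sum_const_zero, mul_zero, zero_add]
  field_simp

end Sample

end RegressionModel

end PopulationModel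

theorem dotProduct_mulVec_eq_sum {q : ℕ} (M : Matrix (Fin q) (Fin q) ℝ) (v : Fin q → ℝ) :
    v ⬝ᵥ M *ᵥ v = ∑ a, ∑ b, M a b * (v a * v b) := by
  simp only [dotProduct, Matrix.mulVec, Finset.mul_sum]
  exact Finset.sum_congr rfl fun a _ => Finset.sum_congr rfl fun b _ => by ring

/-! ### Positivity of the mean excess risk -/

namespace RegressionSample

variable {Ω 𝒱 : Type*} [MeasurableSpace Ω] [MeasurableSpace 𝒱] {q : ℕ}
  {μ : Measure Ω} [IsProbabilityMeasure μ] {V : ℕ → Ω → 𝒱} {w : 𝒱 → ℝ}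
  {U : 𝒱 → EuclideanSpace ℝ (Fin q)} {H : Matrix (Fin q) (Fin q) ℝ}
  {θ : EuclideanSpace ℝ (Fin q)} {ε : ℝ}

theorem memLp_floorEstimator_apply (h : RegressionSample μ V w U H θ) (hε : 0 < ε) (N : ℕ)
    (a : Fin q) : MemLp (fun ω => floorEstimator ε w U N (fun i => V i ω) a) 2 μ := by
  have e : ∀ ω, floorEstimator ε w U N (fun i => V i ω) a
      = ∑ b, 2 * ((eigenFloor (sampleGram U N fun i => V i ω) ε)⁻¹ a b
        * sampleMoment w U N (fun i => V i ω) b) := by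
    intro ω
    rw [← Finset.mul_sum]
    rfl
  simp_rw [e]
  refine memLp_finsetSum _ fun b _ => MemLp.const_mul ?_ _
  have hm : MemLp (fun ω => sampleMoment w U N (fun i => V i ω) b) 2 μ := by
    simp_rw [sampleMoment_apply]
    exact (memLp_sum h.ident (φ := fun v => w v * U v b)
      (h.measurable_w.mul (h.measurable_U_apply b)) (h.memLp_moment b) N).const_mul _
  refine MemLp.of_le_mul (c := ε⁻¹) hm
    ((h.measurable_inv_floor N ε a b).aestronglyMeasurable.mul hm.1) (.of_forall fun ω => ?_)
  rw [norm_mul]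
  exact mul_le_mul_of_nonneg_right
    (abs_inv_eigenFloor_apply_le (sampleGram_posSemidef _ _ _).1 hε a b) (norm_nonneg _)

theorem integral_meanScore (h : RegressionSample μ V w U H θ) (N : ℕ) (a : Fin q) :
    ∫ ω, meanScore w U θ N (fun i => V i ω) a ∂μ = 0 := by
  simp_rw [meanScore, sampleMoment_sub]
  have hi : ∀ i, IdentDistrib (fun ω => score w U θ (V i ω) a) (fun ω => score w U θ (V 0 ω) a)
      μ μ := fun i => (h.ident i).comp (h.measurable_score_apply a)
  rw [integral_const_mul, integral_finsetSum _ fun i _ =>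
    ((hi i).memLp_iff.mpr (h.memLp_score a)).integrable one_le_two]
  simp_rw [fun i => (hi i).integral_eq, h.integral_score]
  simp

theorem integral_meanScore_sq (h : RegressionSample μ V w U H θ) {N : ℕ} (hN : 1 ≤ N)
    (a : Fin q) : N * ∫ ω, meanScore w U θ N (fun i => V i ω) a ^ 2 ∂μ
      = ∫ ω, score w U θ (V 0 ω) a ^ 2 ∂μ := by
  have hN0 : (N : ℝ) ≠ 0 := by positivity
  simp_rw [meanScore, sampleMoment_sub, sq, mul_mul_mul_comm (1 / (N : ℝ))]
  rw [integral_const_mul, integral_sum_mul_sum h.indep h.ident (h.measurable_score_apply a)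
    (h.measurable_score_apply a) (h.memLp_score a) (h.memLp_score a) (h.integral_score a)]
  field_simp

/-- If the estimator is exact, then so is the linear model on the sample. -/
theorem meanScore_eq_zero_of_exact {S F : Matrix (Fin q) (Fin q) ℝ} (hSF : (F - S).PosSemidef)
    {r t : Fin q → ℝ} (hr : r = (1 / 2 : ℝ) • ((F - S) *ᵥ t)) :
    0 ≤ t ⬝ᵥ r ∧ (t ⬝ᵥ r = 0 → r = 0) := by
  have e : t ⬝ᵥ r = 1 / 2 * (t ⬝ᵥ (F - S) *ᵥ t) := by
    rw [hr, dotProduct_smul, smul_eq_mul]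
  have h0 := hSF.dotProduct_mulVec_nonneg t
  simp only [star_trivial] at h0
  refine ⟨by rw [e]; positivity, fun h => ?_⟩
  rw [e] at h
  have h1 : star t ⬝ᵥ (F - S) *ᵥ t = 0 := by simp only [star_trivial]; linarith
  rw [hr, (hSF.dotProduct_mulVec_zero_iff t).mp h1, smul_zero]

/-- The mean excess risk of a misspecified model is positive. -/
theorem integral_quadForm_pos (h : RegressionSample μ V w U H θ) (hε : 0 < ε) (hH : H.PosDef)
    (hHε : (H - (2 * ε) • (1 : Matrix (Fin q) (Fin q) ℝ)).PosSemidef) {N : ℕ} (hN : 1 ≤ N)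
    {a : Fin q} (ha : ∫ ω, score w U θ (V 0 ω) a ^ 2 ∂μ ≠ 0) :
    0 < ∫ ω, 1 / 2 * ((floorEstimator ε w U N (fun i => V i ω) - θ).ofLp ⬝ᵥ
      H *ᵥ (floorEstimator ε w U N (fun i => V i ω) - θ).ofLp) ∂μ := by
  have hnn : ∀ ω, 0 ≤ 1 / 2 * ((floorEstimator ε w U N (fun i => V i ω) - θ).ofLp ⬝ᵥ
      H *ᵥ (floorEstimator ε w U N (fun i => V i ω) - θ).ofLp) := fun ω => by
    have := hH.posSemidef.dotProduct_mulVec_nonneg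
      (floorEstimator ε w U N (fun i => V i ω) - θ).ofLp
    simp only [star_trivial] at this
    positivity
  -- If the mean vanished, the estimator would equal `θ` almost surely, so `r = (F - G) θ / 2`. As
  -- `F ≥ G`, this gives `θ · r ≥ 0`; but `θ · r` has mean zero, so it vanishes, which forces `r =
  -- 0` and contradicts `N E[r_a²] = E[score_a²] ≠ 0`.
  refine (integral_nonneg hnn).lt_of_ne' fun h0 => ha ?_
  rw [integral_eq_zero_iff_of_nonneg hnn (h.integrable_quadForm hε hH hHε N)] at h0
  have hex : ∀ᵐ ω ∂μ, meanScore w U θ N (fun i => V i ω) = (1 / 2 : ℝ) •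
      ((eigenFloor (sampleGram U N fun i => V i ω) ε - sampleGram U N fun i => V i ω)
        *ᵥ θ.ofLp) := by
    filter_upwards [h0] with ω hω
    set δ := (floorEstimator ε w U N (fun i => V i ω) - θ).ofLp with hδ
    have h1 : δ = 0 := by
      by_contra hne
      have := hH.dotProduct_mulVec_pos hne
      simp only [star_trivial] at this
      simp only [Pi.zero_apply] at hω
      linarith
    rw [hδ, WithLp.ofLp_sub, sub_eq_zero, floorEstimator_ofLp] at h1
    have h2 : (sampleMoment w U N fun i => V i ω).ofLp
        = (1 / 2 : ℝ) • (eigenFloor (sampleGram U N fun i => V i ω) ε *ᵥ θ.ofLp) := by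
      rw [← h1, Matrix.mulVec_smul, Matrix.mulVec_mulVec, Matrix.mul_nonsing_inv _
        (isUnit_det_eigenFloor (sampleGram_posSemidef _ _ _).1 hε), Matrix.one_mulVec, smul_smul]
      norm_num
    rw [meanScore, h2, Matrix.sub_mulVec, smul_sub]
  have hSF : ∀ ω, (eigenFloor (sampleGram U N fun i => V i ω) ε
      - sampleGram U N fun i => V i ω).PosSemidef := fun ω =>
    Matrix.le_iff.mp (le_eigenFloor (sampleGram_posSemidef _ _ _).1 ε)
  have hint : ∀ b, Integrable (fun ω => θ.ofLp b * meanScore w U θ N (fun i => V i ω) b) μ :=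
    fun b => ((h.memLp_meanScore N b).integrable one_le_two).const_mul _
  have hz : ∫ ω, θ.ofLp ⬝ᵥ meanScore w U θ N (fun i => V i ω) ∂μ = 0 := by
    simp only [dotProduct]
    rw [integral_finsetSum _ fun b _ => hint b]
    simp_rw [integral_const_mul, h.integral_meanScore]
    simp
  rw [integral_eq_zero_iff_of_nonneg_ae
    (hex.mono fun ω hω => (meanScore_eq_zero_of_exact (hSF ω) hω).1)
    (integrable_finsetSum _ fun b _ => hint b)] at hz
  rw [← h.integral_meanScore_sq hN a]
  have hr : ∀ᵐ ω ∂μ, meanScore w U θ N (fun i => V i ω) a ^ 2 = 0 := by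
    filter_upwards [hex, hz] with ω h1 h2
    rw [(meanScore_eq_zero_of_exact (hSF ω) h1).2 h2]
    simp
  rw [integral_congr_ae hr]
  simp

end RegressionSample

/-! ### Quadratic forms in uncorrelated variables -/

/-- The mean of a quadratic form in `L + c ∑ p, ζ p` for mutually uncorrelated `L`, `ζ p`. -/
theorem integral_quadForm_add_sum {Ω ι : Type*} [MeasurableSpace Ω] {μ : Measure Ω} {q : ℕ}
    [DecidableEq ι] (H : Matrix (Fin q) (Fin q) ℝ) {L : Ω → Fin q → ℝ} {ζ : ι → Ω → Fin q → ℝ}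
    (hL : ∀ a, MemLp (fun ω => L ω a) 2 μ) (hζ : ∀ p a, MemLp (fun ω => ζ p ω a) 2 μ)
    (hLζ : ∀ p a b, ∫ ω, L ω a * ζ p ω b ∂μ = 0)
    (hζζ : ∀ p p', p ≠ p' → ∀ a b, ∫ ω, ζ p ω a * ζ p' ω b ∂μ = 0) (c : ℝ) (s : Finset ι) :
    ∫ ω, (L ω + c • ∑ p ∈ s, ζ p ω) ⬝ᵥ H *ᵥ (L ω + c • ∑ p ∈ s, ζ p ω) ∂μ
      = ∫ ω, L ω ⬝ᵥ H *ᵥ L ω ∂μ + c ^ 2 * ∑ p ∈ s, ∫ ω, ζ p ω ⬝ᵥ H *ᵥ ζ p ω ∂μ := by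
  have i1 : ∀ a b, Integrable (fun ω => L ω a * L ω b) μ := fun a b =>
    (hL a).integrable_mul (hL b)
  have i2 : ∀ p a b, Integrable (fun ω => L ω a * ζ p ω b) μ := fun p a b =>
    (hL a).integrable_mul (hζ p b)
  have i3 : ∀ p p' a b, Integrable (fun ω => ζ p ω a * ζ p' ω b) μ := fun p p' a b =>
    (hζ p a).integrable_mul (hζ p' b)
  have key : ∀ {v : Ω → Fin q → ℝ}, (∀ a b, Integrable (fun ω => v ω a * v ω b) μ) →
      ∫ ω, v ω ⬝ᵥ H *ᵥ v ω ∂μ = ∑ a, ∑ b, H a b * ∫ ω, v ω a * v ω b ∂μ := by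
    intro v hv
    simp_rw [dotProduct_mulVec_eq_sum]
    rw [integral_finsetSum _ fun a _ => integrable_finsetSum _ fun b _ =>
      (hv a b).const_mul (H a b)]
    simp_rw [fun a => integral_finsetSum Finset.univ fun b _ => (hv a b).const_mul (H a b),
      integral_const_mul]
  have e : ∀ a b ω, (L ω + c • ∑ p ∈ s, ζ p ω) a * (L ω + c • ∑ p ∈ s, ζ p ω) b
      = L ω a * L ω b + ((c * ∑ p ∈ s, (L ω a * ζ p ω b + L ω b * ζ p ω a))
        + c ^ 2 * ∑ p ∈ s, ∑ p' ∈ s, ζ p ω a * ζ p' ω b) := by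
    intro a b ω
    simp only [Pi.add_apply, Pi.smul_apply, smul_eq_mul, Finset.sum_apply]
    rw [← Finset.sum_mul_sum, Finset.sum_add_distrib, ← Finset.mul_sum, ← Finset.mul_sum]
    ring
  have j1 : ∀ a b, Integrable (fun ω => c * ∑ p ∈ s, (L ω a * ζ p ω b + L ω b * ζ p ω a)) μ :=
    fun a b => (integrable_finsetSum _ fun p _ => (i2 p a b).fun_add (i2 p b a)).const_mul _
  have j2 : ∀ a b, Integrable (fun ω => c ^ 2 * ∑ p ∈ s, ∑ p' ∈ s, ζ p ω a * ζ p' ω b) μ :=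
    fun a b => (integrable_finsetSum _ fun p _ => integrable_finsetSum _ fun p' _ =>
      i3 p p' a b).const_mul _
  have hprod : ∀ a b, ∫ ω, (L ω + c • ∑ p ∈ s, ζ p ω) a * (L ω + c • ∑ p ∈ s, ζ p ω) b ∂μ
      = ∫ ω, L ω a * L ω b ∂μ + c ^ 2 * ∑ p ∈ s, ∫ ω, ζ p ω a * ζ p ω b ∂μ := by
    intro a b
    simp_rw [e a b]
    rw [integral_add (i1 a b) ((j1 a b).fun_add (j2 a b)), integral_add (j1 a b) (j2 a b),
      integral_const_mul, integral_const_mul,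
      integral_finsetSum _ fun p _ => (i2 p a b).fun_add (i2 p b a),
      integral_finsetSum _ fun p _ => integrable_finsetSum _ fun p' _ => i3 p p' a b]
    simp_rw [fun p => integral_add (i2 p a b) (i2 p b a), hLζ, add_zero, Finset.sum_const_zero,
      mul_zero, zero_add, fun p => integral_finsetSum s fun p' _ => i3 p p' a b]
    congr 2
    refine Finset.sum_congr rfl fun p hp => ?_
    rw [Finset.sum_eq_single_of_mem p hp fun p' _ hne => hζζ p p' hne.symm a b]
  have hint : ∀ a b, Integrable (fun ω => (L ω + c • ∑ p ∈ s, ζ p ω) a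
      * (L ω + c • ∑ p ∈ s, ζ p ω) b) μ := fun a b => by
    simp_rw [e a b]
    exact (i1 a b).fun_add ((j1 a b).fun_add (j2 a b))
  rw [key hint, key i1]
  simp_rw [fun p => key (i3 p p), hprod, mul_add, Finset.sum_add_distrib, Finset.mul_sum]
  congr 1
  symm
  rw [Finset.sum_comm]
  refine Finset.sum_congr rfl fun a _ => ?_
  rw [Finset.sum_comm]
  exact Finset.sum_congr rfl fun b _ => Finset.sum_congr rfl fun p _ => by ring

/-! ### Decomposition of the mean excess risk -/

namespace RegressionModel

variable {d p q : ℕ} {Ω Ω' : Type*} [MeasurableSpace Ω] [MeasurableSpace Ω']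
  {P : Measure Ω} [IsProbabilityMeasure P] {P' : Measure Ω'} [IsProbabilityMeasure P']
  {X : Ω → EuclideanSpace ℝ (Fin d)} {Y : Ω → EuclideanSpace ℝ (Fin p)}
  {f : EuclideanSpace ℝ (Fin p) → ℝ} {u : EuclideanSpace ℝ (Fin d) → EuclideanSpace ℝ (Fin q)}
  {Xs : ℕ → Ω' → EuclideanSpace ℝ (Fin d)} {Ys : ℕ → ℕ → Ω' → EuclideanSpace ℝ (Fin p)}

/-- The covariates, with the conditional means as responses. -/
theorem covariateSample (h : RegressionModel P X Y f u) (hs : IsNestedSample P X Y P' Xs Ys) :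
    RegressionSample P' Xs (regMean P X Y f) u (matH P X u) (thetaStar P X Y f u) where
  indep := hs.indep.comp (fun _ => Prod.fst) fun _ => measurable_fst
  measurable_V := hs.measurable_X
  ident i := (h.identDistrib_X hs i).trans (h.identDistrib_X hs 0).symm
  measurable_w := measurable_regMean h.measurable_f
  measurable_U := h.measurable_u
  memLp_gram := h.memLp_gram_sample hs 0
  memLp_moment a := ((h.identDistrib_X hs 0).comp ((measurable_regMean h.measurable_f).mul
    (h.measurable_u_apply a))).memLp_iff.mpr (h.memLp_regMean_mul_u a)
  gram a b := by
    rw [matH_apply]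
    congr 1
    exact (((h.identDistrib_X hs 0).comp
      ((h.measurable_u_apply a).mul (h.measurable_u_apply b))).integral_eq).symm
  normal a := by
    rw [h.matH_mulVec_thetaStar, ← h.integral_regMean_mul_u]
    congr 1
    exact (((h.identDistrib_X hs 0).comp ((measurable_regMean h.measurable_f).mul
      (h.measurable_u_apply a))).integral_eq).symm

theorem matA_apply_eq_score (h : RegressionModel P X Y f u) (hs : IsNestedSample P X Y P' Xs Ys)
    (a b : Fin q) : matA P X Y f u a b
      = ∫ ω, score (regMean P X Y f) u (thetaStar P X Y f u) (Xs 0 ω) a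
        * score (regMean P X Y f) u (thetaStar P X Y f u) (Xs 0 ω) b ∂P' := by
  rw [h.matA_apply]
  exact (((h.identDistrib_X hs 0).comp
    ((h.measurable_residual a).mul (h.measurable_residual b))).integral_eq).symm

/-- The weight of the noise of the `i`-th block in the estimator. -/
noncomputable def _root_.NestedRegression.noiseWeight
    (u : EuclideanSpace ℝ (Fin d) → EuclideanSpace ℝ (Fin q)) (ε : ℝ) (N i : ℕ)
    (x : ℕ → EuclideanSpace ℝ (Fin d)) : Fin q → ℝ :=
  (2 / (N : ℝ)) • ((eigenFloor (sampleGram u N x) ε)⁻¹ *ᵥ (u (x i)).ofLp)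

/-- The estimator is linear in the responses, and the floored inverse involves covariates only.
Replacing `f(Y)` by conditional mean plus noise splits off the noise with weights determined by the
covariates. -/
theorem thetaHat_sub_ofLp {K : ℕ} (hK : 1 ≤ K) (ε : ℝ) (N : ℕ) (ω : Ω') :
    (thetaHat f u Xs Ys ε K N ω - thetaStar P X Y f u).ofLp
      = (floorEstimator ε (regMean P X Y f) u N (fun r => Xs r ω) - thetaStar P X Y f u).ofLp
        + (1 / (K : ℝ)) • ∑ z ∈ Finset.range N ×ˢ Finset.range K,
          noise P X Y f (Xs z.1 ω) (Ys z.1 z.2 ω) • noiseWeight u ε N z.1 fun r => Xs r ω := by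
  have hK0 : (K : ℝ) ≠ 0 := by positivity
  set F := (eigenFloor (sampleGram u N fun r => Xs r ω) ε)⁻¹ with hF
  have e1 : (thetaHat f u Xs Ys ε K N ω).ofLp = (2 : ℝ) • (F *ᵥ
      (sampleMoment (blockResponse d f K) (blockRegressor p u) N fun i => block Xs Ys i ω).ofLp) :=
    rfl
  have e2 : (sampleMoment (blockResponse d f K) (blockRegressor p u) N
      fun i => block Xs Ys i ω).ofLp = (sampleMoment (regMean P X Y f) u N fun r => Xs r ω).ofLp
        + (1 / (K : ℝ)) • (1 / (N : ℝ)) • ∑ z ∈ Finset.range N ×ˢ Finset.range K,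
          noise P X Y f (Xs z.1 ω) (Ys z.1 z.2 ω) • (u (Xs z.1 ω)).ofLp := by
    ext a
    simp only [Pi.add_apply, Pi.smul_apply, Finset.sum_apply, smul_eq_mul, sampleMoment_apply,
      Finset.sum_product, ← Finset.sum_mul]
    rw [mul_left_comm, ← mul_add]
    congr 1
    rw [Finset.mul_sum, ← Finset.sum_add_distrib]
    refine Finset.sum_congr rfl fun i _ => ?_
    simp only [blockResponse, blockRegressor, block, noise, Finset.sum_sub_distrib,
      Finset.sum_const, Finset.card_range, nsmul_eq_mul]
    field_simp
    ring
  rw [WithLp.ofLp_sub, WithLp.ofLp_sub, e1, e2, floorEstimator_ofLp, Matrix.mulVec_add, smul_add,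
    add_sub_right_comm]
  congr 1
  rw [Matrix.mulVec_smul, Matrix.mulVec_smul, Matrix.mulVec_sum, smul_comm (2 : ℝ), smul_smul 2,
    mul_one_div, Finset.smul_sum]
  congr 1
  refine Finset.sum_congr rfl fun z _ => ?_
  rw [noiseWeight, Matrix.mulVec_smul, smul_comm]

section Decomposition

variable (h : RegressionModel P X Y f u) (hs : IsNestedSample P X Y P' Xs Ys) {ε : ℝ}

include h in
theorem measurable_sampleGram_cov (N : ℕ) (a b : Fin q) :
    Measurable fun x : ℕ → EuclideanSpace ℝ (Fin d) => sampleGram u N x a b :=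
  (Finset.measurable_fun_sum _ fun i _ => ((h.measurable_u_apply a).comp (measurable_pi_apply i)).mul
    ((h.measurable_u_apply b).comp (measurable_pi_apply i))).const_mul _

include h in
theorem measurable_inv_floor_cov (N : ℕ) (ε : ℝ) (a b : Fin q) :
    Measurable fun x : ℕ → EuclideanSpace ℝ (Fin d) => (eigenFloor (sampleGram u N x) ε)⁻¹ a b :=
  measurable_inv_apply (fun c e => measurable_eigenFloor_apply (h.measurable_sampleGram_cov N)
    (fun _ => (sampleGram_posSemidef _ _ _).1) ε c e) a b

include h in
theorem measurable_noiseWeight (N i : ℕ) (ε : ℝ) (a : Fin q) :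
    Measurable fun x => noiseWeight u ε N i x a := by
  simp only [noiseWeight, Pi.smul_apply, smul_eq_mul, Matrix.mulVec, dotProduct]
  exact (Finset.measurable_fun_sum _ fun b _ => (h.measurable_inv_floor_cov N ε a b).mul
    ((h.measurable_u_apply b).comp (measurable_pi_apply i))).const_mul _

include h in
theorem measurable_floorEstimator_cov (N : ℕ) (ε : ℝ) (a : Fin q) :
    Measurable fun x => (floorEstimator ε (regMean P X Y f) u N x - thetaStar P X Y f u) a := by
  refine Measurable.sub_const (f := fun x => floorEstimator ε (regMean P X Y f) u N x a) ?_ _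
  refine (Finset.measurable_fun_sum Finset.univ fun b _ =>
    (h.measurable_inv_floor_cov N ε a b).mul (?_ : Measurable fun x =>
      sampleMoment (regMean P X Y f) u N x b)).const_mul 2
  simp_rw [sampleMoment_apply]
  exact (Finset.measurable_fun_sum _ fun i _ =>
    ((measurable_regMean h.measurable_f).comp (measurable_pi_apply i)).mul
    ((h.measurable_u_apply b).comp (measurable_pi_apply i))).const_mul _

include h hs

/-- The floored inverse is bounded by `1 / ε`, so square integrability is inherited from `noise ·
u`. -/
theorem memLp_noise_mul_noiseWeight (hε : 0 < ε) (N i k : ℕ) (a : Fin q) :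
    MemLp (fun ω => (noise P X Y f (Xs i ω) (Ys i k ω)
      • noiseWeight u ε N i fun r => Xs r ω) a) 2 P' := by
  have e : ∀ ω, (noise P X Y f (Xs i ω) (Ys i k ω) • noiseWeight u ε N i fun r => Xs r ω) a
      = ∑ b, 2 / (N : ℝ) * ((eigenFloor (sampleGram u N fun r => Xs r ω) ε)⁻¹ a b
        * (noise P X Y f (Xs i ω) (Ys i k ω) * u (Xs i ω) b)) := by
    intro ω
    simp only [noiseWeight, Pi.smul_apply, smul_eq_mul, Matrix.mulVec, dotProduct, Finset.mul_sum]
    exact Finset.sum_congr rfl fun b _ => by ring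
  simp_rw [e]
  refine memLp_finsetSum _ fun b _ => MemLp.const_mul ?_ _
  have hm := h.memLp_noise_sample hs i k b
  refine MemLp.of_le_mul (c := ε⁻¹) hm
    (((h.covariateSample hs).measurable_inv_floor N ε a b).aestronglyMeasurable.mul hm.1)
    (.of_forall fun ω => ?_)
  rw [norm_mul]
  exact mul_le_mul_of_nonneg_right
    (abs_inv_eigenFloor_apply_le (sampleGram_posSemidef _ _ _).1 hε a b) (norm_nonneg _)

/-- The mean excess risk is affine in `1 / K`. -/
theorem integral_quadForm_thetaHat (hε : 0 < ε) {K : ℕ} (hK : 1 ≤ K) (N : ℕ) :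
    ∫ ω, 1 / 2 * ((thetaHat f u Xs Ys ε K N ω - thetaStar P X Y f u).ofLp ⬝ᵥ
        matH P X u *ᵥ (thetaHat f u Xs Ys ε K N ω - thetaStar P X Y f u).ofLp) ∂P'
      = ∫ ω, 1 / 2 * ((floorEstimator ε (regMean P X Y f) u N (fun r => Xs r ω)
          - thetaStar P X Y f u).ofLp ⬝ᵥ matH P X u *ᵥ
          (floorEstimator ε (regMean P X Y f) u N (fun r => Xs r ω)
          - thetaStar P X Y f u).ofLp) ∂P'
        + (∑ i ∈ Finset.range N, ∫ ω, 1 / 2 * ((noise P X Y f (Xs i ω) (Ys i 0 ω) •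
          noiseWeight u ε N i fun r => Xs r ω) ⬝ᵥ matH P X u *ᵥ
          (noise P X Y f (Xs i ω) (Ys i 0 ω) • noiseWeight u ε N i fun r => Xs r ω)) ∂P') / K := by
  have hK0 : (K : ℝ) ≠ 0 := by positivity
  simp_rw [integral_const_mul, thetaHat_sub_ofLp (P := P) (X := X) (Y := Y) hK]
  rw [integral_quadForm_add_sum (matH P X u)
    (L := fun ω => (floorEstimator ε (regMean P X Y f) u N (fun r => Xs r ω)
          - thetaStar P X Y f u).ofLp)
    (ζ := fun (z : ℕ × ℕ) ω => noise P X Y f (Xs z.1 ω) (Ys z.1 z.2 ω) •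
      noiseWeight u ε N z.1 fun r => Xs r ω)
    (fun a => ((h.covariateSample hs).memLp_floorEstimator_apply hε N a).sub (memLp_const _))
    (fun z a => h.memLp_noise_mul_noiseWeight hs hε N z.1 z.2 a)]
  -- All `K` draws of a block contribute equally, so the `K` equal terms times `1 / K²` leave `1 /
  -- K`.
  · have hsq : ∀ i k, ∫ ω, (noise P X Y f (Xs i ω) (Ys i k ω) •
          noiseWeight u ε N i fun r => Xs r ω) ⬝ᵥ matH P X u *ᵥ
          (noise P X Y f (Xs i ω) (Ys i k ω) • noiseWeight u ε N i fun r => Xs r ω) ∂P'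
        = ∫ ω, (noise P X Y f (Xs i ω) (Ys i 0 ω) •
          noiseWeight u ε N i fun r => Xs r ω) ⬝ᵥ matH P X u *ᵥ
          (noise P X Y f (Xs i ω) (Ys i 0 ω) • noiseWeight u ε N i fun r => Xs r ω) ∂P' := by
      intro i k
      have hm : Measurable fun x => noiseWeight u ε N i x ⬝ᵥ matH P X u *ᵥ noiseWeight u ε N i x := by
        simp_rw [dotProduct_mulVec_eq_sum]
        exact Finset.measurable_fun_sum _ fun a _ => Finset.measurable_fun_sum _ fun b _ =>
          ((h.measurable_noiseWeight N i ε a).mul (h.measurable_noiseWeight N i ε b)).const_mul _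
      have := hs.integral_cov_mul_noise_sq h.measurable_f i k hm
      refine Eq.trans ?_ (this.trans ?_) <;> refine integral_congr_ae (.of_forall fun ω => ?_) <;>
        simp only [Matrix.mulVec_smul, smul_dotProduct, dotProduct_smul, smul_eq_mul] <;> ring
    simp_rw [Finset.sum_product, hsq, Finset.sum_const, Finset.card_range, nsmul_eq_mul]
    rw [← Finset.mul_sum, ← Finset.mul_sum]
    field_simp
  · intro z a b
    rw [← hs.integral_cov_mul_noise h.measurable_f z.1 z.2
      ((h.measurable_floorEstimator_cov N ε a).mul (h.measurable_noiseWeight N z.1 ε b))]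
    refine integral_congr_ae (.of_forall fun ω => ?_)
    simp only [Pi.smul_apply, smul_eq_mul, Pi.mul_apply]
    ring
  · intro z z' hne a b
    rw [← hs.integral_cov_mul_noise_mul_noise h.measurable_f (i := z.1) (k := z.2) (j := z'.1)
      (l := z'.2) hne ((h.measurable_noiseWeight N z.1 ε a).mul (h.measurable_noiseWeight N z'.1 ε b))]
    refine integral_congr_ae (.of_forall fun ω => ?_)
    simp only [Pi.smul_apply, smul_eq_mul, Pi.mul_apply]
    ring

end Decomposition

end RegressionModel

/-! ### Allocation of a budget -/

/-- With `n = ν(r)` the difference is `(K - n) (K n - r) / (K n)`. Both factors have the same sign: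
`K < n` gives `K n ≤ (n - 1) n < r`, and `K > n` gives `K n ≥ n (n + 1) ≥ r`. -/
theorem add_div_nu_le (r : ℝ) {K : ℕ} (hK : 1 ≤ K) :
    (nu r : ℝ) + r / nu r ≤ K + r / K := by
  obtain ⟨h1, h2⟩ := nu_spec r
  set n := nu r with hn
  have hn0 : (0 : ℝ) < n := by positivity
  have hK0 : (0 : ℝ) < K := by positivity
  have key : 0 ≤ ((K : ℝ) - n) * (K * n - r) := by
    rcases lt_trichotomy K n with h | h | h
    -- Minimality of `n`: its predecessor is at least `K ≥ 1`, so it can only fail the second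
    -- condition.
    · have h3 : ¬ (1 ≤ n - 1 ∧ r ≤ ((n - 1 : ℕ) : ℝ) * ((n - 1 : ℕ) + 1)) := by
        have : n - 1 < sInf {m : ℕ | 1 ≤ m ∧ r ≤ (m : ℝ) * (m + 1)} := by
          change n - 1 < n
          omega
        exact Nat.notMem_of_lt_sInf this
      have h4 : ((n - 1 : ℕ) : ℝ) * ((n - 1 : ℕ) + 1) < r := by
        by_contra! h5
        exact h3 ⟨by omega, h5⟩
      rw [Nat.cast_sub h1, Nat.cast_one, sub_add_cancel] at h4
      have h5 : (K : ℝ) + 1 ≤ n := by exact_mod_cast h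
      exact mul_nonneg_of_nonpos_of_nonpos (by linarith) (by nlinarith)
    · rw [h]; simp
    · have h5 : (n : ℝ) + 1 ≤ K := by exact_mod_cast h
      exact mul_nonneg (by linarith) (by nlinarith)
  have e : (K : ℝ) + r / K - (n + r / n) = ((K : ℝ) - n) * (K * n - r) / (K * n) := by
    field_simp
    ring
  have := div_nonneg key (by positivity : (0 : ℝ) ≤ K * n)
  linarith

/-- The product equals `a + b κ + κ a (K + r / K)` with `r = b / (κ a)`, so only `K + r / K` depends
on `K`. -/
theorem costPerPrecision_nu_le {a b κ : ℝ} (ha : 0 < a) (hκ : 0 < κ) {K : ℕ}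
    (hK : 1 ≤ K) :
    (1 + nu (b / (κ * a)) * κ) * (a + b / nu (b / (κ * a))) ≤ (1 + K * κ) * (a + b / K) := by
  have h := add_div_nu_le (b / (κ * a)) hK
  have h1 := (nu_spec (b / (κ * a))).1
  set n := nu (b / (κ * a))
  have hn0 : (0 : ℝ) < n := by positivity
  have hK0 : (0 : ℝ) < K := by positivity
  have e : ∀ x : ℝ, 0 < x →
      (1 + x * κ) * (a + b / x) = a + b * κ + κ * a * (x + b / (κ * a) / x) := by
    intro x hx
    field_simp
    ring
  rw [e _ hn0, e _ hK0]
  gcongr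

theorem exists_pos_le_of_lt {α : ℕ → ℝ} (hα : ∀ N, 1 ≤ N → 0 < α N) (n : ℕ) :
    ∃ m, 0 < m ∧ ∀ N, 1 ≤ N → N < n → m ≤ α N := by
  induction n with
  | zero => exact ⟨1, one_pos, fun N _ h => absurd h (Nat.not_lt_zero N)⟩
  | succ n ih =>
    obtain ⟨m, hm, h⟩ := ih
    rcases Nat.eq_zero_or_pos n with rfl | hn
    · exact ⟨1, one_pos, fun N h1 h2 => by omega⟩
    · refine ⟨min m (α n), lt_min hm (hα n hn), fun N h1 h2 => ?_⟩
      rcases Nat.lt_succ_iff_lt_or_eq.mp h2 with h3 | rfl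
      · exact (min_le_left _ _).trans (h N h1 h3)
      · exact min_le_right _ _

section Budget

variable {α β : ℕ → ℝ} {a b κ : ℝ} {E : ℕ → ℕ → ℝ}

/-- The lower bound must hold for all `K` at once. For large `N` the limits of `N α N` and `N β N`
give it uniformly, since `K` enters only through `1 / K`; for the finitely many small `N` the excess
is at least some `m > 0`, and `c m` is eventually large. -/
theorem eventually_le_mul_of_budget (hα : ∀ N, 1 ≤ N → 0 < α N) (hβ : ∀ N, 0 ≤ β N)
    (hαl : Tendsto (fun N : ℕ => (N : ℝ) * α N) atTop (𝓝 a))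
    (hβl : Tendsto (fun N : ℕ => (N : ℝ) * β N) atTop (𝓝 b)) (ha : 0 < a) (hκ : 0 < κ)
    (hE : ∀ N K, 1 ≤ N → 1 ≤ K → E K N = α N + β N / K) {g : ℝ}
    (hg : g < (1 + nu (b / (κ * a)) * κ) * (a + b / nu (b / (κ * a)))) :
    ∀ᶠ c : ℝ in atTop, ∀ N K : ℕ, 1 ≤ N → 1 ≤ K → (N : ℝ) + N * K * κ ≤ c → g ≤ c * E K N := by
  have hb : 0 ≤ b := ge_of_tendsto' hβl fun N => mul_nonneg (Nat.cast_nonneg N) (hβ N)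
  set n := nu (b / (κ * a)) with hn
  set G := (1 + n * κ) * (a + b / n) with hG
  have hG0 : 0 < G := by positivity
  obtain ⟨δ, hδ0, hδ1, hδ⟩ : ∃ δ : ℝ, 0 < δ ∧ δ < 1 ∧ g ≤ (1 - δ) * G := by
    refine ⟨min (1 / 2) ((G - g) / G), lt_min (by norm_num) (div_pos (by linarith) hG0),
      (min_le_left _ _).trans_lt (by norm_num), ?_⟩
    have := mul_le_mul_of_nonneg_right (min_le_right (1 / 2) ((G - g) / G)) hG0.le
    rw [div_mul_cancel₀ _ hG0.ne'] at this
    linarith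
  have e1 : ∀ᶠ N : ℕ in atTop, (1 - δ) * a ≤ N * α N :=
    hαl.eventually_const_le (by nlinarith)
  -- If `b = 0` there is no gap `(1 - δ) b < b` to exploit, but `β ≥ 0` is enough.
  have e2 : ∀ᶠ N : ℕ in atTop, (1 - δ) * b ≤ N * β N := by
    rcases hb.eq_or_lt with h0 | h0
    · exact .of_forall fun N => by
        rw [← h0, mul_zero]; exact mul_nonneg (Nat.cast_nonneg N) (hβ N)
    · exact hβl.eventually_const_le (by nlinarith)
  obtain ⟨N₀, hN₀⟩ := eventually_atTop.mp (e1.and e2)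
  obtain ⟨m, hm, hmα⟩ := exists_pos_le_of_lt hα N₀
  filter_upwards [eventually_ge_atTop (max 0 (G / m))] with c hc N K hN hK hcost
  have hc0 : 0 ≤ c := (le_max_left _ _).trans hc
  have hK0 : (0 : ℝ) < K := by positivity
  have hN0 : (0 : ℝ) < N := by positivity
  have hβK : 0 ≤ β N / K := div_nonneg (hβ N) hK0.le
  rw [hE N K hN hK]
  rcases lt_or_ge N N₀ with h | h
  · have h1 : G ≤ c * m := (div_le_iff₀ hm).mp ((le_max_right _ _).trans hc)
    have h2 := hmα N hN h
    have h3 : c * m ≤ c * (α N + β N / K) := mul_le_mul_of_nonneg_left (by linarith) hc0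
    linarith
  · obtain ⟨h1, h2⟩ := hN₀ N h
    have hopt := costPerPrecision_nu_le (b := b) ha hκ hK
    calc g ≤ (1 - δ) * G := hδ
      _ ≤ (1 - δ) * ((1 + K * κ) * (a + b / K)) :=
          mul_le_mul_of_nonneg_left hopt (by linarith)
      _ = (1 + K * κ) * ((1 - δ) * a + ((1 - δ) * b) / K) := by ring
      _ ≤ (1 + K * κ) * (N * α N + (N * β N) / K) := by gcongr
      _ = (N + N * K * κ) * (α N + β N / K) := by ring
      _ ≤ c * (α N + β N / K) := by
          have := hα N hN
          gcongr

/-- Rounding is negligible: `c = s · (c / s)`, the ratio of `⌊c / s⌋` to `c / s` tends to `1`, and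
`N E K N → a + b / K`. -/
theorem tendsto_mul_floor_allocation (hαl : Tendsto (fun N : ℕ => (N : ℝ) * α N) atTop (𝓝 a))
    (hβl : Tendsto (fun N : ℕ => (N : ℝ) * β N) atTop (𝓝 b))
    (hE : ∀ N K, 1 ≤ N → 1 ≤ K → E K N = α N + β N / K) {K : ℕ} (hK : 1 ≤ K) {s : ℝ}
    (hs : 0 < s) :
    Tendsto (fun c : ℝ => c * E K ⌊c / s⌋₊) atTop (𝓝 (s * (a + b / K))) := by
  have hfl : Tendsto (fun c : ℝ => ⌊c / s⌋₊) atTop atTop :=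
    tendsto_nat_floor_atTop.comp (tendsto_id.atTop_div_const hs)
  have h1 : Tendsto (fun c : ℝ => (⌊c / s⌋₊ : ℝ) * E K ⌊c / s⌋₊) atTop (𝓝 (a + b / K)) := by
    have : Tendsto (fun N : ℕ => (N : ℝ) * E K N) atTop (𝓝 (a + b / K)) := by
      refine (hαl.add (hβl.div_const (K : ℝ))).congr' ?_
      filter_upwards [eventually_ge_atTop 1] with N hN
      rw [hE N K hN hK]
      ring
    exact this.comp hfl
  have h2 : Tendsto (fun c : ℝ => (⌊c / s⌋₊ : ℝ) / (c / s)) atTop (𝓝 1) :=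
    (tendsto_nat_floor_div_atTop (R := ℝ)).comp (tendsto_id.atTop_div_const hs)
  have h3 := (h2.inv₀ one_ne_zero).const_mul s |>.mul h1
  rw [inv_one, mul_one] at h3
  refine h3.congr' ?_
  filter_upwards [eventually_ge_atTop s] with c hc
  have hc0 : 0 < c := hs.trans_le hc
  have : (⌊c / s⌋₊ : ℝ) ≠ 0 := by
    have := Nat.floor_pos.mpr ((one_le_div hs).mpr hc)
    positivity
  field_simp

theorem one_le_floor_allocation {c s : ℝ} (hs : 0 < s) (hc : s ≤ c) : 1 ≤ ⌊c / s⌋₊ :=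
  Nat.floor_pos.mpr ((one_le_div hs).mpr hc)

theorem floor_allocation_cost_le {c κ : ℝ} {K : ℕ} (hc : 0 ≤ c) (hs : 0 < 1 + K * κ) :
    (⌊c / (1 + K * κ)⌋₊ : ℝ) + ⌊c / (1 + K * κ)⌋₊ * K * κ ≤ c := by
  have h := Nat.floor_le (div_nonneg hc hs.le)
  rw [le_div_iff₀ hs] at h
  linarith

/-- Asymptotic optimality of the allocation for a risk of the form `α N + β N / K`. -/
theorem isEquivalent_floor_allocation (hα : ∀ N, 1 ≤ N → 0 < α N) (hβ : ∀ N, 0 ≤ β N)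
    (hαl : Tendsto (fun N : ℕ => (N : ℝ) * α N) atTop (𝓝 a))
    (hβl : Tendsto (fun N : ℕ => (N : ℝ) * β N) atTop (𝓝 b)) (ha : 0 < a) (hκ : 0 < κ)
    (hE : ∀ N K, 1 ≤ N → 1 ≤ K → E K N = α N + β N / K) :
    Asymptotics.IsEquivalent atTop
      (fun c : ℝ => E (nu (b / (κ * a))) ⌊c / (1 + nu (b / (κ * a)) * κ)⌋₊)
      (fun c : ℝ => sInf {e : ℝ | ∃ N K : ℕ, 1 ≤ N ∧ 1 ≤ K ∧ (N : ℝ) + N * K * κ ≤ c ∧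
        e = E K N}) := by
  have hb : 0 ≤ b := ge_of_tendsto' hβl fun N => mul_nonneg (Nat.cast_nonneg N) (hβ N)
  have hlow := fun g hg => eventually_le_mul_of_budget (g := g) hα hβ hαl hβl ha hκ hE hg
  have hn1 := (nu_spec (b / (κ * a))).1
  set n := nu (b / (κ * a)) with hn
  have hs : 0 < 1 + (n : ℝ) * κ := by positivity
  set G := (1 + n * κ) * (a + b / n) with hG
  have hG0 : 0 < G := by positivity
  have hu := tendsto_mul_floor_allocation hαl hβl hE hn1 hs
  set best : ℝ → ℝ := fun c => sInf {e : ℝ | ∃ N K : ℕ, 1 ≤ N ∧ 1 ≤ K ∧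
    (N : ℝ) + N * K * κ ≤ c ∧ e = E K N}
  have hmem : ∀ᶠ c : ℝ in atTop, E n ⌊c / (1 + n * κ)⌋₊ ∈ {e : ℝ | ∃ N K : ℕ, 1 ≤ N ∧ 1 ≤ K ∧
      (N : ℝ) + N * K * κ ≤ c ∧ e = E K N} := by
    filter_upwards [eventually_ge_atTop (1 + n * κ)] with c hc
    exact ⟨_, n, one_le_floor_allocation hs hc, hn1,
      floor_allocation_cost_le (hs.le.trans hc) hs, rfl⟩
  -- The infimum is squeezed between the uniform lower bound and the value at the proposed
  -- allocation, so both sides are equivalent to `G / c`.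
  have hv : Tendsto (fun c => c * best c) atTop (𝓝 G) := by
    refine tendsto_order.mpr ⟨fun g hg => ?_, fun g hg => ?_⟩
    · obtain ⟨g', hg1, hg2⟩ := exists_between hg
      filter_upwards [hlow g' hg2, hmem, eventually_gt_atTop 0] with c h1 h2 hc
      refine hg1.trans_le ?_
      rw [← div_le_iff₀' hc]
      refine le_csInf ⟨_, h2⟩ ?_
      rintro _ ⟨N, K, hN, hK, hcost, rfl⟩
      rw [div_le_iff₀' hc]
      exact h1 N K hN hK hcost
    · filter_upwards [hu.eventually_lt_const hg, hmem, eventually_gt_atTop 0] with c h1 h2 hc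
      refine lt_of_le_of_lt (mul_le_mul_of_nonneg_left (csInf_le ⟨0, ?_⟩ h2) hc.le) h1
      rintro _ ⟨N, K, hN, hK, -, rfl⟩
      rw [hE N K hN hK]
      exact add_nonneg (hα N hN).le (div_nonneg (hβ N) (Nat.cast_nonneg K))
  have key : ∀ w : ℝ → ℝ, Tendsto (fun c => c * w c) atTop (𝓝 G) →
      Asymptotics.IsEquivalent atTop w fun c => G / c := by
    intro w hw
    refine Asymptotics.isEquivalent_of_tendsto_one ?_
    have := hw.div_const G
    rw [div_self hG0.ne'] at this
    refine this.congr' ?_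
    filter_upwards [eventually_gt_atTop 0] with c hc
    simp only [Pi.div_apply]
    field_simp
  exact (key _ hu).trans (key _ hv).symm

end Budget

/-! ### The floored estimator of a nested sample -/

namespace RegressionModel

variable {d p q : ℕ} {Ω Ω' : Type*} [MeasurableSpace Ω] [MeasurableSpace Ω']
  {P : Measure Ω} [IsProbabilityMeasure P] {P' : Measure Ω'} [IsProbabilityMeasure P']
  {X : Ω → EuclideanSpace ℝ (Fin d)} {Y : Ω → EuclideanSpace ℝ (Fin p)}
  {f : EuclideanSpace ℝ (Fin p) → ℝ} {u : EuclideanSpace ℝ (Fin d) → EuclideanSpace ℝ (Fin q)}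
  {Xs : ℕ → Ω' → EuclideanSpace ℝ (Fin d)} {Ys : ℕ → ℕ → Ω' → EuclideanSpace ℝ (Fin p)}

theorem matA_eq_zero (h : RegressionModel P X Y f u)
    (h0 : ∀ a, (fun ω => residual P X Y f u a (X ω)) =ᵐ[P] 0) : matA P X Y f u = 0 := by
  ext a b
  rw [h.matA_apply, integral_congr_ae (g := fun _ => (0 : ℝ))]
  · simp
  · filter_upwards [h0 a] with ω hω
    simp only [Pi.zero_apply] at hω
    rw [hω, zero_mul]

theorem exists_matA_diag_ne_zero (h : RegressionModel P X Y f u) (hA : matA P X Y f u ≠ 0) :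
    ∃ a, matA P X Y f u a a ≠ 0 := by
  by_contra! h0
  refine hA (h.matA_eq_zero fun a => ?_)
  have h1 := h0 a
  rw [h.matA_apply, integral_eq_zero_iff_of_nonneg (fun ω => mul_self_nonneg _)
    ((h.memLp_residual a).integrable_mul (h.memLp_residual a))] at h1
  filter_upwards [h1] with ω hω
  exact mul_self_eq_zero.mp hω

/-- The trace is the mean of `ρᵀ H⁻¹ ρ` for the residual vector `ρ`. If it vanished, `ρ` would be
zero almost surely and so would `A`. -/
theorem trace_matA_mul_inv_pos (h : RegressionModel P X Y f u) (hA : matA P X Y f u ≠ 0) :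
    0 < (matA P X Y f u * (matH P X u)⁻¹).trace := by
  have hJ := h.posDef.inv
  have hi : ∀ a b, Integrable (fun ω => (matH P X u)⁻¹ b a
      * (residual P X Y f u a (X ω) * residual P X Y f u b (X ω))) P := fun a b =>
    ((h.memLp_residual a).integrable_mul (h.memLp_residual b)).const_mul _
  have hi' := integrable_finsetSum Finset.univ fun a _ =>
    integrable_finsetSum Finset.univ fun b _ => hi a b
  have e : (matA P X Y f u * (matH P X u)⁻¹).trace
      = ∫ ω, ∑ a, ∑ b, (matH P X u)⁻¹ b a
        * (residual P X Y f u a (X ω) * residual P X Y f u b (X ω)) ∂P := by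
    rw [integral_finsetSum _ fun a _ => integrable_finsetSum _ fun b _ => hi a b]
    simp_rw [fun a => integral_finsetSum Finset.univ fun b _ => hi a b, integral_const_mul,
      ← h.matA_apply, Matrix.trace, Matrix.diag_apply, Matrix.mul_apply, mul_comm]
  have e2 : ∀ ω, ∑ a, ∑ b, (matH P X u)⁻¹ b a
        * (residual P X Y f u a (X ω) * residual P X Y f u b (X ω))
      = (fun a => residual P X Y f u a (X ω)) ⬝ᵥ (matH P X u)⁻¹ *ᵥ
        fun a => residual P X Y f u a (X ω) := by
    intro ω
    rw [dotProduct_mulVec_eq_sum, Finset.sum_comm]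
    exact Finset.sum_congr rfl fun a _ => Finset.sum_congr rfl fun b _ => by ring
  simp_rw [e2] at e hi'
  have hnn : ∀ ω, 0 ≤ (fun a => residual P X Y f u a (X ω)) ⬝ᵥ (matH P X u)⁻¹ *ᵥ
        fun a => residual P X Y f u a (X ω) := fun ω => by
    simpa using hJ.posSemidef.dotProduct_mulVec_nonneg fun a => residual P X Y f u a (X ω)
  rw [e]
  refine (integral_nonneg hnn).lt_of_ne' fun h0 => hA (h.matA_eq_zero fun a => ?_)
  rw [integral_eq_zero_iff_of_nonneg hnn hi'] at h0
  filter_upwards [h0] with ω hω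
  by_contra hne
  have := hJ.dotProduct_mulVec_pos (x := fun a => residual P X Y f u a (X ω))
    fun hz => hne (congrFun hz a)
  simp only [star_trivial] at this
  exact this.ne' hω

variable (h : RegressionModel P X Y f u) (hs : IsNestedSample P X Y P' Xs Ys) {ε : ℝ}
  (hε : 0 < ε) (hHε : (matH P X u - (2 * ε) • (1 : Matrix (Fin q) (Fin q) ℝ)).PosSemidef)
include h hs hε hHε

theorem integrable_quadForm_thetaHat {K : ℕ} (hK : 1 ≤ K) (N : ℕ) : Integrable (fun ω =>
    1 / 2 * ((thetaHat f u Xs Ys ε K N ω - thetaStar P X Y f u).ofLp ⬝ᵥ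
        matH P X u *ᵥ (thetaHat f u Xs Ys ε K N ω - thetaStar P X Y f u).ofLp)) P' :=
  (h.regressionSample hs hK).integrable_quadForm hε h.posDef hHε N

theorem integrable_vInf_thetaHat {K : ℕ} (hK : 1 ≤ K) (N : ℕ) :
    Integrable (fun ω => vInf P X Y f u (thetaHat f u Xs Ys ε K N ω)) P' := by
  refine ((h.integrable_quadForm_thetaHat hs hε hHε hK N).add
    (integrable_const (vInf P X Y f u (thetaStar P X Y f u)))).congr (.of_forall fun ω => ?_)
  simp only [Pi.add_apply]
  rw [← h.vInf_sub_vInf, sub_add_cancel]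

theorem meanExcess_eq {K : ℕ} (hK : 1 ≤ K) (N : ℕ) : meanExcess P X Y f u P' Xs Ys ε K N
    = ∫ ω, 1 / 2 * ((thetaHat f u Xs Ys ε K N ω - thetaStar P X Y f u).ofLp ⬝ᵥ
        matH P X u *ᵥ (thetaHat f u Xs Ys ε K N ω - thetaStar P X Y f u).ofLp) ∂P' := by
  simp_rw [← h.vInf_sub_vInf]
  rw [integral_sub (h.integrable_vInf_thetaHat hs hε hHε hK N) (integrable_const _)]
  simp [meanExcess]

theorem tendsto_natCast_mul_meanExcess {K : ℕ} (hK : 1 ≤ K) :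
    Tendsto (fun N : ℕ => (N : ℝ) * meanExcess P X Y f u P' Xs Ys ε K N) atTop
      (𝓝 (2 * (matGamma P X Y f u K * (matH P X u)⁻¹).trace)) := by
  simp_rw [h.meanExcess_eq hs hε hHε hK]
  exact (h.regressionSample hs hK).tendsto_integral_quadForm hε h.posDef hHε
    (h.matGamma_apply hs hK)

/-- First-order expansion of the mean risk. -/
theorem isLittleO_integral_vInf {K : ℕ} (hK : 1 ≤ K) :
    (fun N : ℕ => ∫ ω, vInf P X Y f u (thetaHat f u Xs Ys ε K N ω) ∂P'
        - (vInf P X Y f u (thetaStar P X Y f u)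
          + 2 * (matGamma P X Y f u K * (matH P X u)⁻¹).trace / N))
      =o[atTop] (fun N : ℕ => 1 / (N : ℝ)) := by
  refine (Asymptotics.isLittleO_iff_tendsto' ?_).mpr ?_
  · filter_upwards [eventually_gt_atTop 0] with N hN h0
    have : (N : ℝ) ≠ 0 := by positivity
    simp [this] at h0
  · have := (h.tendsto_natCast_mul_meanExcess hs hε hHε hK).sub_const
      (2 * (matGamma P X Y f u K * (matH P X u)⁻¹).trace)
    rw [sub_self] at this
    refine this.congr' ?_
    filter_upwards [eventually_gt_atTop 0] with N hN
    have : (N : ℝ) ≠ 0 := by positivity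
    simp only [meanExcess]
    field_simp
    ring

/-- Uniform integrability of the rescaled excess risk. -/
theorem uniformIntegrable_vInf {K : ℕ} (hK : 1 ≤ K) : UniformIntegrable
    (fun (N : ℕ) ω => (N : ℝ) * (vInf P X Y f u (thetaHat f u Xs Ys ε K N ω)
      - vInf P X Y f u (thetaStar P X Y f u))) 1 P' := by
  simp_rw [h.vInf_sub_vInf]
  exact (h.regressionSample hs hK).uniformIntegrable_quadForm hε h.posDef hHε

/-- The mean excess risk has the form `α N + β N / K`. -/
theorem exists_meanExcess_decomposition (hA : matA P X Y f u ≠ 0) : ∃ α β : ℕ → ℝ,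
    (∀ N, 1 ≤ N → 0 < α N) ∧ (∀ N, 0 ≤ β N) ∧
    Tendsto (fun N : ℕ => (N : ℝ) * α N) atTop
      (𝓝 (2 * (matA P X Y f u * (matH P X u)⁻¹).trace)) ∧
    Tendsto (fun N : ℕ => (N : ℝ) * β N) atTop
      (𝓝 (2 * (matB P X Y f u * (matH P X u)⁻¹).trace)) ∧
    ∀ N K, 1 ≤ N → 1 ≤ K → meanExcess P X Y f u P' Xs Ys ε K N = α N + β N / K := by
  have hc := h.covariateSample hs
  have hE : ∀ N K, 1 ≤ K → meanExcess P X Y f u P' Xs Ys ε K N = _ := fun N K hK =>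
    (h.meanExcess_eq hs hε hHε hK N).trans (h.integral_quadForm_thetaHat hs hε hK N)
  have hα := hc.tendsto_integral_quadForm hε h.posDef hHε (h.matA_apply_eq_score hs)
  refine ⟨_, _, fun N hN => ?_, fun N => ?_, hα, ?_, fun N K _ hK => hE N K hK⟩
  · obtain ⟨a, ha⟩ := h.exists_matA_diag_ne_zero hA
    refine hc.integral_quadForm_pos hε h.posDef hHε hN (a := a) ?_
    rw [h.matA_apply_eq_score hs] at ha
    simpa only [sq] using ha
  · refine Finset.sum_nonneg fun i _ => integral_nonneg fun ω => ?_
    have := h.posDef.posSemidef.dotProduct_mulVec_nonneg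
      (noise P X Y f (Xs i ω) (Ys i 0 ω) • noiseWeight u ε N i fun r => Xs r ω)
    simp only [star_trivial] at this
    simp only [Pi.zero_apply]
    positivity
  -- At `K = 1` the excess is `α N + β N`, so the limit for `β` is the difference of two known ones:
  -- `Γ^1 - A = B`.
  · have h1 := (h.tendsto_natCast_mul_meanExcess hs hε hHε le_rfl).sub hα
    have e : 2 * (matGamma P X Y f u 1 * (matH P X u)⁻¹).trace
        - 2 * (matA P X Y f u * (matH P X u)⁻¹).trace
        = 2 * (matB P X Y f u * (matH P X u)⁻¹).trace := by
      simp only [matGamma, Nat.cast_one, inv_one, one_smul, add_mul, Matrix.trace_add]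
      ring
    rw [e] at h1
    refine h1.congr fun N => ?_
    rw [hE N 1 le_rfl, Nat.cast_one, div_one]
    ring

end RegressionModel

end NestedRegression

open NestedRegression in
theorem mainTheorem5 {d p q : ℕ} {Ω Ω' : Type*} [MeasurableSpace Ω] [MeasurableSpace Ω']
    (P : Measure Ω) [IsProbabilityMeasure P] (P' : Measure Ω') [IsProbabilityMeasure P']
    (X : Ω → EuclideanSpace ℝ (Fin d)) (Y : Ω → EuclideanSpace ℝ (Fin p))
    (hX : Measurable X) (hY : Measurable Y)
    (f : EuclideanSpace ℝ (Fin p) → ℝ) (hf : Measurable f)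
    (hf2 : Integrable (fun ω => f (Y ω) ^ 2) P)
    (u : EuclideanSpace ℝ (Fin d) → EuclideanSpace ℝ (Fin q)) (hu : Measurable u)
    (Xs : ℕ → Ω' → EuclideanSpace ℝ (Fin d)) (Ys : ℕ → ℕ → Ω' → EuclideanSpace ℝ (Fin p))
    (hsample : IsNestedSample P X Y P' Xs Ys)
    (η : ℝ) (hη : 0 < η)
    (hu_mom : Integrable (fun ω => ‖u (X ω)‖ ^ (4 + η)) P)
    (hfu_mom : Integrable (fun ω => ‖f (Y ω) • u (X ω)‖ ^ (2 + η)) P)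
    (hH : (matH P X u).PosDef)
    (ε : ℝ) (hε : 0 < ε)
    (hHε : (matH P X u - (2 * ε) • (1 : Matrix (Fin q) (Fin q) ℝ)).PosDef) :
    (∀ K : ℕ, 1 ≤ K →
      -- almost sure convergence
      (∀ᵐ ω ∂P', Tendsto (fun N => thetaHat f u Xs Ys ε K N ω) atTop (𝓝 (thetaStar P X Y f u))) ∧
      -- central limit theorem
      TendstoInDistribution
        (fun (N : ℕ) ω => √(N : ℝ) • (thetaHat f u Xs Ys ε K N ω - thetaStar P X Y f u)) atTop
        id (fun _ => P')
        (multivariateGaussian 0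
          ((4 : ℝ) • ((matH P X u)⁻¹ * matGamma P X Y f u K * (matH P X u)⁻¹))) ∧
      -- uniform integrability
      UniformIntegrable
        (fun (N : ℕ) ω => (N : ℝ) * (vInf P X Y f u (thetaHat f u Xs Ys ε K N ω)
          - vInf P X Y f u (thetaStar P X Y f u))) 1 P' ∧
      -- first-order expansion of the mean
      (∀ N : ℕ, Integrable (fun ω => vInf P X Y f u (thetaHat f u Xs Ys ε K N ω)) P') ∧
      (fun N : ℕ => ∫ ω, vInf P X Y f u (thetaHat f u Xs Ys ε K N ω) ∂P'
          - (vInf P X Y f u (thetaStar P X Y f u)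
            + 2 * (matGamma P X Y f u K * (matH P X u)⁻¹).trace / N))
        =o[atTop] (fun N : ℕ => 1 / (N : ℝ))) ∧
    -- asymptotically optimal allocation of a budget `c` when sampling `Y` given `X` costs `κ`
    (matA P X Y f u ≠ 0 → ∀ κ : ℝ, 0 < κ →
      (∀ᶠ c : ℝ in atTop, 1 ≤ Kstar P X Y f u κ ∧ 1 ≤ Nstar P X Y f u κ c ∧
        (Nstar P X Y f u κ c : ℝ) + Nstar P X Y f u κ c * Kstar P X Y f u κ * κ ≤ c) ∧
      Asymptotics.IsEquivalent atTop
        (fun c : ℝ =>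
          meanExcess P X Y f u P' Xs Ys ε (Kstar P X Y f u κ) (Nstar P X Y f u κ c))
        (fun c : ℝ => bestExcess P X Y f u P' Xs Ys ε κ c)) := by
  have h := RegressionModel.of_moments hX hY hf hf2 hu hη hu_mom hfu_mom hH
  have hs := hsample
  have hHε' := hHε.posSemidef
  refine ⟨fun K hK => ?_, fun hA κ hκ => ?_⟩
  · have hr := h.regressionSample hs hK
    -- `thetaHat` unfolds to the floored estimator of the blocks, so the i.i.d. limit theorems apply
    -- as they stand.
    exact ⟨hr.tendsto_floorEstimator hε hH hHε',
      hr.tendstoInDistribution_floorEstimator hε hH hHε' (h.matGamma_apply hs hK),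
      h.uniformIntegrable_vInf hs hε hHε' hK, h.integrable_vInf_thetaHat hs hε hHε' hK,
      h.isLittleO_integral_vInf hs hε hHε' hK⟩
  · have hK : 1 ≤ Kstar P X Y f u κ := (nu_spec _).1
    have hpos : 0 < 1 + (Kstar P X Y f u κ : ℝ) * κ := by positivity
    refine ⟨?_, ?_⟩
    · filter_upwards [eventually_ge_atTop (1 + (Kstar P X Y f u κ : ℝ) * κ)] with c hc
      exact ⟨hK, one_le_floor_allocation hpos hc,
        floor_allocation_cost_le (hpos.le.trans hc) hpos⟩
    · obtain ⟨α, β, hα, hβ, hαl, hβl, hE⟩ := h.exists_meanExcess_decomposition hs hε hHε' hA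
      -- The limits of `N α N` and `N β N` both carry a factor `2`, which cancels in the ratio.
      have hKs : Kstar P X Y f u κ = nu (2 * (matB P X Y f u * (matH P X u)⁻¹).trace
          / (κ * (2 * (matA P X Y f u * (matH P X u)⁻¹).trace))) := by
        rw [Kstar, mul_left_comm, mul_div_mul_left _ _ two_ne_zero]
      have := isEquivalent_floor_allocation hα hβ hαl hβl
        (mul_pos two_pos (h.trace_matA_mul_inv_pos hA)) hκ hE
      rw [← hKs] at this
      exact this
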